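/- **Conventions.** For a closed interval $\Delta=[\alpha,\beta]$, $\alpha<\beta$, let $D_\Delta=\overline{\mathbb C}\setminus\Delta$, let $d\omega_\Delta(x)=\frac{dx}{\pi\sqrt{(x-\alpha)(\beta-x)}}$ be its arcsine distribution, and let $\phi_\Delta$ be the conformal map of $D_\Delta$ onto the unit disk $\mathbb D$ with $\phi_\Delta(\infty)=0$, $\phi_\Delta(\beta)=1$. A function $G$ is an outer function in $H^2(D_\Delta)$ if $G\circ\phi_\Delta^{-1}$ is an outer function in $H^2(\mathbb D)$, that is, if $$G(\phi_\Delta^{-1}(z))=c\,\exp\Big(\frac1{2\pi}\int_0^{2\pi}\frac{e^{it}+z}{e^{it}-z}\log\psi(t)\,dt\Big),\qquad z\in\mathbb D,$$ with $|c|=1$, $\psi\ge0$, $\log\psi\in L^1$, $\psi\in L^2$ on $[0,2\pi]$. For a finite compactly supported positive Borel measure $\mu$ on $\mathbb R$ let $\Delta(\mu)$ be the convex hull of $\operatorname{supp}\mu$, let $\mu'$ be the Lebesgue density of its absolutely continuous part, and let $v_\Delta$ be the Radon–Nikodym derivative of (the absolutely continuous part of) $\mu_{|\Delta}$ with respect to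 $\omega_\Delta$. We write $\mu\in\mathrm{Sz}(\Delta)$ if $\Delta\subseteq\Delta(\mu)$ and $\log\mu'\in L^1(\omega_\Delta)$ (with $\log 0=-\infty$). We write $\mu\in\mathrm{USz}(\Delta)$ if $\mu\in\mathrm{Sz}(\Delta)$ and for every sequence of closed intervals $\Delta_n\subseteq\Delta(\mu)$ with $\Delta_n\to\Delta$ (convergence of endpoints) there is $n_0$ such that $\mu\in\mathrm{Sz}(\Delta_n)$ for $n\ge n_0$, and $$\lim_{n\to\infty}\int\big|\log\mu'(x)-\log\mu'(l_{\Delta\to\Delta_n}(x))\big|\,d\omega_\Delta(x)=0,$$ where $l_{\Delta\to\Delta_n}$ is the increasing affine map of $\Delta$ onto $\Delta_n$. Given pairwise disjoint closed intervals $\Delta_1,\dots,\Delta_d$ and measures $\mu_1,\dots,\mu_d$, *vector Szegő functions* for $\{\Delta_i\}$ are functions $\{S_i\}_{i=1}^d$ such that each $S_i$ is a conjugate-symmetric outer function in $H^2(D_{\Delta_i})$ with $S_i(\infty)>0$, and $$|S_{i\pm}(x)|^2\prod_{j\ne i}S_j(x)=v_{\Delta_i}(x)\quad\text{for a.e. }x\in\Delta_i,\quad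 i=1,\dots,d,$$ where $v_{\Delta_i}$ is taken for $\mu_i$ and $|S_{i\pm}|$ are the non-tangential limits of $|S_i|$ from above and below $\Delta_i$. **Proposition 3.2.** Let $\Delta_1,\dots,\Delta_d$ be pairwise disjoint closed non-degenerate intervals and let $\mu_1,\dots,\mu_d$ be finite compactly supported positive Borel measures on $\mathbb R$ with $\mu_i\in\mathrm{USz}(\Delta_i)$ for each $i$. For each $n\in\mathbb N$ let $\Delta_{n,1},\dots,\Delta_{n,d}$ be pairwise disjoint closed non-degenerate intervals with $\Delta_{n,i}\subseteq\Delta(\mu_i)$, such that $\Delta_{n,i}\to\Delta_i$ as $n\to\infty$ for each $i$. Then vector Szegő functions exist for $\{\Delta_i\}$ and, for all $n$ large enough, for $\{\Delta_{n,i}\}$; and for any vector Szegő functions $\{S_i\}$ for $\{\Delta_i\}$ and $\{S_{n,i}\}$ for $\{\Delta_{n,i}\}$, $n$ large, $$S_{n,i}(z)\to S_i(z)\quad\text{as }n\to\infty$$ locally uniformly in $D_{\Delta_i}$ (including at $\infty$) for each $i=1,\dots,d$. -/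

import Mathlib

open MeasureTheory Filter Topology

noncomputable section

namespace VectorSzego

/-- The convex hull `Δ(μ)` of the support of a Borel measure on the real line. -/
def hullSupport (μ : Measure ℝ) : Set ℝ := convexHull ℝ μ.support

/-- The density `μ'` of the absolutely continuous part of `μ` with respect to Lebesgue measure. -/
def density (μ : Measure ℝ) (x : ℝ) : ℝ := (μ.rnDeriv volume x).toReal

/-- The arcsine distribution `ω_Δ` of the interval `Δ = [a, b]`:
`dω_Δ(x) = dx / (π √((x - a)(b - x)))` on `[a, b]`. -/
def arcsine (a b : ℝ) : Measure ℝ :=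
  (volume.restrict (Set.Icc a b)).withDensity
    (fun x => ENNReal.ofReal (1 / (Real.pi * Real.sqrt ((x - a) * (b - x)))))

/-- `v_Δ`: the Radon–Nikodym derivative with respect to `ω_Δ` of the restriction of `μ` to
`Δ = [a, b]`. -/
def arcsineDensity (μ : Measure ℝ) (a b : ℝ) (x : ℝ) : ℝ :=
  ((μ.restrict (Set.Icc a b)).rnDeriv (arcsine a b) x).toReal

/-- `μ ∈ Sz(Δ)`, `Δ = [a, b]`: the interval lies in `Δ(μ)` and `log μ' ∈ L¹(ω_Δ)`.
Since `log 0 = -∞` in the mathematical definition, integrability of `log μ'` includes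
`μ' > 0` almost everywhere on `Δ`; this is said separately because `Real.log 0 = 0`. -/
def IsSzego (μ : Measure ℝ) (a b : ℝ) : Prop :=
  Set.Icc a b ⊆ hullSupport μ ∧
  (∀ᵐ x ∂(volume.restrict (Set.Icc a b)), 0 < density μ x) ∧
  Integrable (fun x => Real.log (density μ x)) (arcsine a b)

/-- The increasing affine map of `[a, b]` onto `[a', b']`. -/
def affineMap (a b a' b' x : ℝ) : ℝ := a' + (b' - a') / (b - a) * (x - a)

/-- `μ ∈ USz(Δ)`, `Δ = [a, b]`: `μ` is a Szegő measure on `Δ` and, for every sequence of closed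
intervals `Δₙ = [aₙ, bₙ] ⊆ Δ(μ)` converging to `Δ`, `μ` is eventually a Szegő measure on `Δₙ` and
`∫ |log μ'(x) - log μ'(lₙ(x))| dω_Δ(x) → 0`, where `lₙ` is the increasing affine map of `Δ`
onto `Δₙ`. -/
def IsUniformlySzego (μ : Measure ℝ) (a b : ℝ) : Prop :=
  IsSzego μ a b ∧
  ∀ a' b' : ℕ → ℝ, (∀ n, a' n < b' n) → (∀ n, Set.Icc (a' n) (b' n) ⊆ hullSupport μ) →
    Tendsto a' atTop (𝓝 a) → Tendsto b' atTop (𝓝 b) →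
    (∃ n₀ : ℕ, ∀ n ≥ n₀, IsSzego μ (a' n) (b' n)) ∧
    Tendsto (fun n => ∫⁻ x, ENNReal.ofReal |Real.log (density μ x) -
      Real.log (density μ (affineMap a b (a' n) (b' n) x))| ∂(arcsine a b)) atTop (𝓝 0)

/-- The real interval `[a, b]` as a subset of the Riemann sphere. -/
def slit (a b : ℝ) : Set (OnePoint ℂ) := (fun x : ℝ => ((x : ℂ) : OnePoint ℂ)) '' Set.Icc a b

/-- The domain `D_Δ`: the complement of `Δ = [a, b]` in the Riemann sphere. -/
def slitDomain (a b : ℝ) : Set (OnePoint ℂ) := (slit a b)ᶜ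

/-- The conformal map of the open unit disk onto `D_Δ`, `Δ = [a, b]`, that sends `0` to `∞` and
(on the boundary) `1` to `b`. It is the inverse of the map
`φ_Δ(z) = 2 / (b - a) * (z - (a + b) / 2 - √((z - a)(z - b)))`. -/
def phiInv (a b : ℝ) (w : ℂ) : OnePoint ℂ :=
  open Classical in
  if w = 0 then OnePoint.infty
  else (((a + b) / 2 + (b - a) / 4 * (w + w⁻¹) : ℂ) : OnePoint ℂ)

/-- Outer functions of the Hardy space `H²` of the unit disk:
`F(z) = c * exp ((1 / 2π) ∫₀^{2π} (e^{it} + z) / (e^{it} - z) log ψ(t) dt)` in the disk, where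
`|c| = 1`, `ψ ≥ 0`, `log ψ ∈ L¹` (in particular `ψ > 0` almost everywhere) and `ψ ∈ L²`.
Every such function belongs to `H²`. -/
def IsOuterDisk (F : ℂ → ℂ) : Prop :=
  ∃ (c : ℂ) (ψ : ℝ → ℝ), ‖c‖ = 1 ∧
    (∀ᵐ t ∂(volume.restrict (Set.Ioc 0 (2 * Real.pi))), 0 < ψ t) ∧
    IntegrableOn (fun t => Real.log (ψ t)) (Set.Ioc 0 (2 * Real.pi)) ∧
    MemLp ψ 2 (volume.restrict (Set.Ioc 0 (2 * Real.pi))) ∧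
    ∀ z : ℂ, ‖z‖ < 1 →
      F z = c * Complex.exp ((1 / (2 * Real.pi) : ℂ) *
        ∫ t in Set.Ioc 0 (2 * Real.pi),
          (Complex.exp (t * Complex.I) + z) / (Complex.exp (t * Complex.I) - z) *
            (Real.log (ψ t) : ℂ))

/-- Outer functions of `H²(D_Δ)`, `Δ = [a, b]`: those which become outer functions of the Hardy
space `H²` of the disk after composition with the inverse of `φ_Δ`. -/
def IsOuter (a b : ℝ) (S : OnePoint ℂ → ℂ) : Prop :=
  IsOuterDisk (fun w => S (phiInv a b w))

/-- Conjugate symmetry `S(z̄) = conj S(z)` in `D_Δ` (the condition at infinity says that the value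
`S(∞)` is real). -/
def IsConjSymm (a b : ℝ) (S : OnePoint ℂ → ℂ) : Prop :=
  (∀ z : ℂ, (z : OnePoint ℂ) ∈ slitDomain a b →
    S ((starRingEnd ℂ z : ℂ) : OnePoint ℂ) = starRingEnd ℂ (S (z : OnePoint ℂ))) ∧
  starRingEnd ℂ (S OnePoint.infty) = S OnePoint.infty

/-- `|S₊(x)| = m`: the function `|S|` has the non-tangential limit `m` at the real point `x`
from the upper half-plane. -/
def HasUpperModulus (S : OnePoint ℂ → ℂ) (x m : ℝ) : Prop :=
  ∀ κ : ℝ, 0 < κ →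
    Tendsto (fun z : ℂ => ‖S (z : OnePoint ℂ)‖) (𝓝[{z : ℂ | |z.re - x| < κ * z.im}] (x : ℂ)) (𝓝 m)

/-- `|S₋(x)| = m`: the function `|S|` has the non-tangential limit `m` at the real point `x`
from the lower half-plane. -/
def HasLowerModulus (S : OnePoint ℂ → ℂ) (x m : ℝ) : Prop :=
  ∀ κ : ℝ, 0 < κ →
    Tendsto (fun z : ℂ => ‖S (z : OnePoint ℂ)‖)
      (𝓝[{z : ℂ | |z.re - x| < κ * (-z.im)}] (x : ℂ)) (𝓝 m)

/-- `S = (S₁, …, S_d)` is the vector Szegő function of the measures `μ₁, …, μ_d` on the intervals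
`Δᵢ = [aᵢ, bᵢ]`: each `Sᵢ` is a conjugate-symmetric outer function in `H²(D_{Δᵢ})`, positive at
infinity, and for almost every `x ∈ Δᵢ`
`|S_{i±}(x)|² ∏_{j ≠ i} S_j(x) = v_{Δᵢ}(x)`.
Only the values of `Sᵢ` on `D_{Δᵢ}` matter. -/
def IsVectorSzego {d : ℕ} (μ : Fin d → Measure ℝ) (a b : Fin d → ℝ)
    (S : Fin d → OnePoint ℂ → ℂ) : Prop :=
  ∀ i,
    IsOuter (a i) (b i) (S i) ∧
    IsConjSymm (a i) (b i) (S i) ∧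
    (0 < (S i OnePoint.infty).re ∧ (S i OnePoint.infty).im = 0) ∧
    ∀ᵐ x ∂(volume.restrict (Set.Icc (a i) (b i))), ∃ p m : ℝ,
      HasUpperModulus (S i) x p ∧ HasLowerModulus (S i) x m ∧
      (p : ℂ) ^ 2 * ∏ j ∈ Finset.univ.erase i, S j ((x : ℂ) : OnePoint ℂ) =
        (arcsineDensity (μ i) (a i) (b i) x : ℂ) ∧
      (m : ℂ) ^ 2 * ∏ j ∈ Finset.univ.erase i, S j ((x : ℂ) : OnePoint ℂ) =
        (arcsineDensity (μ i) (a i) (b i) x : ℂ)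

end VectorSzego

end

noncomputable section

namespace VectorSzego

/-! The boundary value problem is linearised by taking logarithms. Transplanted to the unit disk,
each `S i` is the exponential of a Herglotz integral whose boundary datum `v i` is the logarithm of
the modulus on the slit. With `F i` half the logarithm of the arcsine density, the boundary
condition reads `2 v i + ∑_{j ≠ i} P j v j = 2 F i` on the `i`-th interval, where `P j` is harmonic
extension off the `j`-th slit. The products of the other functions are positive there by conjugate
symmetry, so moduli carry all the information.

The datum `F i` is merely integrable, but the coupling sees it only at a positive distance from the
`j`-th slit. Writing `v = F + g` therefore gives an equation `(2 + T) g = -T F` whose right-hand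
side is continuous, and the correction `g` can be sought among continuous functions on `d` copies of
`[-1, 1]`, a space that does not depend on the intervals. The operator `T` is compact
(Arzelà–Ascoli), and `-2` is not an eigenvalue: for a solution of the homogeneous equation, the sum
of the harmonic extensions is shown by the strong maximum principle on the whole sphere to be
constant, and the constant must be zero (`eq_zero_of_homogeneous`). The Fredholm alternative then
gives both solvability and the bound `‖g‖ ≤ K ‖(2 + T) g‖`.

Conversely, every family of vector Szegő functions comes from a solution `g`. Positivity at infinity
removes the unimodular constant, and Fatou's theorem identifies the boundary datum with the
logarithm of the non-tangential modulus (`IsVectorSzego.exists_isCorrection`).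

For convergence, the uniform Szegő condition says exactly that the logarithmic densities converge in
`L¹` once all intervals are parametrised by `cos t`. The operators `T_n` converge to `T` in norm and
`T_n F_n` converges uniformly to `T F`, so the bound for the limiting operator alone forces `g_n →
g` (`tendsto_correction`). The Herglotz integral is jointly continuous in its `L¹` datum and its
point, and the conformal maps depend continuously on the end-points. This yields locally uniform
convergence, with infinity an ordinary point of the domain. -/

/-! ### Herglotz and Poisson integrals in the unit disk -/

/-- The Herglotz integral of a real function on the circle, parametrised by the angle. -/
def herglotz (k : ℝ → ℝ) (w : ℂ) : ℂ :=
  (1 / (2 * Real.pi) : ℂ) * ∫ t in Set.Ioc 0 (2 * Real.pi),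
    (Complex.exp (t * Complex.I) + w) / (Complex.exp (t * Complex.I) - w) * (k t : ℂ)

/-- The Poisson kernel of the unit disk, parametrised by the angle. -/
def poisson (w : ℂ) (t : ℝ) : ℝ := (1 - ‖w‖ ^ 2) / ‖Complex.exp (t * Complex.I) - w‖ ^ 2

/-- Integrability over one period of the angle. -/
abbrev IntegrableAngle (k : ℝ → ℝ) : Prop := IntegrableOn k (Set.Ioc 0 (2 * Real.pi))

lemma one_sub_norm_le_norm_exp_sub (w : ℂ) (t : ℝ) :
    1 - ‖w‖ ≤ ‖Complex.exp (t * Complex.I) - w‖ := by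
  have := norm_sub_norm_le (Complex.exp (t * Complex.I)) w
  rwa [Complex.norm_exp_ofReal_mul_I] at this

lemma exp_sub_ne_zero {w : ℂ} (hw : ‖w‖ < 1) (t : ℝ) : Complex.exp (t * Complex.I) - w ≠ 0 := by
  have := one_sub_norm_le_norm_exp_sub w t
  exact norm_pos_iff.1 (by linarith)

lemma norm_herglotzKernel_le {w : ℂ} (hw : ‖w‖ < 1) (t : ℝ) :
    ‖(Complex.exp (t * Complex.I) + w) / (Complex.exp (t * Complex.I) - w)‖ ≤ 2 / (1 - ‖w‖) := by
  rw [norm_div]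
  have h1 := one_sub_norm_le_norm_exp_sub w t
  have h2 := norm_add_le (Complex.exp (t * Complex.I)) w
  rw [Complex.norm_exp_ofReal_mul_I] at h2
  have : 0 < 1 - ‖w‖ := by linarith
  gcongr
  linarith

lemma norm_herglotzKernel_sub_le {w w' : ℂ} (hw : ‖w‖ < 1) (hw' : ‖w'‖ < 1) (t : ℝ) :
    ‖(Complex.exp (t * Complex.I) + w) / (Complex.exp (t * Complex.I) - w) -
      (Complex.exp (t * Complex.I) + w') / (Complex.exp (t * Complex.I) - w')‖ ≤
      2 * ‖w - w'‖ / ((1 - ‖w‖) * (1 - ‖w'‖)) := by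
  have e : (Complex.exp (t * Complex.I) + w) / (Complex.exp (t * Complex.I) - w) -
      (Complex.exp (t * Complex.I) + w') / (Complex.exp (t * Complex.I) - w') =
      2 * Complex.exp (t * Complex.I) * (w - w') /
        ((Complex.exp (t * Complex.I) - w) * (Complex.exp (t * Complex.I) - w')) := by
    have h1 := exp_sub_ne_zero hw t
    have h2 := exp_sub_ne_zero hw' t
    field_simp
    ring
  rw [e, norm_div, norm_mul, norm_mul, norm_mul, Complex.norm_exp_ofReal_mul_I]
  have h1 := one_sub_norm_le_norm_exp_sub w t
  have h2 := one_sub_norm_le_norm_exp_sub w' t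
  have : 0 < 1 - ‖w‖ := by linarith
  have : 0 < 1 - ‖w'‖ := by linarith
  simp only [Complex.norm_ofNat, mul_one]
  gcongr

lemma continuous_herglotzKernel {w : ℂ} (hw : ‖w‖ < 1) :
    Continuous fun t : ℝ =>
      (Complex.exp (t * Complex.I) + w) / (Complex.exp (t * Complex.I) - w) := by
  refine Continuous.div (by fun_prop) (by fun_prop) (exp_sub_ne_zero hw)

lemma continuous_poisson {w : ℂ} (hw : ‖w‖ < 1) : Continuous (poisson w) := by
  unfold poisson
  refine Continuous.div (by fun_prop) (by fun_prop) fun t => ?_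
  exact pow_ne_zero 2 (norm_ne_zero_iff.2 (exp_sub_ne_zero hw t))

lemma poisson_pos {w : ℂ} (hw : ‖w‖ < 1) (t : ℝ) : 0 < poisson w t := by
  have := norm_pos_iff.2 (exp_sub_ne_zero hw t)
  have h : 0 < 1 - ‖w‖ ^ 2 := by nlinarith [norm_nonneg w]
  unfold poisson
  positivity

lemma re_herglotzKernel (w : ℂ) (t : ℝ) :
    ((Complex.exp (t * Complex.I) + w) / (Complex.exp (t * Complex.I) - w)).re = poisson w t := by
  have := congrFun (poissonKernel_eq_re_herglotzRieszKernel (c := 0) (w := w))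
    (Complex.exp (t * Complex.I))
  simp only [poissonKernel, herglotzRieszKernel, Function.comp_apply, sub_zero,
    Complex.norm_exp_ofReal_mul_I, one_pow] at this
  rw [← this, poisson]

lemma integrableOn_herglotz {k : ℝ → ℝ} (hk : IntegrableAngle k) {w : ℂ} (hw : ‖w‖ < 1) :
    IntegrableOn (fun t : ℝ => (Complex.exp (t * Complex.I) + w) /
      (Complex.exp (t * Complex.I) - w) * (k t : ℂ)) (Set.Ioc 0 (2 * Real.pi)) :=
  (Integrable.ofReal (𝕜 := ℂ) hk).bdd_mul (continuous_herglotzKernel hw).aestronglyMeasurable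
    (Eventually.of_forall (norm_herglotzKernel_le hw))

lemma integrableOn_poisson_mul {k : ℝ → ℝ} (hk : IntegrableAngle k) {w : ℂ} (hw : ‖w‖ < 1) :
    IntegrableAngle (fun t => poisson w t * k t) := by
  refine Integrable.bdd_mul hk (continuous_poisson hw).aestronglyMeasurable
    (c := 2 / (1 - ‖w‖)) (Eventually.of_forall fun t => ?_)
  rw [← re_herglotzKernel, Real.norm_eq_abs]
  exact (Complex.abs_re_le_norm _).trans (norm_herglotzKernel_le hw t)

lemma re_herglotz {k : ℝ → ℝ} (hk : IntegrableAngle k) {w : ℂ} (hw : ‖w‖ < 1) :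
    (herglotz k w).re = (2 * Real.pi)⁻¹ * ∫ t in Set.Ioc 0 (2 * Real.pi), poisson w t * k t := by
  have h : ((1 / (2 * Real.pi) : ℂ)) = (((2 * Real.pi)⁻¹ : ℝ) : ℂ) := by push_cast; simp
  rw [herglotz, h, Complex.re_ofReal_mul]
  congr 1
  rw [← RCLike.re_eq_complex_re, ← integral_re (integrableOn_herglotz hk hw)]
  refine integral_congr_ae (Eventually.of_forall fun t => ?_)
  simp only [RCLike.re_eq_complex_re]
  rw [Complex.re_mul_ofReal, re_herglotzKernel]

lemma herglotz_congr {k k' : ℝ → ℝ}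
    (h : ∀ᵐ t ∂(volume.restrict (Set.Ioc 0 (2 * Real.pi))), k t = k' t) (w : ℂ) :
    herglotz k w = herglotz k' w := by
  unfold herglotz
  congr 1
  refine integral_congr_ae ?_
  filter_upwards [h] with t ht
  rw [ht]

lemma herglotz_add {k k' : ℝ → ℝ} (hk : IntegrableAngle k) (hk' : IntegrableAngle k') {w : ℂ}
    (hw : ‖w‖ < 1) : herglotz (fun t => k t + k' t) w = herglotz k w + herglotz k' w := by
  unfold herglotz
  rw [← mul_add, ← integral_add (integrableOn_herglotz hk hw) (integrableOn_herglotz hk' hw)]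
  congr 1
  refine integral_congr_ae (Eventually.of_forall fun t => ?_)
  simp [mul_add]

lemma herglotz_const_mul (c : ℝ) (k : ℝ → ℝ) (w : ℂ) :
    herglotz (fun t => c * k t) w = c * herglotz k w := by
  unfold herglotz
  rw [mul_left_comm, ← integral_const_mul (μ := volume.restrict (Set.Ioc 0 (2 * Real.pi)))
    (r := (c : ℂ))]
  congr 1
  refine integral_congr_ae (Eventually.of_forall fun t => ?_)
  simp only [Complex.ofReal_mul]
  ring

lemma herglotz_sub {k k' : ℝ → ℝ} (hk : IntegrableAngle k) (hk' : IntegrableAngle k') {w : ℂ}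
    (hw : ‖w‖ < 1) : herglotz (fun t => k t - k' t) w = herglotz k w - herglotz k' w := by
  have := herglotz_add (k' := fun t => (-1) * k' t) hk (hk'.const_mul (-1)) hw
  rw [herglotz_const_mul] at this
  simp only [Complex.ofReal_neg, Complex.ofReal_one, neg_mul, one_mul, ← sub_eq_add_neg] at this
  exact this

lemma norm_herglotz_le {k : ℝ → ℝ} (hk : IntegrableAngle k) {w : ℂ} (hw : ‖w‖ < 1) :
    ‖herglotz k w‖ ≤ 2 / (1 - ‖w‖) * ∫ t in Set.Ioc 0 (2 * Real.pi), |k t| := by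
  have h1 : ‖∫ t in Set.Ioc 0 (2 * Real.pi), (Complex.exp (t * Complex.I) + w) /
      (Complex.exp (t * Complex.I) - w) * (k t : ℂ)‖ ≤
      2 / (1 - ‖w‖) * ∫ t in Set.Ioc 0 (2 * Real.pi), |k t| := by
    rw [← integral_const_mul]
    refine norm_integral_le_of_norm_le (hk.abs.const_mul _) (Eventually.of_forall fun t => ?_)
    rw [norm_mul, Complex.norm_real, Real.norm_eq_abs]
    gcongr
    exact norm_herglotzKernel_le hw t
  -- The factor `1 / (2π)` is simply bounded by one; no sharp constant is needed.
  have h2 : ‖(1 / (2 * Real.pi) : ℂ)‖ ≤ 1 := by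
    have : (1 / (2 * Real.pi) : ℂ) = ((1 / (2 * Real.pi) : ℝ) : ℂ) := by push_cast; rfl
    rw [this, Complex.norm_real, Real.norm_eq_abs, abs_of_nonneg (by positivity),
      div_le_one (by positivity)]
    linarith [Real.pi_gt_three]
  rw [herglotz, norm_mul]
  calc _ ≤ 1 * _ := mul_le_mul h2 h1 (norm_nonneg _) zero_le_one
    _ = _ := one_mul _

lemma norm_herglotz_sub_le {k : ℝ → ℝ} (hk : IntegrableAngle k) {w w' : ℂ} (hw : ‖w‖ < 1)
    (hw' : ‖w'‖ < 1) : ‖herglotz k w - herglotz k w'‖ ≤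
      2 * ‖w - w'‖ / ((1 - ‖w‖) * (1 - ‖w'‖)) * ∫ t in Set.Ioc 0 (2 * Real.pi), |k t| := by
  rw [herglotz, herglotz, ← mul_sub,
    ← integral_sub (integrableOn_herglotz hk hw) (integrableOn_herglotz hk hw'), norm_mul]
  have h1 : ‖∫ t in Set.Ioc 0 (2 * Real.pi), ((Complex.exp (t * Complex.I) + w) /
      (Complex.exp (t * Complex.I) - w) * (k t : ℂ) - (Complex.exp (t * Complex.I) + w') /
      (Complex.exp (t * Complex.I) - w') * (k t : ℂ))‖ ≤
      2 * ‖w - w'‖ / ((1 - ‖w‖) * (1 - ‖w'‖)) * ∫ t in Set.Ioc 0 (2 * Real.pi), |k t| := by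
    rw [← integral_const_mul]
    refine norm_integral_le_of_norm_le (hk.abs.const_mul _) (Eventually.of_forall fun t => ?_)
    rw [← sub_mul, norm_mul, Complex.norm_real, Real.norm_eq_abs]
    gcongr
    exact norm_herglotzKernel_sub_le hw hw' t
  have h2 : ‖(1 / (2 * Real.pi) : ℂ)‖ ≤ 1 := by
    have : (1 / (2 * Real.pi) : ℂ) = ((1 / (2 * Real.pi) : ℝ) : ℂ) := by push_cast; rfl
    rw [this, Complex.norm_real, Real.norm_eq_abs, abs_of_nonneg (by positivity),
      div_le_one (by positivity)]
    linarith [Real.pi_gt_three]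
  calc _ ≤ 1 * _ := mul_le_mul h2 h1 (norm_nonneg _) zero_le_one
    _ = _ := one_mul _

/-- The Herglotz integral is jointly continuous in the boundary function (in `L¹`) and the point. -/
lemma tendsto_herglotz {α : Type*} {l : Filter α} {k : α → ℝ → ℝ} {k₀ : ℝ → ℝ} {w : α → ℂ} {w₀ : ℂ}
    (hk₀ : IntegrableAngle k₀) (hw₀ : ‖w₀‖ < 1) (hk : ∀ᶠ a in l, IntegrableAngle (k a))
    (hkl : Tendsto (fun a => ∫ t in Set.Ioc 0 (2 * Real.pi), |k a t - k₀ t|) l (𝓝 0))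
    (hw : Tendsto w l (𝓝 w₀)) :
    Tendsto (fun a => herglotz (k a) (w a)) l (𝓝 (herglotz k₀ w₀)) := by
  rw [tendsto_iff_norm_sub_tendsto_zero]
  have hn : Tendsto (fun a => ‖w a‖) l (𝓝 ‖w₀‖) := hw.norm
  have hlt : ∀ᶠ a in l, ‖w a‖ < 1 := hn.eventually_lt_const hw₀
  have hd : Tendsto (fun a => ‖w a - w₀‖) l (𝓝 0) := tendsto_iff_norm_sub_tendsto_zero.1 hw
  have h0 : 1 - ‖w₀‖ ≠ 0 := by linarith
  have key : Tendsto (fun a => 2 / (1 - ‖w a‖) *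
      (∫ t in Set.Ioc 0 (2 * Real.pi), |k a t - k₀ t|) +
      2 * ‖w a - w₀‖ / ((1 - ‖w a‖) * (1 - ‖w₀‖)) *
        ∫ t in Set.Ioc 0 (2 * Real.pi), |k₀ t|) l
      (𝓝 (2 / (1 - ‖w₀‖) * 0 + 2 * 0 / ((1 - ‖w₀‖) * (1 - ‖w₀‖)) *
        ∫ t in Set.Ioc 0 (2 * Real.pi), |k₀ t|)) := by
    refine ((Tendsto.div tendsto_const_nhds (tendsto_const_nhds.sub hn) h0).mul hkl).add
      (Tendsto.mul_const _ (Tendsto.div (hd.const_mul 2)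
        ((tendsto_const_nhds.sub hn).mul_const _) (mul_ne_zero h0 h0)))
  simp only [mul_zero, zero_div, zero_mul, add_zero] at key
  refine squeeze_zero' (Eventually.of_forall fun _ => norm_nonneg _) ?_ key
  filter_upwards [hlt, hk] with a ha hka
  have e : herglotz (k a) (w a) - herglotz k₀ w₀ =
      herglotz (fun t => k a t - k₀ t) (w a) + (herglotz k₀ (w a) - herglotz k₀ w₀) := by
    rw [herglotz_sub hka hk₀ ha]; ring
  rw [e]
  exact (norm_add_le _ _).trans
    (add_le_add (norm_herglotz_le (hka.sub hk₀) ha) (norm_herglotz_sub_le hk₀ ha hw₀))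

lemma continuousAt_herglotz {k : ℝ → ℝ} (hk : IntegrableAngle k) {w : ℂ} (hw : ‖w‖ < 1) :
    ContinuousAt (herglotz k) w :=
  tendsto_herglotz hk hw (Eventually.of_forall fun _ => hk) (by simp) tendsto_id

/-- This is the Poisson formula applied to the constant function one. -/
lemma integral_poisson {w : ℂ} (hw : ‖w‖ < 1) :
    ∫ t in Set.Ioc 0 (2 * Real.pi), poisson w t = 2 * Real.pi := by
  have h := DiffContOnCl.circleAverage_poissonKernel_smul (c := (0 : ℂ)) (R := 1) (w := w)
    (f := fun _ => (1 : ℂ)) diffContOnCl_const (by simpa using hw)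
  have e : Set.EqOn (fun t : ℝ => (poissonKernel 0 w • fun _ => (1 : ℂ)) (circleMap 0 1 t))
      (fun t => ((poisson w t : ℝ) : ℂ)) (Set.uIcc 0 (2 * Real.pi)) := fun t _ => by
    simp [poissonKernel, poisson, circleMap]
  rw [Real.circleAverage_def, intervalIntegral.integral_congr e, intervalIntegral.integral_ofReal,
    intervalIntegral.integral_of_le Real.two_pi_pos.le] at h
  have h' := congrArg Complex.re h
  simp only [Complex.smul_re, Complex.ofReal_re, Complex.one_re, smul_eq_mul] at h'
  have := Real.two_pi_pos
  field_simp at h'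
  linarith

lemma integrableAngle_const (c : ℝ) : IntegrableAngle fun _ => c :=
  integrableOn_const measure_Ioc_lt_top.ne

lemma re_herglotz_const (c : ℝ) {w : ℂ} (hw : ‖w‖ < 1) : (herglotz (fun _ => c) w).re = c := by
  rw [re_herglotz (integrableAngle_const c) hw, integral_mul_const, integral_poisson hw]
  have := Real.two_pi_pos
  field_simp

lemma re_herglotz_mono {k k' : ℝ → ℝ} (hk : IntegrableAngle k) (hk' : IntegrableAngle k') {w : ℂ}
    (hw : ‖w‖ < 1) (h : ∀ t, k t ≤ k' t) : (herglotz k w).re ≤ (herglotz k' w).re := by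
  rw [re_herglotz hk hw, re_herglotz hk' hw]
  have := Real.two_pi_pos
  gcongr ?_ * ?_
  exact integral_mono (integrableOn_poisson_mul hk hw) (integrableOn_poisson_mul hk' hw) fun t =>
    mul_le_mul_of_nonneg_left (h t) (poisson_pos hw t).le

/-- Unlike `norm_herglotz_le`, this bound does not degenerate as the point approaches the circle,
because the Poisson kernel is positive with mean one. It gives the sup-norm bound on the interaction
operator. -/
lemma abs_re_herglotz_le {k : ℝ → ℝ} (hk : IntegrableAngle k) {w : ℂ} (hw : ‖w‖ < 1) {M : ℝ}
    (h : ∀ t, |k t| ≤ M) : |(herglotz k w).re| ≤ M := by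
  rw [abs_le]
  constructor
  · rw [← re_herglotz_const (-M) hw]
    exact re_herglotz_mono (integrableAngle_const _) hk hw fun t => (abs_le.1 (h t)).1
  · rw [← re_herglotz_const M hw]
    exact re_herglotz_mono hk (integrableAngle_const _) hw fun t => (abs_le.1 (h t)).2

lemma integrableAngle_of_continuous {k : ℝ → ℝ} (hk : Continuous k) : IntegrableAngle k :=
  (hk.integrableOn_Icc).mono_set Set.Ioc_subset_Icc_self

/-- The strong minimum principle for Poisson integrals of continuous functions. -/
lemma eq_of_re_herglotz_eq_of_le {k : ℝ → ℝ} (hk : Continuous k) {w : ℂ} (hw : ‖w‖ < 1) {m : ℝ}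
    (h : ∀ t, m ≤ k t) (he : (herglotz k w).re = m) {t : ℝ} (ht : t ∈ Set.Icc 0 (2 * Real.pi)) :
    k t = m := by
  have hki := integrableAngle_of_continuous hk
  have h2 := Real.two_pi_pos
  have hz : ∫ t in (0 : ℝ)..2 * Real.pi, poisson w t * (k t - m) = 0 := by
    have h0 : (herglotz (fun t => k t - m) w).re = 0 := by
      rw [herglotz_sub hki (integrableAngle_const m) hw, Complex.sub_re, re_herglotz_const m hw, he,
        sub_self]
    rw [re_herglotz (k := fun t => k t - m) (hki.sub (integrableAngle_const m)) hw] at h0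
    rw [intervalIntegral.integral_of_le h2.le]
    exact (mul_eq_zero.1 h0).resolve_left (by positivity)
  have hc : Continuous fun t => poisson w t * (k t - m) :=
    (continuous_poisson hw).mul (hk.sub continuous_const)
  by_contra hne
  have hpos : 0 < ∫ t in (0 : ℝ)..2 * Real.pi, poisson w t * (k t - m) :=
    intervalIntegral.integral_pos h2 hc.continuousOn
      (fun s _ => mul_nonneg (poisson_pos hw s).le (sub_nonneg.2 (h s)))
      ⟨t, ht, mul_pos (poisson_pos hw t) (sub_pos.2 (lt_of_le_of_ne (h t) (Ne.symm hne)))⟩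
  exact hpos.ne' hz

/-- Conjugate symmetry of the Herglotz integral of an even function. -/
lemma herglotz_conj {k : ℝ → ℝ} (hk : ∀ t, k (2 * Real.pi - t) = k t) (w : ℂ) :
    herglotz k (starRingEnd ℂ w) = starRingEnd ℂ (herglotz k w) := by
  have h2 := Real.two_pi_pos
  unfold herglotz
  rw [map_mul, ← integral_conj]
  congr 1
  · simp [map_ofNat]
  · rw [← intervalIntegral.integral_of_le h2.le, ← intervalIntegral.integral_of_le h2.le]
    have := intervalIntegral.integral_comp_sub_left (a := 0) (b := 2 * Real.pi)
      (fun t : ℝ => (Complex.exp (t * Complex.I) + starRingEnd ℂ w) /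
        (Complex.exp (t * Complex.I) - starRingEnd ℂ w) * (k t : ℂ)) (2 * Real.pi)
    simp only [sub_self, sub_zero] at this
    rw [← this]
    refine intervalIntegral.integral_congr fun t _ => ?_
    have e : Complex.exp (((2 * Real.pi - t : ℝ) : ℂ) * Complex.I) =
        starRingEnd ℂ (Complex.exp (t * Complex.I)) := by
      rw [← Complex.exp_conj, map_mul, Complex.conj_I, Complex.conj_ofReal]
      push_cast
      rw [sub_mul, Complex.exp_sub, Complex.exp_two_pi_mul_I, mul_neg, Complex.exp_neg, one_div]
    simp only [hk, e]
    simp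

lemma differentiableAt_herglotz {h : ℂ → ℝ} (hh : Continuous h) {w : ℂ} (hw : ‖w‖ < 1) :
    DifferentiableAt ℂ (herglotz fun t => h (Complex.exp (t * Complex.I))) w := by
  have hi : CircleIntegrable (fun ζ => (h ζ : ℂ)) 0 1 :=
    ContinuousOn.circleIntegrable' (by fun_prop)
  have := (hasDerivAt_circleAverage_herglotzRieszKernel_smul hi
    (w := w) (by simpa using hw)).differentiableAt
  refine this.congr_of_eventuallyEq (Eventually.of_forall fun z => ?_)
  simp only [herglotz]
  rw [Real.circleAverage_def, intervalIntegral.integral_of_le Real.two_pi_pos.le,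
    Complex.real_smul]
  congr 1
  · push_cast; simp
  · simp [circleMap, herglotzRieszKernel]

/-! ### Boundary values of Poisson integrals and Fatou's theorem -/

/-- The Poisson integral of a continuous function attains its boundary values. -/
lemma tendsto_re_herglotz_boundary {h : ℂ → ℝ} (hh : Continuous h) {ζ : ℂ} (hζ : ‖ζ‖ = 1) :
    Tendsto (fun w => (herglotz (fun t => h (Complex.exp (t * Complex.I))) w).re)
      (𝓝[Metric.ball 0 1] ζ) (𝓝 (h ζ)) := by
  obtain ⟨M, hM⟩ := (isCompact_sphere (0 : ℂ) 1).exists_bound_of_continuousOn hh.continuousOn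
  have hM0 : 0 ≤ M := (norm_nonneg _).trans (hM ζ (by simpa using hζ))
  rw [Metric.tendsto_nhds]
  intro ε hε
  obtain ⟨δ, hδ, hcont⟩ := Metric.continuousAt_iff.1 (hh.continuousAt (x := ζ)) (ε / 2)
    (by positivity)
  have hlim : Tendsto (fun w : ℂ => 2 * M * ((1 - ‖w‖ ^ 2) / (δ / 2) ^ 2)) (𝓝 ζ) (𝓝 0) := by
    have : ContinuousAt (fun w : ℂ => 2 * M * ((1 - ‖w‖ ^ 2) / (δ / 2) ^ 2)) ζ := by fun_prop
    simpa [ContinuousAt, hζ] using this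
  filter_upwards [mem_nhdsWithin_of_mem_nhds (hlim.eventually_lt_const (half_pos hε)),
    mem_nhdsWithin_of_mem_nhds (Metric.ball_mem_nhds ζ (half_pos hδ)), self_mem_nhdsWithin]
    with w hw1 hw2 hw3
  have hw : ‖w‖ < 1 := by simpa using hw3
  rw [Metric.mem_ball, dist_eq_norm] at hw2
  have hk : Continuous fun t : ℝ => h (Complex.exp (t * Complex.I)) := by fun_prop
  have hki := integrableAngle_of_continuous hk
  have hc := integrableAngle_const (h ζ)
  -- For angles near `ζ` continuity of `h` gives the first term. For the others `exp (it)` stays at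
  -- distance at least `δ / 2` from `w`, so the kernel is small and the crude bound `2 * M`
  -- suffices.
  have hpt : ∀ t : ℝ, ‖poisson w t * (h (Complex.exp (t * Complex.I)) - h ζ)‖ ≤
      poisson w t * (ε / 2) + 2 * M * ((1 - ‖w‖ ^ 2) / (δ / 2) ^ 2) := by
    intro t
    have h1 : 0 ≤ 1 - ‖w‖ ^ 2 := by nlinarith [norm_nonneg w]
    rw [norm_mul, Real.norm_eq_abs, abs_of_pos (poisson_pos hw t)]
    by_cases hd : ‖Complex.exp (t * Complex.I) - ζ‖ < δ
    · have := hcont (x := Complex.exp (t * Complex.I)) (by rwa [dist_eq_norm])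
      rw [Real.dist_eq, ← Real.norm_eq_abs] at this
      have h3 := mul_le_mul_of_nonneg_left this.le (poisson_pos hw t).le
      have : 0 ≤ 2 * M * ((1 - ‖w‖ ^ 2) / (δ / 2) ^ 2) := by positivity
      linarith
    · have h2 : ‖h (Complex.exp (t * Complex.I)) - h ζ‖ ≤ 2 * M := by
        refine (norm_sub_le _ _).trans ?_
        have := hM (Complex.exp (t * Complex.I)) (by simp [Complex.norm_exp_ofReal_mul_I])
        have := hM ζ (by simpa using hζ)
        linarith
      have h4 : poisson w t ≤ (1 - ‖w‖ ^ 2) / (δ / 2) ^ 2 := by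
        have : δ / 2 ≤ ‖Complex.exp (t * Complex.I) - w‖ := by
          have := norm_sub_le_norm_sub_add_norm_sub (Complex.exp (t * Complex.I)) w ζ
          linarith
        unfold poisson
        gcongr
      have h5 := mul_le_mul h4 h2 (norm_nonneg _) (by positivity)
      have := mul_pos (poisson_pos hw t) (half_pos hε)
      linarith
  have hP : IntegrableAngle (poisson w) := integrableAngle_of_continuous (continuous_poisson hw)
  have hint : ‖∫ t in Set.Ioc 0 (2 * Real.pi),
      poisson w t * (h (Complex.exp (t * Complex.I)) - h ζ)‖ ≤
      2 * Real.pi * (ε / 2 + 2 * M * ((1 - ‖w‖ ^ 2) / (δ / 2) ^ 2)) := by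
    refine (norm_integral_le_of_norm_le ((hP.mul_const _).add (integrableAngle_const _))
      (Eventually.of_forall hpt)).trans (le_of_eq ?_)
    simp only [Pi.add_apply]
    rw [integral_add (hP.mul_const _) (integrableAngle_const _), integral_mul_const,
      integral_poisson hw]
    simp only [integral_const, MeasurableSet.univ, measureReal_restrict_apply, Set.univ_inter,
      Real.volume_real_Ioc, sub_zero, smul_eq_mul, max_eq_left Real.two_pi_pos.le]
    ring
  rw [Real.dist_eq]
  nth_rewrite 1 [← re_herglotz_const (h ζ) hw]
  rw [← Complex.sub_re, ← herglotz_sub hki hc hw,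
    re_herglotz (k := fun t : ℝ => h (Complex.exp (t * Complex.I)) - h ζ) (hki.sub hc) hw, abs_mul,
    abs_of_pos (by positivity), ← Real.norm_eq_abs, inv_mul_lt_iff₀ (by positivity)]
  refine hint.trans_lt ?_
  have := Real.two_pi_pos
  gcongr
  linarith

/-- Dyadic domination of the kernel `ε / (ε² + s²)` by averages over intervals. -/
lemma lintegral_cauchyKernel_le {g : ℝ → ENNReal} (hg : Measurable g) (x₀ η ε : ℝ) (hε : 0 < ε)
    (hη : 0 ≤ η)
    (h : ∀ ρ > 0, ∫⁻ t in Metric.closedBall x₀ ρ, g t ≤ ENNReal.ofReal (η * ρ)) :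
    ∫⁻ t, ENNReal.ofReal (ε / (ε ^ 2 + (t - x₀) ^ 2)) * g t ≤ ENNReal.ofReal (8 * η) := by
  have hpt : ∀ t, ENNReal.ofReal (ε / (ε ^ 2 + (t - x₀) ^ 2)) * g t ≤
      ∑' k : ℕ, ENNReal.ofReal (4 * (1 / 4) ^ k / ε) *
        (Metric.closedBall x₀ (2 ^ k * ε)).indicator g t := by
    intro t
    have hex : ∃ k : ℕ, |t - x₀| ≤ 2 ^ k * ε := by
      obtain ⟨k, hk⟩ := pow_unbounded_of_one_lt (|t - x₀| / ε) (one_lt_two)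
      exact ⟨k, by rw [div_lt_iff₀ hε] at hk; exact hk.le⟩
    classical
    -- The least `k` locates the dyadic shell of `t`. Outside the innermost ball, minimality gives
    -- `|t - x₀| > 2 ^ (k - 1) * ε`, so the kernel is at most `4 * 4⁻ᵏ / ε`. Multiplied by the mass
    -- `η * 2ᵏ * ε` of the ball this leaves `4 * η * 2⁻ᵏ`, with sum `8 * η`.
    set k := Nat.find hex with hkdef
    have hk : |t - x₀| ≤ 2 ^ k * ε := Nat.find_spec hex
    refine le_trans ?_ (ENNReal.le_tsum k)
    rw [Set.indicator_of_mem (by rwa [Metric.mem_closedBall, Real.dist_eq])]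
    gcongr ENNReal.ofReal ?_ * _
    rcases Nat.eq_zero_or_pos k with h0 | h0
    · rw [h0, pow_zero, div_le_div_iff₀ (by positivity) hε]
      nlinarith [sq_nonneg (t - x₀), sq_nonneg ε]
    · obtain ⟨m, hm⟩ : ∃ m, k = m + 1 := ⟨k - 1, by omega⟩
      have hlt : 2 ^ m * ε < |t - x₀| := by
        have := Nat.find_min hex (m := m) (by omega)
        linarith
      have hsq : (2 ^ m * ε) ^ 2 ≤ (t - x₀) ^ 2 := by
        rw [← sq_abs (t - x₀)]
        gcongr
      have e4 : ((2 : ℝ) ^ m) ^ 2 * (1 / 4) ^ m = 1 := by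
        rw [← pow_mul, mul_comm m 2, pow_mul, ← mul_pow]; norm_num
      rw [hm, div_le_div_iff₀ (by positivity) hε, pow_succ]
      have h4 : (0 : ℝ) < (1 / 4) ^ m := by positivity
      have : ε ^ 2 = (1 / 4) ^ m * (2 ^ m * ε) ^ 2 := by
        rw [mul_pow, ← mul_assoc, mul_comm ((1 / 4 : ℝ) ^ m), e4, one_mul]
      nlinarith [mul_le_mul_of_nonneg_left hsq h4.le, mul_nonneg h4.le (sq_nonneg ε)]
  calc _ ≤ ∫⁻ t, ∑' k : ℕ, ENNReal.ofReal (4 * (1 / 4) ^ k / ε) *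
        (Metric.closedBall x₀ (2 ^ k * ε)).indicator g t := lintegral_mono hpt
    _ = ∑' k : ℕ, ENNReal.ofReal (4 * (1 / 4) ^ k / ε) *
        ∫⁻ t in Metric.closedBall x₀ (2 ^ k * ε), g t := by
      rw [lintegral_tsum fun k =>
        ((hg.indicator Metric.isClosed_closedBall.measurableSet).const_mul _).aemeasurable]
      refine tsum_congr fun k => ?_
      rw [lintegral_const_mul _ (hg.indicator Metric.isClosed_closedBall.measurableSet),
        lintegral_indicator Metric.isClosed_closedBall.measurableSet]
    _ ≤ ∑' k : ℕ, ENNReal.ofReal (4 * η * (1 / 2) ^ k) := by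
      refine ENNReal.tsum_le_tsum fun k => ?_
      calc _ ≤ ENNReal.ofReal (4 * (1 / 4) ^ k / ε) * ENNReal.ofReal (η * (2 ^ k * ε)) := by
            gcongr
            exact h _ (by positivity)
        _ = _ := by
            rw [← ENNReal.ofReal_mul (by positivity)]
            congr 1
            have : (1 / 4 : ℝ) ^ k * 2 ^ k = (1 / 2) ^ k := by rw [← mul_pow]; norm_num
            rw [← this]
            field_simp
    _ = ENNReal.ofReal (8 * η) := by
      rw [← ENNReal.ofReal_tsum_of_nonneg (fun k => by positivity)
        (summable_geometric_two.mul_left _), tsum_mul_left, tsum_geometric_two]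
      congr 1
      ring

/-- The analytic core of Fatou's theorem: near `x₀` the dyadic bound turns vanishing averages into a
vanishing integral, and away from `x₀` the kernel is `O(ε)`. -/
lemma tendsto_integral_cauchyKernel {g : ℝ → ℝ} (hg : Integrable g) (hg0 : ∀ t, 0 ≤ g t) (x₀ : ℝ)
    (h : Tendsto (fun δ : ℝ => δ⁻¹ * ∫ t in Metric.closedBall x₀ δ, g t) (𝓝[>] 0) (𝓝 0)) :
    Tendsto (fun ε : ℝ => ∫ t, ε / (ε ^ 2 + (t - x₀) ^ 2) * g t) (𝓝[>] 0) (𝓝 0) := by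
  have hker : ∀ ε > 0, Integrable fun t => ε / (ε ^ 2 + (t - x₀) ^ 2) * g t := by
    intro ε hε
    refine hg.bdd_mul (c := 1 / ε) ?_ (Eventually.of_forall fun t => ?_)
    · exact (Continuous.div (by fun_prop) (by fun_prop) fun t => by positivity).aestronglyMeasurable
    · rw [Real.norm_eq_abs, abs_of_nonneg (by positivity), div_le_div_iff₀ (by positivity) hε]
      nlinarith [sq_nonneg (t - x₀)]
  rw [Metric.tendsto_nhds]
  intro η hη
  -- The constant `8` of the dyadic bound turns `η / 32` into `η / 4` for the near part; the far
  -- part will be below `η / 2`.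
  obtain ⟨δ, hδ, hδs⟩ : ∃ δ > 0, ∀ ρ, 0 < ρ → ρ ≤ δ →
      ∫ t in Metric.closedBall x₀ ρ, g t ≤ η / 32 * ρ := by
    have := h.eventually_lt_const (u := η / 32) (by positivity)
    obtain ⟨δ, hδ, hs⟩ := (mem_nhdsGT_iff_exists_Ioc_subset).1 this
    refine ⟨δ, hδ, fun ρ h0 h1 => ?_⟩
    have h2 : ρ⁻¹ * ∫ t in Metric.closedBall x₀ ρ, g t < η / 32 := hs ⟨h0, h1⟩
    rw [inv_mul_lt_iff₀ h0] at h2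
    linarith
  have hsmall : Tendsto (fun ε : ℝ => ε / δ ^ 2 * ∫ t, g t) (𝓝[>] 0) (𝓝 0) := by
    have : Continuous fun ε : ℝ => ε / δ ^ 2 * ∫ t, g t := by fun_prop
    have := this.tendsto 0
    simp only [zero_div, zero_mul] at this
    exact this.mono_left nhdsWithin_le_nhds
  filter_upwards [self_mem_nhdsWithin, hsmall.eventually_lt_const (half_pos hη)] with ε hε hε2
  have hε : 0 < ε := hε
  have hB : MeasurableSet (Metric.closedBall x₀ δ) := Metric.isClosed_closedBall.measurableSet
  have hnn : ∀ t, 0 ≤ ε / (ε ^ 2 + (t - x₀) ^ 2) * g t := fun t =>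
    mul_nonneg (by positivity) (hg0 t)
  have h1 : ∫ t in Metric.closedBall x₀ δ, ε / (ε ^ 2 + (t - x₀) ^ 2) * g t ≤ η / 4 := by
    obtain ⟨g', hg'm, hgg'⟩ := hg.aestronglyMeasurable.aemeasurable.ennreal_ofReal
    rw [integral_eq_lintegral_of_nonneg_ae (Eventually.of_forall hnn)
      (hker ε hε).aestronglyMeasurable.restrict]
    refine ENNReal.toReal_le_of_le_ofReal (by positivity) ?_
    have e1 : ∫⁻ t in Metric.closedBall x₀ δ, ENNReal.ofReal (ε / (ε ^ 2 + (t - x₀) ^ 2) * g t) =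
        ∫⁻ t, ENNReal.ofReal (ε / (ε ^ 2 + (t - x₀) ^ 2)) *
          (Metric.closedBall x₀ δ).indicator g' t := by
      rw [← lintegral_indicator hB]
      refine lintegral_congr_ae ?_
      filter_upwards [hgg'] with t ht
      by_cases htB : t ∈ Metric.closedBall x₀ δ
      · rw [Set.indicator_of_mem htB, Set.indicator_of_mem htB,
          ENNReal.ofReal_mul (by positivity), ← ht]
      · rw [Set.indicator_of_notMem htB, Set.indicator_of_notMem htB, mul_zero]
    rw [e1]
    refine (lintegral_cauchyKernel_le (hg'm.indicator hB) x₀ (η / 32) ε hε (by positivity)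
      fun ρ hρ => ?_).trans (le_of_eq (by ring_nf))
    have e2 : ∫⁻ t in Metric.closedBall x₀ ρ, (Metric.closedBall x₀ δ).indicator g' t =
        ENNReal.ofReal (∫ t in Metric.closedBall x₀ (min ρ δ), g t) := by
      rw [ofReal_integral_eq_lintegral_ofReal hg.integrableOn (Eventually.of_forall hg0),
        setLIntegral_indicator hB]
      have : Metric.closedBall x₀ δ ∩ Metric.closedBall x₀ ρ = Metric.closedBall x₀ (min ρ δ) := by
        ext t; simp [and_comm]
      rw [this]
      exact lintegral_congr_ae (ae_restrict_of_ae (hgg'.mono fun t ht => ht.symm))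
    rw [e2]
    refine ENNReal.ofReal_le_ofReal ((hδs _ (lt_min hρ hδ) (min_le_right _ _)).trans ?_)
    gcongr
    exact min_le_left _ _
  have h2 : ∫ t in (Metric.closedBall x₀ δ)ᶜ, ε / (ε ^ 2 + (t - x₀) ^ 2) * g t ≤
      ε / δ ^ 2 * ∫ t, g t := by
    calc _ ≤ ∫ t in (Metric.closedBall x₀ δ)ᶜ, ε / δ ^ 2 * g t := by
          refine setIntegral_mono_on (hker ε hε).integrableOn (hg.const_mul _).integrableOn
            hB.compl fun t ht => ?_
          have ht' : δ < |t - x₀| := by simpa [Real.dist_eq] using ht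
          have : δ ^ 2 ≤ (t - x₀) ^ 2 := by rw [← sq_abs (t - x₀)]; gcongr
          refine mul_le_mul_of_nonneg_right ?_ (hg0 t)
          gcongr
          nlinarith [sq_nonneg ε]
      _ ≤ ∫ t, ε / δ ^ 2 * g t := setIntegral_le_integral (hg.const_mul _)
          (Eventually.of_forall fun t => mul_nonneg (by positivity) (hg0 t))
      _ = _ := integral_const_mul _ _
  rw [Real.dist_eq, sub_zero, abs_of_nonneg (integral_nonneg hnn),
    ← integral_add_compl hB (hker ε hε)]
  linarith

/-- The chord is `2 sin y` with `y = |t - t₀| / 2`. Since `t₀` is interior to the period, `y` stays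
below some `m < π`. Jordan's inequality, applied to `y` or to `π - y`, then bounds the sine below
linearly. -/
lemma exists_mul_abs_le_norm_exp_sub_exp {t₀ : ℝ} (ht₀ : t₀ ∈ Set.Ioo 0 (2 * Real.pi)) :
    ∃ c > 0, ∀ t ∈ Set.Icc 0 (2 * Real.pi),
      c * |t - t₀| ≤ ‖Complex.exp (t * Complex.I) - Complex.exp (t₀ * Complex.I)‖ := by
  have hpi := Real.pi_pos
  obtain ⟨m, hm0, hmpi, hm⟩ : ∃ m, 0 ≤ m ∧ m < Real.pi ∧
      ∀ t ∈ Set.Icc 0 (2 * Real.pi), |(t - t₀) / 2| ≤ m := by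
    refine ⟨max t₀ (2 * Real.pi - t₀) / 2, ?_, ?_, fun t ht => ?_⟩
    · have := le_max_left t₀ (2 * Real.pi - t₀); linarith [ht₀.1]
    · have : max t₀ (2 * Real.pi - t₀) < 2 * Real.pi := max_lt ht₀.2 (by linarith [ht₀.1])
      linarith
    · rw [abs_le]
      have h1 := le_max_left t₀ (2 * Real.pi - t₀)
      have h2 := le_max_right t₀ (2 * Real.pi - t₀)
      constructor <;> linarith [ht.1, ht.2]
  refine ⟨2 / Real.pi * ((Real.pi - m) / Real.pi), by
    have : 0 < Real.pi - m := by linarith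
    positivity, fun t ht => ?_⟩
  set y := |(t - t₀) / 2| with hy
  have hy0 : 0 ≤ y := abs_nonneg _
  have hym : y ≤ m := hm t ht
  have e1 : ‖Complex.exp (t * Complex.I) - Complex.exp (t₀ * Complex.I)‖ = 2 * Real.sin y := by
    have : Complex.exp (t * Complex.I) - Complex.exp (t₀ * Complex.I) =
        Complex.exp (t₀ * Complex.I) * (Complex.exp (Complex.I * ((t - t₀ : ℝ) : ℂ)) - 1) := by
      rw [mul_sub, ← Complex.exp_add, mul_one]
      congr 2
      push_cast
      ring
    rw [this, norm_mul, Complex.norm_exp_ofReal_mul_I, one_mul,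
      Complex.norm_exp_I_mul_ofReal_sub_one, norm_mul, Real.norm_eq_abs, Real.norm_eq_abs,
      abs_two, ← Real.abs_sin_eq_sin_abs_of_abs_le_pi (by linarith : |(t - t₀) / 2| ≤ Real.pi)]
  have e2 : |t - t₀| = 2 * y := by
    rw [hy, abs_div, abs_two]; ring
  have key : 2 / Real.pi * ((Real.pi - m) / Real.pi) * y ≤ Real.sin y := by
    rcases le_total y (Real.pi / 2) with h | h
    · refine le_trans ?_ (Real.mul_le_sin hy0 h)
      have : (Real.pi - m) / Real.pi ≤ 1 := by rw [div_le_one hpi]; linarith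
      gcongr
      exact mul_le_of_le_one_right (by positivity) this
    · rw [← Real.sin_pi_sub]
      refine le_trans ?_ (Real.mul_le_sin (by linarith) (by linarith))
      rw [mul_assoc]
      gcongr
      calc (Real.pi - m) / Real.pi * y ≤ (Real.pi - m) / Real.pi * Real.pi := by
            have : 0 ≤ Real.pi - m := by linarith
            gcongr
            linarith
        _ = Real.pi - m := by field_simp
        _ ≤ _ := by linarith
  rw [e1, e2]
  linarith

/-- **Fatou's theorem**: the Poisson integral of an integrable function has non-tangential limits
almost everywhere. -/
theorem ae_tendsto_re_herglotz {k : ℝ → ℝ} (hk : IntegrableAngle k) :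
    ∀ᵐ (t₀ : ℝ) ∂(volume.restrict (Set.Ioc 0 (2 * Real.pi))), ∀ C : ℝ,
      Tendsto (fun w => (herglotz k w).re)
        (𝓝[{w | ‖w‖ < 1 ∧ ‖w - Complex.exp (t₀ * Complex.I)‖ ≤ C * (1 - ‖w‖)}]
          (Complex.exp (t₀ * Complex.I))) (𝓝 (k t₀)) := by
  set J := Set.Ioc 0 (2 * Real.pi) with hJ
  have hf : Integrable (J.indicator k) := (integrable_indicator_iff measurableSet_Ioc).2 hk
  -- The limit is established at the Lebesgue points of `k`. The end-point `2π` is discarded because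
  -- there chord and angle are not comparable on the whole period.
  have hL := IsUnifLocDoublingMeasure.ae_tendsto_average_norm_sub volume hf.locallyIntegrable 1
  have hne : ∀ᵐ t₀ ∂(volume : Measure ℝ), t₀ ≠ 2 * Real.pi := by simp [ae_iff]
  filter_upwards [ae_restrict_of_ae hL, ae_restrict_of_ae hne, ae_restrict_mem measurableSet_Ioc]
    with t₀ ht₀ hne₀ hmem C
  have hIoo : t₀ ∈ Set.Ioo 0 (2 * Real.pi) := ⟨hmem.1, lt_of_le_of_ne hmem.2 hne₀⟩
  set g : ℝ → ℝ := J.indicator fun t => |k t - k t₀| with hgdef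
  have hkc : IntegrableAngle fun t => |k t - k t₀| := (hk.sub (integrableAngle_const _)).abs
  have hg : Integrable g := (integrable_indicator_iff measurableSet_Ioc).2 hkc
  have hg0 : ∀ t, 0 ≤ g t := fun t => Set.indicator_nonneg (fun _ _ => abs_nonneg _) t
  have hle : ∀ t, g t ≤ ‖J.indicator k t - J.indicator k t₀‖ := by
    intro t
    by_cases ht : t ∈ J
    · simp [hgdef, ht, hmem]
    · simp only [hgdef, Set.indicator_of_notMem ht]
      exact norm_nonneg _
  have hlim : Tendsto (fun δ : ℝ => δ⁻¹ * ∫ t in Metric.closedBall t₀ δ, g t) (𝓝[>] 0) (𝓝 0) := by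
    have h1 := (ht₀ (l := 𝓝[>] (0 : ℝ)) (fun _ => t₀) id tendsto_id (by
      filter_upwards [self_mem_nhdsWithin] with δ hδ
      simp [le_of_lt (Set.mem_Ioi.1 hδ)])).const_mul 2
    rw [mul_zero] at h1
    refine squeeze_zero' ?_ ?_ h1
    · filter_upwards [self_mem_nhdsWithin] with δ hδ
      have : (0 : ℝ) < δ := hδ
      exact mul_nonneg (by positivity) (integral_nonneg hg0)
    · filter_upwards [self_mem_nhdsWithin] with δ hδ
      have hδ : (0 : ℝ) < δ := hδ
      rw [setAverage_eq, id, Real.volume_real_closedBall hδ.le, smul_eq_mul, ← mul_assoc]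
      have e : 2 * (2 * δ)⁻¹ = δ⁻¹ := by field_simp
      rw [e]
      refine mul_le_mul_of_nonneg_left (setIntegral_mono hg.integrableOn ?_ hle) (by positivity)
      exact (hf.integrableOn.sub (integrableOn_const
        (isCompact_closedBall t₀ δ).measure_lt_top.ne)).norm
  have hJ0 := tendsto_integral_cauchyKernel hg hg0 t₀ hlim
  obtain ⟨c, hc, hcle⟩ := exists_mul_abs_le_norm_exp_sub_exp hIoo
  -- In the Stolz angle `c * |t - t₀| ≤ (1 + |C|) * D`, where `D` is the distance from `exp (it)` to
  -- `w`, and also `1 - ‖w‖ ≤ D`. Adding the squares, `A` is the constant that dominates the Poisson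
  -- kernel by the Cauchy kernel of width `1 - ‖w‖`.
  set A : ℝ := 1 + (1 + |C|) ^ 2 / c ^ 2 with hA
  have hkernel : ∀ w : ℂ, ‖w‖ < 1 → ‖w - Complex.exp (t₀ * Complex.I)‖ ≤ C * (1 - ‖w‖) →
      ∀ t ∈ J, poisson w t ≤ 2 * A * ((1 - ‖w‖) / ((1 - ‖w‖) ^ 2 + (t - t₀) ^ 2)) := by
    intro w hw hwC t ht
    have hε : 0 < 1 - ‖w‖ := by linarith
    have hD := one_sub_norm_le_norm_exp_sub w t
    set D := ‖Complex.exp (t * Complex.I) - w‖ with hDdef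
    have h1 : c * |t - t₀| ≤ (1 + |C|) * D := by
      have h2 := hcle t ⟨ht.1.le, ht.2⟩
      have h3 := norm_sub_le_norm_sub_add_norm_sub (Complex.exp (t * Complex.I)) w
        (Complex.exp (t₀ * Complex.I))
      have h4 : C * (1 - ‖w‖) ≤ |C| * D :=
        mul_le_mul (le_abs_self C) hD hε.le (abs_nonneg C)
      linarith
    have h5 : (t - t₀) ^ 2 ≤ (1 + |C|) ^ 2 / c ^ 2 * D ^ 2 := by
      rw [div_mul_eq_mul_div, le_div_iff₀ (by positivity), ← sq_abs (t - t₀), ← mul_pow, ← mul_pow]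
      refine pow_le_pow_left₀ (by positivity) ?_ 2
      linarith
    have h6 : (1 - ‖w‖) ^ 2 + (t - t₀) ^ 2 ≤ A * D ^ 2 := by
      have := pow_le_pow_left₀ hε.le hD 2
      rw [hA]
      linarith
    have hDpos : 0 < D := hε.trans_le hD
    rw [poisson, ← mul_div_assoc, div_le_div_iff₀ (by positivity) (by positivity)]
    have h7 : 1 - ‖w‖ ^ 2 ≤ 2 * (1 - ‖w‖) := by nlinarith [sq_nonneg (1 - ‖w‖)]
    calc _ ≤ 2 * (1 - ‖w‖) * (A * D ^ 2) := by gcongr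
      _ = _ := by ring
  have hto : Tendsto (fun w : ℂ => 1 - ‖w‖)
      (𝓝[{w | ‖w‖ < 1 ∧ ‖w - Complex.exp (t₀ * Complex.I)‖ ≤ C * (1 - ‖w‖)}]
        (Complex.exp (t₀ * Complex.I))) (𝓝[>] 0) := by
    refine tendsto_nhdsWithin_iff.2 ⟨?_, ?_⟩
    · have : ContinuousAt (fun w : ℂ => 1 - ‖w‖) (Complex.exp (t₀ * Complex.I)) := by fun_prop
      have := this.tendsto
      simp only [Complex.norm_exp_ofReal_mul_I, sub_self] at this
      exact this.mono_left nhdsWithin_le_nhds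
    · filter_upwards [self_mem_nhdsWithin] with w hw
      exact Set.mem_Ioi.2 (by linarith [hw.1])
  have hfin := (hJ0.comp hto).const_mul (2 * A)
  rw [mul_zero] at hfin
  rw [tendsto_iff_norm_sub_tendsto_zero]
  refine squeeze_zero' (Eventually.of_forall fun _ => norm_nonneg _) ?_ hfin
  filter_upwards [self_mem_nhdsWithin] with w hw
  obtain ⟨hw, hwC⟩ := hw
  have hε : 0 < 1 - ‖w‖ := by linarith
  have hc0 := integrableAngle_const (k t₀)
  nth_rewrite 1 [← re_herglotz_const (k t₀) hw]
  rw [← Complex.sub_re, ← herglotz_sub hk hc0 hw,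
    re_herglotz (k := fun t => k t - k t₀) (hk.sub hc0) hw, norm_mul]
  have hK : Integrable fun t => 2 * A * ((1 - ‖w‖) / ((1 - ‖w‖) ^ 2 + (t - t₀) ^ 2)) * g t := by
    refine hg.bdd_mul (c := 2 * A * (1 / (1 - ‖w‖))) ?_ (Eventually.of_forall fun t => ?_)
    · exact (Continuous.mul continuous_const (Continuous.div (by fun_prop) (by fun_prop)
        fun t => by positivity)).aestronglyMeasurable
    · rw [Real.norm_eq_abs, abs_of_nonneg (by positivity)]
      gcongr ?_ * ?_
      rw [div_le_div_iff₀ (by positivity) hε]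
      nlinarith [sq_nonneg (t - t₀)]
  calc _ ≤ 1 * ∫ t, 2 * A * ((1 - ‖w‖) / ((1 - ‖w‖) ^ 2 + (t - t₀) ^ 2)) * g t := by
        gcongr
        · rw [Real.norm_eq_abs, abs_of_pos (by positivity)]
          exact inv_le_one_of_one_le₀ (by linarith [Real.pi_gt_three])
        · refine (norm_integral_le_of_norm_le hK.integrableOn ?_).trans
            (setIntegral_le_integral hK (Eventually.of_forall fun t =>
              mul_nonneg (by positivity) (hg0 t)))
          filter_upwards [ae_restrict_mem measurableSet_Ioc] with t ht
          rw [norm_mul, Real.norm_eq_abs, Real.norm_eq_abs, abs_of_pos (poisson_pos hw t)]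
          have : g t = |k t - k t₀| := Set.indicator_of_mem ht _
          rw [this]
          gcongr
          exact hkernel w hw hwC t ht
    _ = _ := by
        rw [one_mul, Function.comp_apply, ← integral_const_mul]
        simp only [mul_assoc]

/-! ### The conformal map onto the disk through the Joukowski map -/

/-- The square root with positive real part on the slit plane. -/
def csqrt (z : ℂ) : ℂ := Complex.exp (Complex.log z / 2)

lemma csqrt_sq {z : ℂ} (hz : z ≠ 0) : csqrt z ^ 2 = z := by
  rw [csqrt, ← Complex.exp_nat_mul]
  push_cast
  rw [mul_div_cancel₀ _ (two_ne_zero), Complex.exp_log hz]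

lemma csqrt_re_pos {z : ℂ} (hz : z ∈ Complex.slitPlane) : 0 < (csqrt z).re := by
  rw [csqrt, Complex.exp_re]
  refine mul_pos (Real.exp_pos _) (Real.cos_pos_of_mem_Ioo ?_)
  have h1 := Complex.neg_pi_lt_arg z
  have h2 := lt_of_le_of_ne (Complex.arg_le_pi z) (Complex.slitPlane_arg_ne_pi hz)
  have e : (Complex.log z / 2).im = Complex.arg z / 2 := by
    rw [← Complex.log_im]; simp
  rw [e]
  constructor <;> linarith

lemma differentiableAt_csqrt {z : ℂ} (hz : z ∈ Complex.slitPlane) :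
    DifferentiableAt ℂ csqrt z := by
  unfold csqrt
  exact ((Complex.differentiableAt_log hz).div_const 2).cexp

/-- The inverse of the Joukowski map in the variable `q = 1 / ζ`. -/
def joukowskiInv (q : ℂ) : ℂ := q / (1 + csqrt (1 - q ^ 2))

lemma one_add_csqrt_ne_zero {z : ℂ} (hz : z ∈ Complex.slitPlane) : 1 + csqrt z ≠ 0 := by
  intro h
  have h1 := congrArg Complex.re h
  have h2 := csqrt_re_pos hz
  simp only [Complex.add_re, Complex.one_re, Complex.zero_re] at h1
  linarith

lemma differentiableAt_joukowskiInv {q : ℂ} (hq : 1 - q ^ 2 ∈ Complex.slitPlane) :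
    DifferentiableAt ℂ joukowskiInv q := by
  unfold joukowskiInv
  refine DifferentiableAt.div differentiableAt_id ?_ (one_add_csqrt_ne_zero hq)
  refine (differentiableAt_const _).add ?_
  exact DifferentiableAt.comp (g := csqrt) (f := fun q : ℂ => 1 - q ^ 2) q
    (differentiableAt_csqrt hq) (by fun_prop)

/-- With `s` the root of `1 - q ^ 2`, the square of the value is the Cayley transform `(1 - s) / (1
+ s)`, and `s` has positive real part. -/
lemma norm_joukowskiInv_lt_one {q : ℂ} (hq : 1 - q ^ 2 ∈ Complex.slitPlane) :
    ‖joukowskiInv q‖ < 1 := by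
  set s := csqrt (1 - q ^ 2) with hs
  have hs2 : s ^ 2 = 1 - q ^ 2 := csqrt_sq (Complex.slitPlane_ne_zero hq)
  have hre : 0 < s.re := csqrt_re_pos hq
  have hne : 1 + s ≠ 0 := one_add_csqrt_ne_zero hq
  have e : joukowskiInv q ^ 2 = (1 - s) / (1 + s) := by
    rw [joukowskiInv, ← hs, div_pow, div_eq_div_iff (pow_ne_zero 2 hne) hne]
    have : q ^ 2 = (1 - s) * (1 + s) := by linear_combination hs2
    rw [this]; ring
  have h : ‖joukowskiInv q‖ ^ 2 < 1 := by
    rw [← norm_pow, e, norm_div, div_lt_one (norm_pos_iff.2 hne)]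
    refine lt_of_pow_lt_pow_left₀ 2 (norm_nonneg _) ?_
    rw [← Complex.normSq_eq_norm_sq, ← Complex.normSq_eq_norm_sq, Complex.normSq_apply,
      Complex.normSq_apply]
    simp only [Complex.sub_re, Complex.one_re, Complex.sub_im, Complex.one_im, Complex.add_re,
      Complex.add_im]
    nlinarith
  nlinarith [norm_nonneg (joukowskiInv q)]

lemma joukowskiInv_add_inv {q : ℂ} (hq : 1 - q ^ 2 ∈ Complex.slitPlane) (hq0 : q ≠ 0) :
    joukowskiInv q ≠ 0 ∧ joukowskiInv q + (joukowskiInv q)⁻¹ = 2 / q := by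
  set s := csqrt (1 - q ^ 2) with hs
  have hs2 : s ^ 2 = 1 - q ^ 2 := csqrt_sq (Complex.slitPlane_ne_zero hq)
  have hne : 1 + s ≠ 0 := one_add_csqrt_ne_zero hq
  rw [joukowskiInv, ← hs]
  refine ⟨div_ne_zero hq0 hne, ?_⟩
  field_simp
  linear_combination hs2

/-- The coordinate `(b - a) / (2z - a - b)` on the Riemann sphere. -/
def slitCoord (a b : ℝ) (z : OnePoint ℂ) : ℂ := z.elim 0 fun z => (b - a) / (2 * z - a - b)

/-- The conformal map `φ_Δ` of `D_Δ` onto the unit disk, `Δ = [a, b]`. -/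
def phi (a b : ℝ) (z : OnePoint ℂ) : ℂ := joukowskiInv (slitCoord a b z)

@[simp] lemma slitCoord_infty (a b : ℝ) : slitCoord a b OnePoint.infty = 0 := rfl

@[simp] lemma slitCoord_coe (a b : ℝ) (z : ℂ) :
    slitCoord a b (z : OnePoint ℂ) = (b - a) / (2 * z - a - b) := rfl

@[simp] lemma phi_infty (a b : ℝ) : phi a b OnePoint.infty = 0 := by
  simp [phi, joukowskiInv]

lemma infty_mem_slitDomain (a b : ℝ) : OnePoint.infty ∈ slitDomain a b := by
  rintro ⟨x, -, hx⟩
  exact OnePoint.coe_ne_infty _ hx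

lemma coe_mem_slitDomain_iff {a b : ℝ} {z : ℂ} :
    (z : OnePoint ℂ) ∈ slitDomain a b ↔ ∀ x ∈ Set.Icc a b, (x : ℂ) ≠ z := by
  simp [slitDomain, slit]

lemma coe_mem_slitDomain_of_im_ne_zero {a b : ℝ} {z : ℂ} (hz : z.im ≠ 0) :
    (z : OnePoint ℂ) ∈ slitDomain a b := by
  rw [coe_mem_slitDomain_iff]
  rintro x - rfl
  simp at hz

lemma ofReal_mem_slitDomain_iff {a b x : ℝ} :
    ((x : ℂ) : OnePoint ℂ) ∈ slitDomain a b ↔ x ∉ Set.Icc a b := by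
  rw [coe_mem_slitDomain_iff]
  constructor
  · intro h hx; exact h x hx rfl
  · intro h y hy e; rw [Complex.ofReal_inj] at e; exact h (e ▸ hy)

lemma isClosed_slit (a b : ℝ) : IsClosed (slit a b) := by
  have : IsCompact (slit a b) :=
    isCompact_Icc.image (OnePoint.continuous_coe.comp Complex.continuous_ofReal)
  exact this.isClosed

lemma isOpen_slitDomain (a b : ℝ) : IsOpen (slitDomain a b) := (isClosed_slit a b).isOpen_compl

lemma two_mul_sub_ne_zero {a b : ℝ} (hab : a < b) {z : ℂ}
    (hz : (z : OnePoint ℂ) ∈ slitDomain a b) : 2 * z - a - b ≠ 0 := by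
  intro h
  refine coe_mem_slitDomain_iff.1 hz ((a + b) / 2) ⟨by linarith, by linarith⟩ ?_
  push_cast
  linear_combination -h / 2

/-- If `1 - q ^ 2` lay on the closed negative axis, then `q` would be real with `|q| ≥ 1`. The
point, recovered as the midpoint plus `(b - a) / (2 q)`, would then lie on the slit. -/
lemma slitCoord_mem_slitPlane {a b : ℝ} (hab : a < b) {z : OnePoint ℂ} (hz : z ∈ slitDomain a b) :
    1 - slitCoord a b z ^ 2 ∈ Complex.slitPlane := by
  induction z using OnePoint.rec with
  | infty => simp
  | coe z =>
    have hne := two_mul_sub_ne_zero hab hz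
    by_contra hcon
    rw [Complex.mem_slitPlane_iff_not_le_zero, not_not, Complex.le_def] at hcon
    set q := slitCoord a b (z : OnePoint ℂ) with hq
    have hq0 : q ≠ 0 := by
      rw [hq, slitCoord_coe]
      exact div_ne_zero (by rw [← Complex.ofReal_sub]; exact_mod_cast (sub_pos.2 hab).ne') hne
    simp only [sq, Complex.sub_re, Complex.one_re, Complex.mul_re, Complex.zero_re, Complex.sub_im,
      Complex.one_im, Complex.mul_im, Complex.zero_im] at hcon
    obtain ⟨h1, h2⟩ := hcon
    have him : q.im = 0 := by
      by_contra him
      have : q.re = 0 := by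
        have : q.re * q.im = 0 := by linarith
        exact (mul_eq_zero.1 this).resolve_right him
      rw [this] at h1
      nlinarith [sq_nonneg q.im]
    have hqr : q = (q.re : ℂ) := by apply Complex.ext <;> simp [him]
    have habs : 1 ≤ q.re ^ 2 := by rw [him] at h1; nlinarith
    have hr0 : q.re ≠ 0 := by rintro h; rw [h] at habs; norm_num at habs
    have hinv : |q.re⁻¹| ≤ 1 := by
      rw [abs_inv]
      exact inv_le_one_of_one_le₀ (by rwa [← one_le_sq_iff_one_le_abs])
    rw [abs_le] at hinv
    refine coe_mem_slitDomain_iff.1 hz ((a + b) / 2 + (b - a) / 2 * q.re⁻¹) ⟨?_, ?_⟩ ?_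
    · nlinarith
    · nlinarith
    · have e : q * (2 * z - a - b) = b - a := by rw [hq, slitCoord_coe]; field_simp
      rw [hqr] at e
      have hr0' : (q.re : ℂ) ≠ 0 := by exact_mod_cast hr0
      push_cast
      field_simp
      linear_combination -e

lemma mem_slitDomain_of_slitCoord {a b : ℝ} {z : ℂ} (hne : 2 * z - a - b ≠ 0)
    (h : 1 - slitCoord a b (z : OnePoint ℂ) ^ 2 ∈ Complex.slitPlane) :
    (z : OnePoint ℂ) ∈ slitDomain a b := by
  rw [coe_mem_slitDomain_iff]
  rintro x hx rfl
  have e : 1 - slitCoord a b ((x : ℂ) : OnePoint ℂ) ^ 2 =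
      ((1 - ((b - a) / (2 * x - a - b)) ^ 2 : ℝ) : ℂ) := by
    rw [slitCoord_coe]; push_cast; ring
  rw [e, Complex.ofReal_mem_slitPlane] at h
  have hne' : 2 * x - a - b ≠ 0 := by exact_mod_cast hne
  have h2 : ((b - a) / (2 * x - a - b)) ^ 2 < 1 := by linarith
  rw [div_pow, div_lt_one (by positivity)] at h2
  nlinarith [hx.1, hx.2]

lemma norm_phi_lt_one {a b : ℝ} (hab : a < b) {z : OnePoint ℂ} (hz : z ∈ slitDomain a b) :
    ‖phi a b z‖ < 1 :=
  norm_joukowskiInv_lt_one (slitCoord_mem_slitPlane hab hz)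

lemma phiInv_zero (a b : ℝ) : phiInv a b 0 = OnePoint.infty := by simp [phiInv]

lemma phiInv_of_ne_zero (a b : ℝ) {w : ℂ} (hw : w ≠ 0) :
    phiInv a b w = (((a + b) / 2 + (b - a) / 4 * (w + w⁻¹) : ℂ) : OnePoint ℂ) := by
  simp [phiInv, hw]

lemma phiInv_phi {a b : ℝ} (hab : a < b) {z : OnePoint ℂ} (hz : z ∈ slitDomain a b) :
    phiInv a b (phi a b z) = z := by
  induction z using OnePoint.rec with
  | infty => rw [phi_infty, phiInv_zero]
  | coe z =>
    have hne := two_mul_sub_ne_zero hab hz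
    have hba : (b - a : ℂ) ≠ 0 := by rw [← Complex.ofReal_sub]; exact_mod_cast (sub_pos.2 hab).ne'
    obtain ⟨h1, h2⟩ := joukowskiInv_add_inv (slitCoord_mem_slitPlane hab hz)
      (by rw [slitCoord_coe]; exact div_ne_zero hba hne)
    rw [phi, phiInv_of_ne_zero _ _ h1, h2, slitCoord_coe]
    congr 1
    field_simp
    ring

/-- Equality of `w + 1/w` and `w' + 1/w'` factors as `(w - w') (w w' - 1) = 0`, and the second
factor cannot vanish inside the disk. -/
lemma phiInv_injOn {a b : ℝ} (hab : a < b) {w w' : ℂ} (hw : ‖w‖ < 1) (hw' : ‖w'‖ < 1)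
    (h : phiInv a b w = phiInv a b w') : w = w' := by
  by_cases h0 : w = 0
  · by_cases h0' : w' = 0
    · rw [h0, h0']
    · rw [h0, phiInv_zero, phiInv_of_ne_zero _ _ h0'] at h
      exact absurd h.symm (OnePoint.coe_ne_infty _)
  · by_cases h0' : w' = 0
    · rw [h0', phiInv_zero, phiInv_of_ne_zero _ _ h0] at h
      exact absurd h (OnePoint.coe_ne_infty _)
    · rw [phiInv_of_ne_zero _ _ h0, phiInv_of_ne_zero _ _ h0', OnePoint.coe_eq_coe] at h
      have hba : (b - a : ℂ) ≠ 0 := by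
        rw [← Complex.ofReal_sub]; exact_mod_cast (sub_pos.2 hab).ne'
      have h1 : (b - a : ℂ) * (w + w⁻¹ - (w' + w'⁻¹)) = 0 := by linear_combination 4 * h
      have h2 := (mul_eq_zero.1 h1).resolve_left hba
      field_simp at h2
      have h3 : (w - w') * (w * w' - 1) = 0 := by linear_combination h2
      rcases mul_eq_zero.1 h3 with h4 | h4
      · exact sub_eq_zero.1 h4
      · exfalso
        have : ‖w * w'‖ = 1 := by rw [sub_eq_zero.1 h4, norm_one]
        rw [norm_mul] at this
        nlinarith [norm_nonneg w, norm_nonneg w']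

lemma phiInv_mem_slitDomain {a b : ℝ} (hab : a < b) {w : ℂ} (hw : ‖w‖ < 1) :
    phiInv a b w ∈ slitDomain a b := by
  by_cases h0 : w = 0
  · rw [h0, phiInv_zero]; exact infty_mem_slitDomain a b
  rw [phiInv_of_ne_zero _ _ h0, coe_mem_slitDomain_iff]
  intro x hx e
  have hba : (b - a : ℂ) ≠ 0 := by rw [← Complex.ofReal_sub]; exact_mod_cast (sub_pos.2 hab).ne'
  obtain ⟨s, hs, hxs⟩ : ∃ s : ℝ, s ^ 2 ≤ 1 ∧ x = (a + b) / 2 + (b - a) / 2 * s := by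
    refine ⟨(2 * x - a - b) / (b - a), ?_, ?_⟩
    · rw [div_pow, div_le_one (by have := sub_pos.2 hab; positivity)]
      nlinarith [hx.1, hx.2]
    · have := (sub_pos.2 hab).ne'
      field_simp
      ring
  have h1 : (b - a : ℂ) * (w + w⁻¹ - 2 * s) = 0 := by
    rw [hxs] at e
    push_cast at e
    linear_combination -4 * e
  have h2 := (mul_eq_zero.1 h1).resolve_left hba
  field_simp at h2
  -- The square of `w - s` is a nonpositive real, so `w - s` is purely imaginary and `‖w‖ = 1`,
  -- which is excluded. The two cases below read this off real and imaginary parts.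
  have h3 : (w - s) ^ 2 = ((s ^ 2 - 1 : ℝ) : ℂ) := by push_cast; linear_combination h2
  have hre := congrArg Complex.re h3
  have him := congrArg Complex.im h3
  simp only [sq, Complex.mul_re, Complex.mul_im, Complex.sub_re, Complex.sub_im, Complex.ofReal_re,
    Complex.ofReal_im, sub_zero] at hre him
  have hn : w.re * w.re + w.im * w.im < 1 := by
    rw [← Complex.normSq_apply, Complex.normSq_eq_norm_sq]
    nlinarith [norm_nonneg w]
  have h5 : (w.re - s) * w.im = 0 := by linarith
  rcases mul_eq_zero.1 h5 with h6 | h6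
  · rw [h6] at hre
    have : w.re = s := by linarith
    rw [this] at hn
    linarith
  · rw [h6] at hre
    nlinarith [sq_nonneg (w.re - s)]

lemma phi_phiInv {a b : ℝ} (hab : a < b) {w : ℂ} (hw : ‖w‖ < 1) :
    phi a b (phiInv a b w) = w :=
  have h := phiInv_mem_slitDomain hab hw
  phiInv_injOn hab (norm_phi_lt_one hab h) hw (phiInv_phi hab h)

lemma phi_ne_zero {a b : ℝ} (hab : a < b) {z : ℂ} (hz : (z : OnePoint ℂ) ∈ slitDomain a b) :
    phi a b z ≠ 0 := by
  intro h
  have := phiInv_phi hab hz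
  rw [h, phiInv_zero] at this
  exact OnePoint.coe_ne_infty _ this.symm

lemma coe_eq_of_phi {a b : ℝ} (hab : a < b) {z : ℂ} (hz : (z : OnePoint ℂ) ∈ slitDomain a b) :
    z = (a + b) / 2 + (b - a) / 4 * (phi a b z + (phi a b z)⁻¹) := by
  have := phiInv_phi hab hz
  rw [phiInv_of_ne_zero _ _ (phi_ne_zero hab hz), OnePoint.coe_eq_coe] at this
  exact this.symm

lemma phi_conj {a b : ℝ} (hab : a < b) {z : ℂ} (hz : (z : OnePoint ℂ) ∈ slitDomain a b) :
    phi a b ((starRingEnd ℂ z : ℂ) : OnePoint ℂ) = starRingEnd ℂ (phi a b z) := by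
  have hw := norm_phi_lt_one hab hz
  have h0 := phi_ne_zero hab hz
  rw [← phi_phiInv hab (w := starRingEnd ℂ (phi a b z)) (by rwa [RCLike.norm_conj]),
    phiInv_of_ne_zero _ _ (by simpa using h0)]
  congr 2
  conv_lhs => rw [coe_eq_of_phi hab hz]
  simp [map_ofNat]

lemma phi_ofReal_im {a b x : ℝ} (hab : a < b) (hx : x ∉ Set.Icc a b) :
    (phi a b ((x : ℂ) : OnePoint ℂ)).im = 0 := by
  have := phi_conj hab (ofReal_mem_slitDomain_iff.2 hx)
  rw [Complex.conj_ofReal] at this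
  exact Complex.conj_eq_iff_im.1 this.symm

lemma tendsto_inv_infty :
    Tendsto (fun z : OnePoint ℂ => z.elim (0 : ℂ) fun y => y⁻¹) (𝓝 OnePoint.infty) (𝓝 0) := by
  have h : ContinuousAt (fun z : OnePoint ℂ => z.elim (0 : ℂ) fun y => y⁻¹)
      OnePoint.infty := by
    rw [OnePoint.continuousAt_infty', coclosedCompact_eq_cocompact]
    exact tendsto_inv₀_cobounded.mono_left (Metric.cobounded_eq_cocompact (α := ℂ)).ge
  exact h.tendsto

/-- Joint continuity of `slitCoord` in the end-points of `Δ` and in `z`. -/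
lemma tendsto_slitCoord {α : Type*} {l : Filter α} {a b : α → ℝ} {z : α → OnePoint ℂ} {a₀ b₀ : ℝ}
    {z₀ : OnePoint ℂ} (hab : a₀ < b₀) (ha : Tendsto a l (𝓝 a₀)) (hb : Tendsto b l (𝓝 b₀))
    (hz : Tendsto z l (𝓝 z₀)) (hz₀ : z₀ ∈ slitDomain a₀ b₀) :
    Tendsto (fun x => slitCoord (a x) (b x) (z x)) l (𝓝 (slitCoord a₀ b₀ z₀)) ∧
      ∀ᶠ x in l, ∀ y : ℂ, z x = y → 2 * y - a x - b x ≠ 0 := by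
  have ha' : Tendsto (fun x => (a x : ℂ)) l (𝓝 a₀) := (Complex.continuous_ofReal.tendsto _).comp ha
  have hb' : Tendsto (fun x => (b x : ℂ)) l (𝓝 b₀) := (Complex.continuous_ofReal.tendsto _).comp hb
  induction z₀ using OnePoint.rec with
  | infty =>
    have hp : Tendsto (fun x => (z x).elim (0 : ℂ) fun y => y⁻¹) l (𝓝 0) :=
      tendsto_inv_infty.comp hz
    have hne : ∀ᶠ x in l, z x ≠ ((0 : ℂ) : OnePoint ℂ) :=
      hz.eventually_ne (OnePoint.coe_ne_infty _).symm
    have hlim : Tendsto (fun x => ((b x : ℂ) - a x) * ((z x).elim (0 : ℂ) fun y => y⁻¹) /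
        (2 - (a x + b x) * ((z x).elim (0 : ℂ) fun y => y⁻¹))) l
        (𝓝 ((b₀ - a₀) * 0 / (2 - (a₀ + b₀) * 0))) :=
      ((hb'.sub ha').mul hp).div (tendsto_const_nhds.sub ((ha'.add hb').mul hp)) (by simp)
    rw [mul_zero, zero_div] at hlim
    have hden : ∀ᶠ x in l, 2 - ((a x : ℂ) + b x) * ((z x).elim (0 : ℂ) fun y => y⁻¹) ≠ 0 := by
      have : Tendsto (fun x => 2 - ((a x : ℂ) + b x) * ((z x).elim (0 : ℂ) fun y => y⁻¹)) l
          (𝓝 (2 - (a₀ + b₀) * 0)) := tendsto_const_nhds.sub ((ha'.add hb').mul hp)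
      exact this.eventually_ne (by simp)
    constructor
    · rw [slitCoord_infty]
      refine hlim.congr' ?_
      filter_upwards [hne, hden] with x hx hd
      generalize z x = y at hx hd ⊢
      induction y using OnePoint.rec with
      | infty => simp
      | coe y =>
        have hy : y ≠ 0 := by rintro rfl; exact hx rfl
        simp only [OnePoint.elim_some, slitCoord_coe] at hd ⊢
        have e : 2 - ((a x : ℂ) + b x) * y⁻¹ = (2 * y - a x - b x) * y⁻¹ := by field_simp; ring
        rw [e, mul_div_mul_right _ _ (inv_ne_zero hy)]
    · filter_upwards [hne, hden] with x hx hd y hy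
      rw [hy] at hx hd
      have hy0 : y ≠ 0 := by rintro rfl; exact hx rfl
      simp only [OnePoint.elim_some] at hd
      have e : 2 - ((a x : ℂ) + b x) * y⁻¹ = (2 * y - a x - b x) * y⁻¹ := by field_simp; ring
      rw [e] at hd
      exact left_ne_zero_of_mul hd
  | coe z₀ =>
    have hp : Tendsto (fun x => (z x).elim (0 : ℂ) id) l (𝓝 z₀) := by
      have hc : ContinuousAt (fun z : OnePoint ℂ => z.elim (0 : ℂ) id) (z₀ : OnePoint ℂ) := by
        rw [OnePoint.continuousAt_coe]
        exact continuousAt_id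
      exact hc.tendsto.comp hz
    have hne : ∀ᶠ x in l, z x ≠ OnePoint.infty := hz.eventually_ne (OnePoint.coe_ne_infty _)
    have hd : Tendsto (fun x => 2 * ((z x).elim (0 : ℂ) id) - a x - b x) l
        (𝓝 (2 * z₀ - a₀ - b₀)) := ((hp.const_mul 2).sub ha').sub hb'
    have hd0 := two_mul_sub_ne_zero hab hz₀
    constructor
    · refine ((hb'.sub ha').div hd hd0).congr' ?_
      filter_upwards [hne] with x hx
      change ((b x : ℂ) - a x) / (2 * ((z x).elim (0 : ℂ) id) - a x - b x) = _
      generalize z x = y at hx ⊢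
      induction y using OnePoint.rec with
      | infty => exact absurd rfl hx
      | coe y => rfl
    · filter_upwards [hd.eventually_ne hd0] with x hx y hy
      rw [hy] at hx
      exact hx

/-- Letting end-points and point move together serves both the continuity of a single map and the
comparison of the maps for varying intervals. -/
lemma tendsto_phi {α : Type*} {l : Filter α} {a b : α → ℝ} {z : α → OnePoint ℂ} {a₀ b₀ : ℝ}
    {z₀ : OnePoint ℂ} (hab : a₀ < b₀) (ha : Tendsto a l (𝓝 a₀)) (hb : Tendsto b l (𝓝 b₀))
    (hz : Tendsto z l (𝓝 z₀)) (hz₀ : z₀ ∈ slitDomain a₀ b₀) :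
    Tendsto (fun x => phi (a x) (b x) (z x)) l (𝓝 (phi a₀ b₀ z₀)) :=
  (differentiableAt_joukowskiInv (slitCoord_mem_slitPlane hab hz₀)).continuousAt.tendsto.comp
    (tendsto_slitCoord hab ha hb hz hz₀).1

/-- Membership is an open condition jointly in the point and the end-points, because it amounts to
`1 - q ^ 2` lying in the open slit plane, together with a nonvanishing denominator at finite points.
-/
lemma eventually_mem_slitDomain {α : Type*} {l : Filter α} {a b : α → ℝ} {z : α → OnePoint ℂ}
    {a₀ b₀ : ℝ} {z₀ : OnePoint ℂ} (hab : a₀ < b₀) (ha : Tendsto a l (𝓝 a₀))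
    (hb : Tendsto b l (𝓝 b₀)) (hz : Tendsto z l (𝓝 z₀)) (hz₀ : z₀ ∈ slitDomain a₀ b₀) :
    ∀ᶠ x in l, z x ∈ slitDomain (a x) (b x) := by
  obtain ⟨h1, h2⟩ := tendsto_slitCoord hab ha hb hz hz₀
  have h3 := (((h1.pow 2).const_sub 1).eventually
    (Complex.isOpen_slitPlane.mem_nhds (slitCoord_mem_slitPlane hab hz₀)))
  filter_upwards [h2, h3] with x hx2 hx3
  generalize hy : z x = y at *
  induction y using OnePoint.rec with
  | infty => exact infty_mem_slitDomain _ _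
  | coe y => exact mem_slitDomain_of_slitCoord (hx2 y rfl) hx3

lemma continuousAt_phi {a b : ℝ} (hab : a < b) {z : OnePoint ℂ} (hz : z ∈ slitDomain a b) :
    ContinuousAt (phi a b) z :=
  tendsto_phi hab tendsto_const_nhds tendsto_const_nhds tendsto_id hz

lemma differentiableAt_phi_coe {a b : ℝ} (hab : a < b) {z : ℂ}
    (hz : (z : OnePoint ℂ) ∈ slitDomain a b) :
    DifferentiableAt ℂ (fun z : ℂ => phi a b z) z := by
  refine DifferentiableAt.comp (g := joukowskiInv) (f := fun z : ℂ => slitCoord a b z) z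
    (differentiableAt_joukowskiInv (slitCoord_mem_slitPlane hab hz)) ?_
  simp only [slitCoord_coe]
  exact DifferentiableAt.div (by fun_prop) (by fun_prop) (two_mul_sub_ne_zero hab hz)

/-- The chart of the Riemann sphere at infinity. -/
def chartInfty (p : ℂ) : OnePoint ℂ :=
  open Classical in if p = 0 then OnePoint.infty else ((p⁻¹ : ℂ) : OnePoint ℂ)

/-! ### Boundary correspondence between the slit and the circle -/

lemma joukowski_sub {ζ w : ℂ} (hw : w ≠ 0) (hζ : ‖ζ‖ = 1) :
    ‖w‖ * ‖(w + w⁻¹) - (ζ + starRingEnd ℂ ζ)‖ = ‖w - ζ‖ * ‖w - starRingEnd ℂ ζ‖ := by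
  rw [← norm_mul, ← norm_mul]
  congr 1
  have : ζ * starRingEnd ℂ ζ = 1 := by rw [Complex.mul_conj, Complex.normSq_eq_norm_sq, hζ]; simp
  field_simp
  linear_combination -this

/-- The affine parametrisation of `[a, b]` by `[-1, 1]`. -/
def xmap (a b s : ℝ) : ℝ := (a + b) / 2 + (b - a) / 2 * s

/-- A slit point has two preimages on the circle, conjugate to each other. The product of the
distances to them is controlled by the distance to the slit point, so a lower bound on one factor
gives an upper bound on the other. -/
lemma norm_phi_sub_mul {a b : ℝ} (hab : a < b) {z : ℂ} (hz : (z : OnePoint ℂ) ∈ slitDomain a b)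
    (t : ℝ) :
    ‖phi a b z - Complex.exp (t * Complex.I)‖ *
      ‖phi a b z - starRingEnd ℂ (Complex.exp (t * Complex.I))‖ =
      4 / (b - a) * ‖phi a b z‖ * ‖z - xmap a b (Real.cos t)‖ := by
  rw [← joukowski_sub (phi_ne_zero hab hz) (Complex.norm_exp_ofReal_mul_I t)]
  have hba := sub_pos.2 hab
  have hba' : (b - a : ℂ) ≠ 0 := by rw [← Complex.ofReal_sub]; exact_mod_cast hba.ne'
  have hn : ‖(b - a : ℂ)‖ = b - a := by
    rw [← Complex.ofReal_sub, Complex.norm_real, Real.norm_eq_abs, abs_of_pos hba]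
  have hc : Complex.exp (t * Complex.I) + starRingEnd ℂ (Complex.exp (t * Complex.I)) =
      2 * Complex.cos t := by
    rw [Complex.add_conj, Complex.exp_ofReal_mul_I_re]; push_cast; rfl
  have e : z - xmap a b (Real.cos t) = (b - a) / 4 * (phi a b z + (phi a b z)⁻¹ -
      (Complex.exp (t * Complex.I) + starRingEnd ℂ (Complex.exp (t * Complex.I)))) := by
    rw [hc]
    conv_lhs => rw [coe_eq_of_phi hab hz]
    simp only [xmap]
    push_cast
    ring
  rw [e, norm_mul, norm_div, hn]
  simp only [Complex.norm_ofNat]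
  field_simp

/-- The minus sign records that `phi` sends the upper half-plane into the lower half-disk. The
identity also compares the height above the slit with the distance to the circle. -/
lemma im_eq_of_phi {a b : ℝ} (hab : a < b) {z : ℂ} (hz : (z : OnePoint ℂ) ∈ slitDomain a b) :
    z.im * ‖phi a b z‖ ^ 2 = -((b - a) / 4 * (phi a b z).im * (1 - ‖phi a b z‖ ^ 2)) := by
  have h0 : Complex.normSq (phi a b z) ≠ 0 := by simpa using phi_ne_zero hab hz
  have e := congrArg Complex.im (coe_eq_of_phi hab hz)
  have e2 : ((a + b) / 2 + (b - a) / 4 * (phi a b z + (phi a b z)⁻¹) : ℂ) =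
      (((a + b) / 2 : ℝ) : ℂ) + (((b - a) / 4 : ℝ) : ℂ) * (phi a b z + (phi a b z)⁻¹) := by
    push_cast; ring
  rw [e2, Complex.add_im, Complex.im_ofReal_mul,
    Complex.add_im, Complex.inv_im, Complex.ofReal_im] at e
  rw [e, ← Complex.normSq_eq_norm_sq]
  field_simp
  ring

/-- Non-tangential approach to the slit corresponds to approach within a Stolz angle. -/
lemma tendsto_phi_stolz {a b : ℝ} (hab : a < b) {σ t κ : ℝ} (hσ : |σ| = 1)
    (ht : σ * Real.sin t < 0) (hκ : 0 < κ) :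
    ∃ C : ℝ, Tendsto (fun z : ℂ => phi a b z)
      (𝓝[{z : ℂ | |z.re - xmap a b (Real.cos t)| < κ * (σ * z.im)}] (xmap a b (Real.cos t) : ℂ))
      (𝓝[{w | ‖w‖ < 1 ∧ ‖w - Complex.exp (t * Complex.I)‖ ≤ C * (1 - ‖w‖)}]
        (Complex.exp (t * Complex.I))) := by
  have hba := sub_pos.2 hab
  set x := xmap a b (Real.cos t) with hx
  have hs : 0 < |Real.sin t| := by
    rw [abs_pos]; rintro h; rw [h] at ht; simp at ht
  have key : ∀ z : ℂ, |z.re - x| < κ * (σ * z.im) → ‖phi a b z‖ < 1 ∧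
      ‖phi a b z - Complex.exp (t * Complex.I)‖ ≤ 4 / (b - a) / |Real.sin t| * ‖z - x‖ ∧
      ‖phi a b z - Complex.exp (t * Complex.I)‖ ≤
        2 * (1 + κ) / |Real.sin t| * (1 - ‖phi a b z‖) := by
    intro z hz
    have hσz : 0 < σ * z.im := pos_of_mul_pos_right ((abs_nonneg _).trans_lt hz) hκ.le
    have him : z.im ≠ 0 := by rintro h; rw [h] at hσz; simp at hσz
    have hD := coe_mem_slitDomain_of_im_ne_zero (a := a) (b := b) him
    have hw := norm_phi_lt_one hab hD
    have h0 := phi_ne_zero hab hD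
    have hprod := norm_phi_sub_mul hab hD t
    have himeq := im_eq_of_phi hab hD
    set w := phi a b z with hwdef
    have hwpos : 0 < ‖w‖ := norm_pos_iff.2 h0
    have h1r : 0 < 1 - ‖w‖ ^ 2 := by nlinarith
    have hσw : σ * w.im < 0 := by
      have h3 : (σ * z.im) * ‖w‖ ^ 2 = -((b - a) / 4 * (1 - ‖w‖ ^ 2)) * (σ * w.im) := by
        linear_combination σ * himeq
      have h4 : 0 < (σ * z.im) * ‖w‖ ^ 2 := by positivity
      rw [h3] at h4
      have h5 : 0 < (b - a) / 4 * (1 - ‖w‖ ^ 2) := by positivity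
      by_contra hcon
      push Not at hcon
      nlinarith
    -- The value `w` lies on the same side of the real axis as `exp (it)`, so it stays at distance
    -- at least `|sin t|` from the conjugate point. The product formula then bounds the remaining
    -- factor.
    have hlow : |Real.sin t| ≤ ‖w - starRingEnd ℂ (Complex.exp (t * Complex.I))‖ := by
      refine le_trans ?_ (Complex.abs_im_le_norm _)
      rw [Complex.sub_im, Complex.conj_im, Complex.exp_ofReal_mul_I_im, sub_neg_eq_add]
      have e1 : |Real.sin t| = -(σ * Real.sin t) := by
        rw [← abs_of_neg ht, abs_mul, hσ, one_mul]
      have e2 : |w.im + Real.sin t| = -(σ * (w.im + Real.sin t)) := by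
        rw [← abs_of_neg (a := σ * (w.im + Real.sin t)) (by linarith), abs_mul, hσ, one_mul]
      rw [e1, e2]
      linarith
    have hb1 : ‖w - Complex.exp (t * Complex.I)‖ * |Real.sin t| ≤
        4 / (b - a) * ‖w‖ * ‖z - x‖ := by
      rw [← hprod]
      gcongr
    refine ⟨hw, ?_, ?_⟩
    · rw [div_mul_eq_mul_div, le_div_iff₀ hs]
      refine hb1.trans ?_
      have : 4 / (b - a) * ‖w‖ ≤ 4 / (b - a) := mul_le_of_le_one_right (by positivity) hw.le
      gcongr
    · rw [div_mul_eq_mul_div, le_div_iff₀ hs]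
      refine hb1.trans ?_
      have hzx : ‖z - x‖ ≤ (1 + κ) * |z.im| := by
        refine (Complex.norm_le_abs_re_add_abs_im _).trans ?_
        have : |z.im| = σ * z.im := by
          rw [← abs_of_pos hσz, abs_mul, hσ, one_mul]
        simp only [Complex.sub_re, Complex.ofReal_re, Complex.sub_im, Complex.ofReal_im, sub_zero]
        rw [this] at *
        linarith
      have hzim : |z.im| * ‖w‖ ^ 2 ≤ (b - a) / 4 * ‖w‖ * (1 - ‖w‖ ^ 2) := by
        have := congrArg abs himeq
        rw [abs_mul, abs_neg, abs_mul, abs_mul, abs_of_pos (by positivity : 0 < ‖w‖ ^ 2),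
          abs_of_pos h1r, abs_of_pos (by positivity : 0 < (b - a) / 4)] at this
        rw [this]
        gcongr
        exact Complex.abs_im_le_norm w
      -- In the cone `‖z - x‖` is at most `(1 + κ) * |z.im|`; this line converts that height into
      -- the distance to the circle, which yields the Stolz condition.
      have h6 : 4 / (b - a) * ‖w‖ * |z.im| ≤ 1 - ‖w‖ ^ 2 := by
        refine le_of_mul_le_mul_right ?_ hwpos
        have : 4 / (b - a) * ‖w‖ * |z.im| * ‖w‖ = 4 / (b - a) * (|z.im| * ‖w‖ ^ 2) := by ring
        rw [this]
        refine (mul_le_mul_of_nonneg_left hzim (by positivity)).trans (le_of_eq ?_)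
        field_simp
      calc 4 / (b - a) * ‖w‖ * ‖z - x‖ ≤ 4 / (b - a) * ‖w‖ * ((1 + κ) * |z.im|) := by gcongr
        _ = (1 + κ) * (4 / (b - a) * ‖w‖ * |z.im|) := by ring
        _ ≤ (1 + κ) * (1 - ‖w‖ ^ 2) := by gcongr
        _ ≤ (1 + κ) * (2 * (1 - ‖w‖)) := by
          gcongr
          nlinarith [sq_nonneg (1 - ‖w‖)]
        _ = _ := by ring
  refine ⟨2 * (1 + κ) / |Real.sin t|, tendsto_nhdsWithin_iff.2 ⟨?_, ?_⟩⟩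
  · rw [tendsto_iff_norm_sub_tendsto_zero]
    have hlim : Tendsto (fun z : ℂ => 4 / (b - a) / |Real.sin t| * ‖z - x‖)
        (𝓝[{z : ℂ | |z.re - x| < κ * (σ * z.im)}] (x : ℂ)) (𝓝 0) := by
      have : Continuous (fun z : ℂ => 4 / (b - a) / |Real.sin t| * ‖z - x‖) := by fun_prop
      have := this.tendsto (x : ℂ)
      simp only [sub_self, norm_zero, mul_zero] at this
      exact this.mono_left nhdsWithin_le_nhds
    refine squeeze_zero' (Eventually.of_forall fun _ => norm_nonneg _) ?_ hlim
    filter_upwards [self_mem_nhdsWithin] with z hz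
    exact (key z hz).2.1
  · filter_upwards [self_mem_nhdsWithin] with z hz
    exact ⟨(key z hz).1, (key z hz).2.2⟩

/-! ### Arcsine measure in the angular variable and logarithmic densities -/

/-- Lebesgue measure on one period of the angle. -/
abbrev angleMeasure : Measure ℝ := volume.restrict (Set.Ioc 0 (2 * Real.pi))

lemma continuous_xmap_cos (a b : ℝ) : Continuous fun t => xmap a b (Real.cos t) := by
  unfold xmap; fun_prop

lemma xmap_mem_Icc {a b s : ℝ} (hab : a < b) (hs : s ∈ Set.Icc (-1 : ℝ) 1) :
    xmap a b s ∈ Set.Icc a b := by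
  unfold xmap
  constructor <;> nlinarith [hs.1, hs.2]

lemma image_xmap_cos {a b : ℝ} (hab : a < b) :
    (fun t => xmap a b (Real.cos t)) '' Set.Ioo 0 Real.pi = Set.Ioo a b := by
  have hba := sub_pos.2 hab
  ext x
  constructor
  · rintro ⟨t, ht, rfl⟩
    have h1 : Real.cos t < 1 := by
      have := Real.cos_lt_cos_of_nonneg_of_le_pi le_rfl ht.2.le ht.1
      rwa [Real.cos_zero] at this
    have h2 : -1 < Real.cos t := by
      have := Real.cos_lt_cos_of_nonneg_of_le_pi ht.1.le le_rfl ht.2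
      rwa [Real.cos_pi] at this
    simp only [xmap, Set.mem_Ioo]
    constructor <;> nlinarith
  · intro hx
    have h1 : -1 < (2 * x - a - b) / (b - a) := by
      rw [lt_div_iff₀ hba]; linarith [hx.1]
    have h2 : (2 * x - a - b) / (b - a) < 1 := by
      rw [div_lt_iff₀ hba]; linarith [hx.2]
    refine ⟨Real.arccos ((2 * x - a - b) / (b - a)), ⟨Real.arccos_pos.2 h2, ?_⟩, ?_⟩
    · refine lt_of_le_of_ne (Real.arccos_le_pi _) fun h => ?_
      rw [Real.arccos_eq_pi] at h
      linarith
    · simp only [xmap]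
      rw [Real.cos_arccos h1.le h2.le]
      field_simp
      ring

lemma hasDerivAt_xmap_cos (a b t : ℝ) :
    HasDerivAt (fun t => xmap a b (Real.cos t)) ((b - a) / 2 * -Real.sin t) t := by
  unfold xmap
  exact ((Real.hasDerivAt_cos t).const_mul _).const_add _

lemma injOn_xmap_cos {a b : ℝ} (hab : a < b) :
    Set.InjOn (fun t => xmap a b (Real.cos t)) (Set.Ioo 0 Real.pi) := by
  intro s hs t ht h
  have hba := sub_pos.2 hab
  simp only [xmap, add_right_inj] at h
  have := mul_left_cancel₀ (by positivity) h
  exact Real.injOn_cos (Set.Ioo_subset_Icc_self hs) (Set.Ioo_subset_Icc_self ht) this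

lemma xmap_sub_mul {a b : ℝ} (t : ℝ) (hab : a < b) :
    Real.sqrt ((xmap a b (Real.cos t) - a) * (b - xmap a b (Real.cos t))) =
      (b - a) / 2 * |Real.sin t| := by
  have hba := sub_pos.2 hab
  have : (xmap a b (Real.cos t) - a) * (b - xmap a b (Real.cos t)) =
      ((b - a) / 2 * Real.sin t) ^ 2 := by
    unfold xmap
    linear_combination (-(b - a) ^ 2 / 4) * Real.sin_sq_add_cos_sq t
  rw [this, Real.sqrt_sq_eq_abs, abs_mul, abs_of_pos (by positivity)]

lemma measurable_arcsineWeight (a b : ℝ) : Measurable fun x : ℝ =>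
    ENNReal.ofReal (1 / (Real.pi * Real.sqrt ((x - a) * (b - x)))) := by
  fun_prop

lemma lintegral_arcsine {a b : ℝ} (hab : a < b) {G : ℝ → ENNReal} (hG : Measurable G) :
    ∫⁻ x, G x ∂(arcsine a b) =
      ENNReal.ofReal (1 / Real.pi) * ∫⁻ t in Set.Ioo 0 Real.pi, G (xmap a b (Real.cos t)) := by
  have hba := sub_pos.2 hab
  have hpi := Real.pi_pos
  rw [arcsine, lintegral_withDensity_eq_lintegral_mul _ (measurable_arcsineWeight a b) hG,
    ← restrict_Ioo_eq_restrict_Icc, ← image_xmap_cos hab,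
    lintegral_image_eq_lintegral_abs_deriv_mul measurableSet_Ioo
      (fun t _ => (hasDerivAt_xmap_cos a b t).hasDerivWithinAt) (injOn_xmap_cos hab),
    ← lintegral_const_mul (f := fun t => G (xmap a b (Real.cos t))) _
      (hG.comp (continuous_xmap_cos a b).measurable)]
  refine setLIntegral_congr_fun measurableSet_Ioo fun t ht => ?_
  have hs : 0 < Real.sin t := Real.sin_pos_of_pos_of_lt_pi ht.1 ht.2
  simp only [Pi.mul_apply]
  rw [← mul_assoc, ← ENNReal.ofReal_mul (abs_nonneg _), xmap_sub_mul t hab]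
  congr 2
  rw [abs_mul, abs_neg, abs_of_pos hs, abs_of_pos (by positivity)]
  field_simp

lemma lintegral_angle_cos {H : ℝ → ENNReal} (hH : Measurable H) :
    ∫⁻ t, H (Real.cos t) ∂angleMeasure = 2 * ∫⁻ t in Set.Ioo 0 Real.pi, H (Real.cos t) := by
  have hpi := Real.pi_pos
  have hHc : Measurable fun t => H (Real.cos t) := hH.comp Real.measurable_cos
  have hsplit : Set.Ioc 0 (2 * Real.pi) = Set.Ioc 0 Real.pi ∪ Set.Ioc Real.pi (2 * Real.pi) :=
    (Set.Ioc_union_Ioc_eq_Ioc hpi.le (by linarith)).symm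
  rw [angleMeasure, hsplit, lintegral_union measurableSet_Ioc
    (Set.disjoint_left.2 fun t h1 h2 => absurd h2.1 (not_lt.2 h1.2)),
    two_mul (∫⁻ t in Set.Ioo 0 Real.pi, H (Real.cos t))]
  congr 1
  · rw [← restrict_Ioo_eq_restrict_Ioc]
  · have := (Measure.measurePreserving_sub_left volume (2 * Real.pi)).setLIntegral_comp_preimage
      (measurableSet_Ioc (a := Real.pi) (b := 2 * Real.pi)) hHc
    rw [← this]
    have e : (fun t => 2 * Real.pi - t) ⁻¹' Set.Ioc Real.pi (2 * Real.pi) = Set.Ico 0 Real.pi := by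
      ext t
      simp only [Set.mem_preimage, Set.mem_Ioc, Set.mem_Ico]
      constructor <;> rintro ⟨h1, h2⟩ <;> constructor <;> linarith
    rw [e, ← restrict_Ioo_eq_restrict_Ico]
    simp only [Real.cos_two_pi_sub]

/-- The arcsine distribution is the image of the uniform distribution on the circle. -/
lemma map_angleMeasure {a b : ℝ} (hab : a < b) :
    Measure.map (fun t => xmap a b (Real.cos t)) angleMeasure =
      ENNReal.ofReal (2 * Real.pi) • arcsine a b := by
  refine Measure.ext_of_lintegral _ fun G hG => ?_
  have hx : Measurable (xmap a b) := by unfold xmap; fun_prop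
  rw [lintegral_map hG (continuous_xmap_cos a b).measurable, lintegral_smul_measure,
    lintegral_arcsine hab hG, lintegral_angle_cos (H := fun s => G (xmap a b s)) (hG.comp hx),
    smul_eq_mul, ← mul_assoc,
    ← ENNReal.ofReal_mul Real.two_pi_pos.le]
  have : 2 * Real.pi * (1 / Real.pi) = 2 := by have := Real.pi_pos; field_simp
  rw [this]
  simp

lemma integrableAngle_comp_xmap_iff {a b : ℝ} (hab : a < b) {f : ℝ → ℝ} (hf : Measurable f) :
    IntegrableAngle (fun t => f (xmap a b (Real.cos t))) ↔ Integrable f (arcsine a b) := by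
  have h := integrable_map_measure (μ := angleMeasure) (f := fun t => xmap a b (Real.cos t))
    (g := f) hf.aestronglyMeasurable (continuous_xmap_cos a b).measurable.aemeasurable
  rw [map_angleMeasure hab, integrable_smul_measure
    (by simpa using Real.pi_pos) ENNReal.ofReal_ne_top] at h
  exact h.symm

/-- Only almost everywhere: at the end-points division by zero makes the weight `0`. -/
lemma arcsineWeight_ne_zero (a b : ℝ) : ∀ᵐ x ∂(volume.restrict (Set.Icc a b)),
    ENNReal.ofReal (1 / (Real.pi * Real.sqrt ((x - a) * (b - x)))) ≠ 0 := by
  rw [← restrict_Ioo_eq_restrict_Icc]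
  filter_upwards [ae_restrict_mem measurableSet_Ioo] with x hx
  have h1 : 0 < Real.sqrt ((x - a) * (b - x)) :=
    Real.sqrt_pos.2 (mul_pos (sub_pos.2 hx.1) (sub_pos.2 hx.2))
  have := Real.pi_pos
  simp only [ne_eq, ENNReal.ofReal_eq_zero, not_le]
  positivity

lemma ae_angle_of_ae_Icc {a b : ℝ} (hab : a < b) {p : ℝ → Prop}
    (h : ∀ᵐ x ∂(volume.restrict (Set.Icc a b)), p x) :
    ∀ᵐ t ∂angleMeasure, p (xmap a b (Real.cos t)) := by
  refine ae_of_ae_map (continuous_xmap_cos a b).measurable.aemeasurable ?_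
  rw [map_angleMeasure hab]
  refine Measure.ae_smul_measure ?_ _
  exact (withDensity_absolutelyContinuous _ _).ae_le h

/-- A differentiable map sends null sets to null sets. Both preimages `t` and `2π - t` are retained
because they carry the limits from the two sides of the slit. -/
lemma ae_Icc_of_ae_angle {a b : ℝ} (hab : a < b) {Q : ℝ → Prop} (h : ∀ᵐ t ∂angleMeasure, Q t) :
    ∀ᵐ x ∂(volume.restrict (Set.Icc a b)), ∃ t ∈ Set.Ioo 0 Real.pi,
      xmap a b (Real.cos t) = x ∧ Q t ∧ Q (2 * Real.pi - t) := by
  have hpi := Real.pi_pos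
  rw [ae_restrict_iff' measurableSet_Ioc] at h
  have h' : ∀ᵐ t : ℝ, 2 * Real.pi - t ∈ Set.Ioc 0 (2 * Real.pi) → Q (2 * Real.pi - t) :=
    (Measure.measurePreserving_sub_left volume (2 * Real.pi)).quasiMeasurePreserving.ae h
  set N := {t | ¬((t ∈ Set.Ioc 0 (2 * Real.pi) → Q t) ∧
    (2 * Real.pi - t ∈ Set.Ioc 0 (2 * Real.pi) → Q (2 * Real.pi - t)))} with hN
  have hN0 : volume N = 0 := ae_iff.1 (h.and h')
  have hX0 : volume ((fun t => xmap a b (Real.cos t)) '' N) = 0 :=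
    addHaar_image_eq_zero_of_differentiableOn_of_addHaar_eq_zero volume
      (fun t _ => (hasDerivAt_xmap_cos a b t).differentiableAt.differentiableWithinAt) hN0
  rw [← restrict_Ioo_eq_restrict_Icc]
  filter_upwards [ae_restrict_mem measurableSet_Ioo,
    ae_restrict_of_ae (measure_eq_zero_iff_ae_notMem.1 hX0)] with x hx hxN
  rw [← image_xmap_cos hab] at hx
  obtain ⟨t, ht, rfl⟩ := hx
  have htN : t ∉ N := fun h => hxN ⟨t, h, rfl⟩
  rw [hN, Set.mem_ofPred_eq, not_not] at htN
  exact ⟨t, ht, rfl, htN.1 ⟨ht.1, by linarith [ht.2]⟩,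
    htN.2 ⟨by linarith [ht.2], by linarith [ht.1]⟩⟩

lemma rnDeriv_restrict_restrict (μ : Measure ℝ) [IsFiniteMeasure μ] {s : Set ℝ}
    (hs : MeasurableSet s) :
    (μ.restrict s).rnDeriv (volume.restrict s) =ᵐ[volume.restrict s] μ.rnDeriv volume := by
  refine (Measure.eq_rnDeriv (s := (μ.singularPart volume).restrict s)
    (Measure.measurable_rnDeriv _ _) ?_ ?_).symm
  · exact (Measure.mutuallySingular_singularPart μ volume).mono_ac
      Measure.restrict_le_self.absolutelyContinuous Measure.restrict_le_self.absolutelyContinuous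
  · rw [← restrict_withDensity hs, ← Measure.restrict_add, ← μ.haveLebesgueDecomposition_add volume]

lemma arcsineDensity_ae_eq (μ : Measure ℝ) [IsFiniteMeasure μ] (a b : ℝ) :
    ∀ᵐ x ∂(volume.restrict (Set.Icc a b)), arcsineDensity μ a b x =
      Real.pi * Real.sqrt ((x - a) * (b - x)) * density μ x := by
  have h := Measure.rnDeriv_withDensity_right (μ.restrict (Set.Icc a b))
    (volume.restrict (Set.Icc a b)) (measurable_arcsineWeight a b).aemeasurable
    (arcsineWeight_ne_zero a b) (Eventually.of_forall fun x => ENNReal.ofReal_ne_top)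
  filter_upwards [h, rnDeriv_restrict_restrict μ (measurableSet_Icc (a := a) (b := b))] with x h1 h2
  rw [arcsineDensity, arcsine, h1, h2, ENNReal.toReal_mul, density, ENNReal.toReal_inv,
    ENNReal.toReal_ofReal (by positivity)]
  simp

lemma measurable_density (μ : Measure ℝ) : Measurable (density μ) :=
  (Measure.measurable_rnDeriv _ _).ennreal_toReal

lemma measurable_arcsineDensity (μ : Measure ℝ) (a b : ℝ) : Measurable (arcsineDensity μ a b) :=
  (Measure.measurable_rnDeriv _ _).ennreal_toReal

/-- Half the logarithm of the arcsine density, in the coordinate `s ∈ [-1, 1]`. -/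
def halfLogDensity (μ : Measure ℝ) (a b s : ℝ) : ℝ :=
  1 / 2 * Real.log (arcsineDensity μ a b (xmap a b s))

lemma measurable_halfLogDensity (μ : Measure ℝ) (a b : ℝ) : Measurable (halfLogDensity μ a b) := by
  have hx : Measurable (xmap a b) := by unfold xmap; fun_prop
  exact ((Real.measurable_log.comp (measurable_arcsineDensity μ a b)).comp hx).const_mul _

lemma ae_sin_ne_zero : ∀ᵐ t ∂angleMeasure, Real.sin t ≠ 0 := by
  have hpi := Real.pi_pos
  have hne : ∀ᵐ t : ℝ, t ≠ Real.pi ∧ t ≠ 2 * Real.pi :=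
    Filter.Eventually.and (by simp [ae_iff]) (by simp [ae_iff])
  filter_upwards [ae_restrict_of_ae hne, ae_restrict_mem measurableSet_Ioc] with t ht hmem
  rcases lt_or_gt_of_ne ht.1 with h | h
  · exact (Real.sin_pos_of_pos_of_lt_pi hmem.1 h).ne'
  · have h2 : t < 2 * Real.pi := lt_of_le_of_ne hmem.2 ht.2
    have := Real.sin_pos_of_pos_of_lt_pi (x := t - Real.pi) (by linarith) (by linarith)
    rw [Real.sin_sub_pi] at this
    linarith

/-- The term `log (sin t)`, which is the singular part of the arcsine weight, does not depend on the
interval and so cancels when two intervals are compared. `Real.log` takes the absolute value of its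
argument, so the sign of `sin t` is harmless. -/
lemma arcsineDensity_pos_of_isSzego {μ : Measure ℝ} [IsFiniteMeasure μ] {a b : ℝ} (hab : a < b)
    (h : IsSzego μ a b) : ∀ᵐ t ∂angleMeasure, 0 < arcsineDensity μ a b (xmap a b (Real.cos t)) ∧
      halfLogDensity μ a b (Real.cos t) = 1 / 2 * (Real.log (density μ (xmap a b (Real.cos t))) +
        Real.log (Real.pi * ((b - a) / 2)) + Real.log (Real.sin t)) := by
  have hba := sub_pos.2 hab
  filter_upwards [ae_angle_of_ae_Icc hab h.2.1, ae_angle_of_ae_Icc hab (arcsineDensity_ae_eq μ a b),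
    ae_sin_ne_zero] with t h1 h2 h3
  have h4 : 0 < |Real.sin t| := abs_pos.2 h3
  have hpi := Real.pi_pos
  rw [halfLogDensity, h2, xmap_sub_mul t hab]
  refine ⟨by positivity, ?_⟩
  rw [← mul_assoc, Real.log_mul (by positivity) h1.ne', Real.log_mul (by positivity) h4.ne',
    Real.log_abs]
  ring

lemma integrableAngle_halfLogDensity {μ : Measure ℝ} [IsFiniteMeasure μ] {a b : ℝ} (hab : a < b)
    (h : IsSzego μ a b) : IntegrableAngle fun t => halfLogDensity μ a b (Real.cos t) := by
  have h1 : IntegrableAngle fun t => Real.log (density μ (xmap a b (Real.cos t))) :=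
    (integrableAngle_comp_xmap_iff hab
      (f := fun x => Real.log (density μ x)) (Real.measurable_log.comp (measurable_density μ))).2
      h.2.2
  have h2 : IntegrableAngle fun t => Real.log (Real.sin t) := by
    have := (intervalIntegrable_log_sin (a := 0) (b := 2 * Real.pi)).1
    exact this
  refine ((h1.add (integrableAngle_const (Real.log (Real.pi * ((b - a) / 2))))).add h2
    |>.const_mul (1 / 2)).congr ?_
  filter_upwards [arcsineDensity_pos_of_isSzego hab h] with t ht
  rw [ht.2]
  rfl

lemma integrableAngle_arcsineDensity (μ : Measure ℝ) [IsFiniteMeasure μ] {a b : ℝ} (hab : a < b) :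
    IntegrableAngle fun t => arcsineDensity μ a b (xmap a b (Real.cos t)) :=
  (integrableAngle_comp_xmap_iff hab (measurable_arcsineDensity μ a b)).2
    Measure.integrable_toReal_rnDeriv

/-- The square of the exponential is the arcsine density, integrable because `μ` is finite, times a
factor at most `exp (2 * M)`. -/
lemma memLp_exp_halfLogDensity_add {μ : Measure ℝ} [IsFiniteMeasure μ] {a b : ℝ} (hab : a < b)
    (h : IsSzego μ a b) {g : ℝ → ℝ} (hg : Measurable g) {M : ℝ} (hM : ∀ s, |g s| ≤ M) :
    MemLp (fun t => Real.exp (halfLogDensity μ a b (Real.cos t) + g (Real.cos t))) 2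
      angleMeasure := by
  have hm : Measurable fun t =>
      Real.exp (halfLogDensity μ a b (Real.cos t) + g (Real.cos t)) :=
    Real.measurable_exp.comp (((measurable_halfLogDensity μ a b).comp Real.measurable_cos).add
      (hg.comp Real.measurable_cos))
  rw [memLp_two_iff_integrable_sq hm.aestronglyMeasurable]
  refine ((integrableAngle_arcsineDensity μ hab).const_mul (Real.exp (2 * M))).mono'
    (hm.pow_const 2).aestronglyMeasurable ?_
  filter_upwards [arcsineDensity_pos_of_isSzego hab h] with t ht
  rw [Real.norm_eq_abs, abs_of_nonneg (by positivity), ← Real.exp_nat_mul]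
  push_cast
  rw [mul_add, Real.exp_add, mul_comm]
  have e : Real.exp (2 * halfLogDensity μ a b (Real.cos t)) =
      arcsineDensity μ a b (xmap a b (Real.cos t)) := by
    rw [halfLogDensity, ← mul_assoc]
    norm_num
    exact Real.exp_log ht.1
  rw [e]
  gcongr
  · exact ht.1.le
  · exact (le_abs_self _).trans (hM _)

lemma affineMap_xmap {a b : ℝ} (hab : a < b) (a' b' s : ℝ) :
    affineMap a b a' b' (xmap a b s) = xmap a' b' s := by
  have := (sub_pos.2 hab).ne'
  unfold affineMap xmap
  field_simp
  ring

/-- The affine map of the uniform Szegő condition becomes the identity in the common coordinate `s`.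
The hypothesis is therefore `L¹` convergence of the logarithmic densities in the angle; what remains
is the convergence of the logarithms of the interval lengths. -/
lemma tendsto_integral_halfLogDensity {μ : Measure ℝ} [IsFiniteMeasure μ] {a b : ℝ} (hab : a < b)
    (h : IsSzego μ a b) {a' b' : ℕ → ℝ} (hab' : ∀ n, a' n < b' n)
    (h' : ∀ᶠ n in atTop, IsSzego μ (a' n) (b' n)) (ha : Tendsto a' atTop (𝓝 a))
    (hb : Tendsto b' atTop (𝓝 b))
    (hlim : Tendsto (fun n => ∫⁻ x, ENNReal.ofReal |Real.log (density μ x) -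
      Real.log (density μ (affineMap a b (a' n) (b' n) x))| ∂(arcsine a b)) atTop (𝓝 0)) :
    Tendsto (fun n => ∫ t, |halfLogDensity μ (a' n) (b' n) (Real.cos t) -
      halfLogDensity μ a b (Real.cos t)| ∂angleMeasure) atTop (𝓝 0) := by
  have hmeas : ∀ n, Measurable fun x => Real.log (density μ x) -
      Real.log (density μ (affineMap a b (a' n) (b' n) x)) := by
    intro n
    have hm := Real.measurable_log.comp (measurable_density μ)
    have : Measurable (affineMap a b (a' n) (b' n)) := by unfold affineMap; fun_prop
    exact hm.sub (hm.comp this)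
  have e1 : ∀ n, ∫⁻ t, ENNReal.ofReal |Real.log (density μ (xmap a b (Real.cos t))) -
      Real.log (density μ (xmap (a' n) (b' n) (Real.cos t)))| ∂angleMeasure =
      ENNReal.ofReal (2 * Real.pi) * ∫⁻ x, ENNReal.ofReal |Real.log (density μ x) -
      Real.log (density μ (affineMap a b (a' n) (b' n) x))| ∂(arcsine a b) := by
    intro n
    rw [← smul_eq_mul, ← lintegral_smul_measure, ← map_angleMeasure hab,
      lintegral_map (f := fun x => ENNReal.ofReal |Real.log (density μ x) -
        Real.log (density μ (affineMap a b (a' n) (b' n) x))|)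
        ((measurable_norm.comp (hmeas n)).ennreal_ofReal)
        (continuous_xmap_cos a b).measurable]
    simp only [affineMap_xmap hab]
  have hint : ∀ᶠ n in atTop, IntegrableAngle fun t =>
      Real.log (density μ (xmap a b (Real.cos t))) -
      Real.log (density μ (xmap (a' n) (b' n) (Real.cos t))) := by
    filter_upwards [h'] with n hn
    have hm := Real.measurable_log.comp (measurable_density μ)
    exact ((integrableAngle_comp_xmap_iff hab hm).2 h.2.2).sub
      ((integrableAngle_comp_xmap_iff (hab' n) hm).2 hn.2.2)
  have hA : Tendsto (fun n => ∫ t, |Real.log (density μ (xmap a b (Real.cos t))) -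
      Real.log (density μ (xmap (a' n) (b' n) (Real.cos t)))| ∂angleMeasure) atTop (𝓝 0) := by
    have h0 := ENNReal.Tendsto.const_mul (a := ENNReal.ofReal (2 * Real.pi)) hlim
      (Or.inr ENNReal.ofReal_ne_top)
    rw [mul_zero] at h0
    have h1 := (ENNReal.tendsto_toReal ENNReal.zero_ne_top).comp h0
    rw [ENNReal.toReal_zero] at h1
    refine h1.congr' ?_
    filter_upwards [hint] with n hn
    rw [Function.comp_apply, ← e1 n, integral_eq_lintegral_of_nonneg_ae
      (Eventually.of_forall fun t => abs_nonneg _) hn.abs.aestronglyMeasurable]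
  have hB : Tendsto (fun n => |Real.log (Real.pi * ((b - a) / 2)) -
      Real.log (Real.pi * ((b' n - a' n) / 2))| * (2 * Real.pi)) atTop (𝓝 0) := by
    have hpos : Real.pi * ((b - a) / 2) ≠ 0 := by
      have := Real.pi_pos; have := sub_pos.2 hab; positivity
    have := ((((hb.sub ha).div_const 2).const_mul Real.pi).log hpos).const_sub
      (Real.log (Real.pi * ((b - a) / 2)))
    rw [sub_self] at this
    simpa using this.abs.mul_const (2 * Real.pi)
  have hAB := (hA.add hB)
  rw [add_zero] at hAB
  refine squeeze_zero' (Eventually.of_forall fun n => integral_nonneg fun t => abs_nonneg _) ?_ hAB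
  filter_upwards [hint, h'] with n hn hn'
  have e2 : |Real.log (Real.pi * ((b - a) / 2)) - Real.log (Real.pi * ((b' n - a' n) / 2))| *
      (2 * Real.pi) = ∫ t, |Real.log (Real.pi * ((b - a) / 2)) -
        Real.log (Real.pi * ((b' n - a' n) / 2))| ∂angleMeasure := by
    simp [Real.pi_pos.le, mul_comm]
  rw [e2, ← integral_add hn.abs (integrableAngle_const _)]
  refine integral_mono_ae ((integrableAngle_halfLogDensity (hab' n) hn').sub
    (integrableAngle_halfLogDensity hab h)).abs (hn.abs.add (integrableAngle_const _)) ?_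
  filter_upwards [arcsineDensity_pos_of_isSzego hab h, arcsineDensity_pos_of_isSzego (hab' n) hn']
    with t h1 h2
  simp only [h1.2, h2.2]
  have := abs_add_le (Real.log (density μ (xmap a b (Real.cos t))) -
      Real.log (density μ (xmap (a' n) (b' n) (Real.cos t))))
    (Real.log (Real.pi * ((b - a) / 2)) - Real.log (Real.pi * ((b' n - a' n) / 2)))
  refine le_trans ?_ this
  rw [abs_sub_comm, ← mul_sub, abs_mul, abs_of_pos (by norm_num : (0 : ℝ) < 1 / 2)]
  have e3 : ∀ A B C A' B' : ℝ, A + B + C - (A' + B' + C) = A - A' + (B - B') := by intros; ring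
  rw [e3]
  linarith [abs_nonneg (Real.log (density μ (xmap a b (Real.cos t))) -
      Real.log (density μ (xmap (a' n) (b' n) (Real.cos t))) +
    (Real.log (Real.pi * ((b - a) / 2)) - Real.log (Real.pi * ((b' n - a' n) / 2))))]

/-! ### Harmonic extensions, the maximum principle and uniqueness -/

/-- The harmonic extension to `D_Δ` of a function on `Δ = [a, b]` (given in the coordinate
`s ∈ [-1, 1]`), equal to the function itself on `Δ`. -/
def harmonicExt (a b : ℝ) (h : ℝ → ℝ) (z : OnePoint ℂ) : ℝ :=
  open Classical in
  if z ∈ slitDomain a b then (herglotz (fun t => h (Real.cos t)) (phi a b z)).re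
  else h ((2 * (z.elim (0 : ℂ) id).re - a - b) / (b - a))

lemma harmonicExt_of_mem {a b : ℝ} (h : ℝ → ℝ) {z : OnePoint ℂ} (hz : z ∈ slitDomain a b) :
    harmonicExt a b h z = (herglotz (fun t => h (Real.cos t)) (phi a b z)).re := if_pos hz

lemma harmonicExt_of_notMem {a b : ℝ} (h : ℝ → ℝ) {z : OnePoint ℂ} (hz : z ∉ slitDomain a b) :
    harmonicExt a b h z = h ((2 * (z.elim (0 : ℂ) id).re - a - b) / (b - a)) := if_neg hz

lemma xmap_div {a b : ℝ} (hab : a < b) (s : ℝ) : (2 * xmap a b s - a - b) / (b - a) = s := by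
  have := (sub_pos.2 hab).ne'
  unfold xmap
  field_simp
  ring

lemma exists_xmap_of_notMem {a b : ℝ} (hab : a < b) {z : OnePoint ℂ} (hz : z ∉ slitDomain a b) :
    ∃ s ∈ Set.Icc (-1 : ℝ) 1, z = ((xmap a b s : ℂ) : OnePoint ℂ) := by
  rw [slitDomain, Set.mem_compl_iff, not_not] at hz
  obtain ⟨x, hx, rfl⟩ := hz
  have hba := sub_pos.2 hab
  refine ⟨(2 * x - a - b) / (b - a), ⟨?_, ?_⟩, ?_⟩
  · rw [le_div_iff₀ hba]; linarith [hx.1]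
  · rw [div_le_iff₀ hba]; linarith [hx.2]
  · have : xmap a b ((2 * x - a - b) / (b - a)) = x := by
      unfold xmap; field_simp; ring
    rw [this]

lemma xmap_notMem_slitDomain {a b : ℝ} (hab : a < b) {s : ℝ} (hs : s ∈ Set.Icc (-1 : ℝ) 1) :
    ((xmap a b s : ℂ) : OnePoint ℂ) ∉ slitDomain a b := by
  rw [ofReal_mem_slitDomain_iff, not_not]
  exact xmap_mem_Icc hab hs

lemma harmonicExt_xmap {a b : ℝ} (hab : a < b) (h : ℝ → ℝ) {s : ℝ} (hs : s ∈ Set.Icc (-1 : ℝ) 1) :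
    harmonicExt a b h ((xmap a b s : ℂ) : OnePoint ℂ) = h s := by
  rw [harmonicExt_of_notMem h (xmap_notMem_slitDomain hab hs)]
  simp only [OnePoint.elim_some, id, Complex.ofReal_re, xmap_div hab]

lemma herglotz_comp_cos_eq (h : ℝ → ℝ) :
    herglotz (fun t => h (Real.cos t)) =
      herglotz fun t => (fun ζ : ℂ => h ζ.re) (Complex.exp (t * Complex.I)) := by
  simp only [Complex.exp_ofReal_mul_I_re]

/-- At a slit point the two conjugate preimages on the circle carry the same value, since the datum
depends on `cos t` only. The extension is therefore continuous across the slit, including the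
end-points. -/
lemma continuous_harmonicExt {a b : ℝ} (hab : a < b) {h : ℝ → ℝ} (hh : Continuous h) :
    Continuous (harmonicExt a b h) := by
  have hki : IntegrableAngle fun t => h (Real.cos t) :=
    integrableAngle_of_continuous (hh.comp Real.continuous_cos)
  have hba := sub_pos.2 hab
  rw [continuous_iff_continuousAt]
  intro z
  by_cases hz : z ∈ slitDomain a b
  · have h1 : ContinuousAt (fun z => (herglotz (fun t => h (Real.cos t)) (phi a b z)).re) z :=
      Complex.continuous_re.continuousAt.comp
        ((continuousAt_herglotz hki (norm_phi_lt_one hab hz)).comp (continuousAt_phi hab hz))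
    refine h1.congr ?_
    filter_upwards [(isOpen_slitDomain a b).mem_nhds hz] with y hy
    rw [harmonicExt_of_mem h hy]
  · obtain ⟨s, hs, rfl⟩ := exists_xmap_of_notMem hab hz
    rw [OnePoint.continuousAt_coe, Metric.continuousAt_iff']
    intro ε hε
    simp only [Function.comp_apply]
    rw [harmonicExt_xmap hab h hs]
    obtain ⟨t, rfl⟩ : ∃ t, s = Real.cos t := ⟨Real.arccos s, (Real.cos_arccos hs.1 hs.2).symm⟩
    have hbd : ∀ ζ : ℂ, ‖ζ‖ = 1 → ζ.re = Real.cos t → ∃ δ > 0, ∀ w : ℂ, ‖w‖ < 1 → ‖w - ζ‖ < δ →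
        dist (herglotz (fun t => h (Real.cos t)) w).re (h (Real.cos t)) < ε := by
      intro ζ hζ hre
      have := tendsto_re_herglotz_boundary (h := fun ζ : ℂ => h ζ.re)
        (hh.comp Complex.continuous_re) hζ
      rw [← herglotz_comp_cos_eq, hre] at this
      obtain ⟨δ, hδ, hs⟩ := Metric.mem_nhdsWithin_iff.1 (Metric.tendsto_nhds.1 this ε hε)
      exact ⟨δ, hδ, fun w hw hd => hs ⟨by rwa [Metric.mem_ball, dist_eq_norm], by simpa using hw⟩⟩
    obtain ⟨δ₁, hδ₁, h₁⟩ := hbd _ (Complex.norm_exp_ofReal_mul_I t) (Complex.exp_ofReal_mul_I_re t)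
    obtain ⟨δ₂, hδ₂, h₂⟩ := hbd (starRingEnd ℂ (Complex.exp (t * Complex.I)))
      (by rw [RCLike.norm_conj, Complex.norm_exp_ofReal_mul_I])
      (by rw [Complex.conj_re, Complex.exp_ofReal_mul_I_re])
    have hc : Tendsto (fun z : ℂ => h ((2 * z.re - a - b) / (b - a)))
        (𝓝 (xmap a b (Real.cos t) : ℂ)) (𝓝 (h (Real.cos t))) := by
      have : Continuous fun z : ℂ => h ((2 * z.re - a - b) / (b - a)) := by fun_prop
      have := this.tendsto (xmap a b (Real.cos t) : ℂ)
      rwa [Complex.ofReal_re, xmap_div hab] at this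
    have hn : Tendsto (fun z : ℂ => 4 / (b - a) * ‖z - xmap a b (Real.cos t)‖)
        (𝓝 (xmap a b (Real.cos t) : ℂ)) (𝓝 0) := by
      have : Continuous fun z : ℂ => 4 / (b - a) * ‖z - xmap a b (Real.cos t)‖ := by fun_prop
      simpa using this.tendsto (xmap a b (Real.cos t) : ℂ)
    filter_upwards [Metric.tendsto_nhds.1 hc ε hε,
      hn.eventually_lt_const (mul_pos hδ₁ hδ₂)] with z hz1 hz2
    by_cases hzD : (z : OnePoint ℂ) ∈ slitDomain a b
    · rw [harmonicExt_of_mem h hzD]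
      have hw := norm_phi_lt_one hab hzD
      have hprod := norm_phi_sub_mul hab hzD t
      -- The product of the two distances is below `δ₁ * δ₂`, so at least one of them is small
      -- enough.
      by_cases hlt : ‖phi a b z - Complex.exp (t * Complex.I)‖ < δ₁
      · exact h₁ _ hw hlt
      · refine h₂ _ hw ?_
        by_contra hlt2
        push Not at hlt hlt2
        have h3 := mul_le_mul hlt hlt2 hδ₂.le (norm_nonneg _)
        rw [hprod] at h3
        have h4 : 4 / (b - a) * ‖phi a b z‖ * ‖z - xmap a b (Real.cos t)‖ ≤
            4 / (b - a) * ‖z - xmap a b (Real.cos t)‖ := by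
          gcongr
          exact mul_le_of_le_one_right (by positivity) hw.le
        linarith
    · rw [harmonicExt_of_notMem h hzD]
      exact hz1

lemma le_harmonicExt {a b : ℝ} (hab : a < b) {h : ℝ → ℝ} (hh : Continuous h) {m : ℝ}
    (hm : ∀ s ∈ Set.Icc (-1 : ℝ) 1, m ≤ h s) (z : OnePoint ℂ) : m ≤ harmonicExt a b h z := by
  by_cases hz : z ∈ slitDomain a b
  · have hw := norm_phi_lt_one hab hz
    rw [harmonicExt_of_mem h hz, ← re_herglotz_const m hw]
    exact re_herglotz_mono (integrableAngle_const m)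
      (integrableAngle_of_continuous (hh.comp Real.continuous_cos)) hw
      fun t => hm _ (Real.cos_mem_Icc t)
  · obtain ⟨s, hs, rfl⟩ := exists_xmap_of_notMem hab hz
    rw [harmonicExt_xmap hab h hs]
    exact hm s hs

lemma eq_of_harmonicExt_eq {a b : ℝ} (hab : a < b) {h : ℝ → ℝ} (hh : Continuous h) {m : ℝ}
    (hm : ∀ s ∈ Set.Icc (-1 : ℝ) 1, m ≤ h s) {z : OnePoint ℂ} (hz : z ∈ slitDomain a b)
    (he : harmonicExt a b h z = m) {s : ℝ} (hs : s ∈ Set.Icc (-1 : ℝ) 1) : h s = m := by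
  rw [harmonicExt_of_mem h hz] at he
  have := eq_of_re_herglotz_eq_of_le (k := fun t => h (Real.cos t)) (hh.comp Real.continuous_cos)
    (norm_phi_lt_one hab hz) (fun t => hm _ (Real.cos_mem_Icc t)) he
    (t := Real.arccos s) ⟨Real.arccos_nonneg s, by
      linarith [Real.arccos_le_pi s, Real.pi_pos]⟩
  simpa only [Real.cos_arccos hs.1 hs.2] using this

lemma harmonicExt_eq_const {a b : ℝ} (hab : a < b) {h : ℝ → ℝ} {m : ℝ}
    (hm : ∀ s ∈ Set.Icc (-1 : ℝ) 1, h s = m) (z : OnePoint ℂ) : harmonicExt a b h z = m := by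
  by_cases hz : z ∈ slitDomain a b
  · rw [harmonicExt_of_mem h hz]
    simp only [hm _ (Real.cos_mem_Icc _)]
    exact re_herglotz_const m (norm_phi_lt_one hab hz)
  · obtain ⟨s, hs, rfl⟩ := exists_xmap_of_notMem hab hz
    rw [harmonicExt_xmap hab h hs, hm s hs]

lemma slitCoord_chartInfty (a b : ℝ) (p : ℂ) :
    slitCoord a b (chartInfty p) = (b - a) * p / (2 - (a + b) * p) := by
  unfold chartInfty
  split_ifs with h
  · simp [h]
  · have e : 2 - ((a : ℂ) + b) * p = (2 * p⁻¹ - a - b) * p := by field_simp; ring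
    rw [slitCoord_coe, e, mul_div_mul_right _ _ h]

/-- The equality of filters transports neighbourhood statements in both directions, so the maximum
principle can be used at infinity too. -/
lemma map_chartInfty : map chartInfty (𝓝 0) = 𝓝 OnePoint.infty := by
  refine le_antisymm ?_ ?_
  · have h1 : Tendsto chartInfty (𝓝[≠] 0) (𝓝 OnePoint.infty) := by
      have : Tendsto (fun p : ℂ => ((p⁻¹ : ℂ) : OnePoint ℂ)) (𝓝[≠] 0) (𝓝 OnePoint.infty) := by
        refine OnePoint.tendsto_coe_infty.comp ?_
        rw [coclosedCompact_eq_cocompact, ← Metric.cobounded_eq_cocompact]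
        exact tendsto_inv₀_nhdsNE_zero
      refine this.congr' ?_
      filter_upwards [self_mem_nhdsWithin] with p hp
      have : p ≠ 0 := hp
      simp [chartInfty, this]
    have h2 : Tendsto chartInfty (pure 0) (𝓝 OnePoint.infty) := by
      rw [tendsto_pure_left]
      intro s hs
      have : chartInfty 0 = OnePoint.infty := by simp [chartInfty]
      rw [this]
      exact mem_of_mem_nhds hs
    have := h1.sup h2
    rwa [nhdsNE_sup_pure] at this
  · intro s hs
    have h1 := tendsto_inv_infty (mem_map.1 hs)
    have h2 : ∀ᶠ z in 𝓝 (OnePoint.infty : OnePoint ℂ), z ≠ ((0 : ℂ) : OnePoint ℂ) :=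
      eventually_ne_nhds (OnePoint.coe_ne_infty _).symm
    filter_upwards [h1, h2] with z hz1 hz2
    induction z using OnePoint.rec with
    | infty => simpa [chartInfty] using hz1
    | coe z =>
      have h0 : z ≠ 0 := by rintro rfl; exact hz2 rfl
      simpa [chartInfty, h0] using hz1

/-- Holomorphic charts of the Riemann sphere. -/
lemma exists_chart (z : OnePoint ℂ) : ∃ (χ : ℂ → OnePoint ℂ) (p : ℂ), χ p = z ∧
    map χ (𝓝 p) = 𝓝 z ∧ ∀ a b : ℝ, a < b → z ∈ slitDomain a b →
      ∀ᶠ q in 𝓝 p, DifferentiableAt ℂ (fun q => phi a b (χ q)) q := by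
  induction z using OnePoint.rec with
  | infty =>
    refine ⟨chartInfty, 0, by simp [chartInfty], map_chartInfty, fun a b hab hz => ?_⟩
    have hD : ∀ᶠ q in 𝓝 (0 : ℂ), chartInfty q ∈ slitDomain a b := by
      have := (isOpen_slitDomain a b).mem_nhds hz
      rw [← map_chartInfty] at this
      exact this
    have hne : ∀ᶠ q : ℂ in 𝓝 0, 2 - ((a : ℂ) + b) * q ≠ 0 := by
      have : ContinuousAt (fun q : ℂ => 2 - ((a : ℂ) + b) * q) 0 := by fun_prop
      exact this.eventually_ne (by simp)
    filter_upwards [hD, hne] with q hq1 hq2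
    have h1 := slitCoord_mem_slitPlane hab hq1
    rw [slitCoord_chartInfty] at h1
    simp only [phi, slitCoord_chartInfty]
    exact DifferentiableAt.comp (g := joukowskiInv)
      (f := fun q : ℂ => (b - a) * q / (2 - (a + b) * q)) q
      (differentiableAt_joukowskiInv h1) (DifferentiableAt.div (by fun_prop) (by fun_prop) hq2)
  | coe z =>
    refine ⟨(↑), z, rfl, (OnePoint.nhds_coe_eq z).symm, fun a b hab hz => ?_⟩
    have := (isOpen_slitDomain a b).mem_nhds hz
    rw [OnePoint.nhds_coe_eq] at this
    filter_upwards [this] with q hq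
    exact differentiableAt_phi_coe hab hq

/-- The strong maximum principle for sums of harmonic extensions. -/
lemma eventually_eq_of_isMax {ι : Type*} (s : Finset ι) {a b : ι → ℝ} (hab : ∀ j, a j < b j)
    {h : ι → ℝ → ℝ} (hh : ∀ j, Continuous (h j)) {z : OnePoint ℂ}
    (hz : ∀ j ∈ s, z ∈ slitDomain (a j) (b j))
    (hmax : ∀ y, ∑ j ∈ s, harmonicExt (a j) (b j) (h j) y ≤
      ∑ j ∈ s, harmonicExt (a j) (b j) (h j) z) :
    ∀ᶠ y in 𝓝 z, ∑ j ∈ s, harmonicExt (a j) (b j) (h j) y =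
      ∑ j ∈ s, harmonicExt (a j) (b j) (h j) z := by
  obtain ⟨χ, p, hχ, hmap, hd⟩ := exists_chart z
  -- Exponentiating the sum of holomorphic Herglotz integrals turns the harmonic sum into the
  -- logarithm of a modulus, so the maximum modulus principle applies.
  set f : ℂ → ℂ := fun q => Complex.exp (∑ j ∈ s,
    herglotz (fun t => h j (Real.cos t)) (phi (a j) (b j) (χ q))) with hf
  have hD : ∀ᶠ q in 𝓝 p, ∀ j ∈ s, χ q ∈ slitDomain (a j) (b j) := by
    rw [eventually_all_finset]
    intro j hj
    have := (isOpen_slitDomain (a j) (b j)).mem_nhds (hz j hj)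
    rw [← hmap] at this
    exact this
  have hdiff : ∀ᶠ q in 𝓝 p, ∀ j ∈ s,
      DifferentiableAt ℂ (fun q => phi (a j) (b j) (χ q)) q := by
    rw [eventually_all_finset]
    exact fun j hj => hd _ _ (hab j) (hz j hj)
  have hnorm : ∀ q, (∀ j ∈ s, χ q ∈ slitDomain (a j) (b j)) →
      ‖f q‖ = Real.exp (∑ j ∈ s, harmonicExt (a j) (b j) (h j) (χ q)) := by
    intro q hq
    rw [hf, Complex.norm_exp, Complex.re_sum]
    congr 1
    exact Finset.sum_congr rfl fun j hj => (harmonicExt_of_mem _ (hq j hj)).symm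
  have hfd : ∀ᶠ q in 𝓝 p, DifferentiableAt ℂ f q := by
    filter_upwards [hD, hdiff] with q hq1 hq2
    refine DifferentiableAt.cexp (DifferentiableAt.fun_sum fun j hj => ?_)
    refine DifferentiableAt.comp (g := herglotz fun t => h j (Real.cos t))
      (f := fun q => phi (a j) (b j) (χ q)) q ?_ (hq2 j hj)
    rw [herglotz_comp_cos_eq]
    exact differentiableAt_herglotz ((hh j).comp Complex.continuous_re)
      (norm_phi_lt_one (hab j) (hq1 j hj))
  have hp : ∀ j ∈ s, χ p ∈ slitDomain (a j) (b j) := hχ ▸ hz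
  have hloc : IsLocalMax (norm ∘ f) p := by
    filter_upwards [hD] with q hq
    simp only [Function.comp_apply]
    rw [hnorm q hq, hnorm p hp, hχ, Real.exp_le_exp]
    exact hmax _
  have hev := Complex.norm_eventually_eq_of_isLocalMax hfd hloc
  rw [← hmap, eventually_map]
  filter_upwards [hev, hD] with q hq1 hq2
  rw [hnorm q hq2, hnorm p hp, hχ] at hq1
  exact Real.exp_injective hq1

lemma frequently_mem_slitDomain (a b x : ℝ) :
    ∃ᶠ y in 𝓝 ((x : ℂ) : OnePoint ℂ), y ∈ slitDomain a b := by
  rw [OnePoint.nhds_coe_eq, frequently_map, Metric.nhds_basis_ball.frequently_iff]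
  intro ε hε
  refine ⟨x + (ε / 2 : ℝ) * Complex.I, ?_, coe_mem_slitDomain_of_im_ne_zero ?_⟩
  · rw [Metric.mem_ball, dist_eq_norm, add_sub_cancel_left, norm_mul, Complex.norm_I, mul_one,
      Complex.norm_real, Real.norm_eq_abs, abs_of_pos (by positivity)]
    linarith
  · simp [hε.ne']

/-- The homogeneous vector Szegő boundary value problem has only the trivial solution. -/
theorem eq_zero_of_homogeneous {d : ℕ} {a b : Fin d → ℝ} (hab : ∀ i, a i < b i)
    (hdisj : ∀ i j, i ≠ j → Disjoint (Set.Icc (a i) (b i)) (Set.Icc (a j) (b j)))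
    {h : Fin d → ℝ → ℝ} (hh : ∀ i, Continuous (h i))
    (heq : ∀ i, ∀ s ∈ Set.Icc (-1 : ℝ) 1, 2 * h i s + ∑ j ∈ Finset.univ.erase i,
      harmonicExt (a j) (b j) (h j) ((xmap (a i) (b i) s : ℂ) : OnePoint ℂ) = 0)
    (i : Fin d) {s : ℝ} (hs : s ∈ Set.Icc (-1 : ℝ) 1) : h i s = 0 := by
  set U : Fin d → OnePoint ℂ → ℝ := fun j => harmonicExt (a j) (b j) (h j) with hU
  set W : OnePoint ℂ → ℝ := fun z => ∑ j, U j z with hW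
  have hUc : ∀ j, Continuous (U j) := fun j => continuous_harmonicExt (hab j) (hh j)
  have hWc : Continuous W := continuous_finsetSum _ fun j _ => hUc j
  have hWsplit : ∀ i z, W z = U i z + ∑ j ∈ Finset.univ.erase i, U j z := fun i z =>
    (Finset.add_sum_erase _ _ (Finset.mem_univ i)).symm
  -- On the `i`-th slit `W` is `h i` plus the other extensions, which the equation makes equal to
  -- `-2 * h i`. A maximum `N` of `W` thus bounds every `h i`, and every extension, below by `-N`.
  have hWslit : ∀ i, ∀ s ∈ Set.Icc (-1 : ℝ) 1,
      W ((xmap (a i) (b i) s : ℂ) : OnePoint ℂ) = -h i s := by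
    intro i s hs
    rw [hWsplit i, hU]
    simp only
    rw [harmonicExt_xmap (hab i) (h i) hs]
    linarith [heq i s hs]
  obtain ⟨z₀, -, hz₀⟩ := isCompact_univ.exists_isMaxOn Set.univ_nonempty hWc.continuousOn
  have hmax : ∀ z, W z ≤ W z₀ := fun z => hz₀ (Set.mem_univ z)
  set N := W z₀ with hN
  have hge : ∀ i, ∀ s ∈ Set.Icc (-1 : ℝ) 1, -N ≤ h i s := fun i s hs => by
    have := hmax ((xmap (a i) (b i) s : ℂ) : OnePoint ℂ)
    rw [hWslit i s hs] at this
    linarith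
  have hUge : ∀ i z, -N ≤ U i z := fun i z => le_harmonicExt (hab i) (hh i) (hge i) z
  have hopen : IsOpen {z | W z = N} := by
    rw [isOpen_iff_mem_nhds]
    intro z hz
    have hz : W z = N := hz
    by_cases hzD : ∀ j, z ∈ slitDomain (a j) (b j)
    · have := eventually_eq_of_isMax Finset.univ hab hh (fun j _ => hzD j)
        (fun y => (hmax y).trans hz.ge)
      filter_upwards [this] with y hy
      exact hy.trans hz
    · push Not at hzD
      obtain ⟨i, hi⟩ := hzD
      obtain ⟨s, hs, rfl⟩ := exists_xmap_of_notMem (hab i) hi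
      have hVD : ∀ j ∈ Finset.univ.erase i,
          ((xmap (a i) (b i) s : ℂ) : OnePoint ℂ) ∈ slitDomain (a j) (b j) := fun j hj =>
        ofReal_mem_slitDomain_iff.2 fun hx => Set.disjoint_left.1
          (hdisj i j (Finset.ne_of_mem_erase hj).symm) (xmap_mem_Icc (hab i) hs) hx
      have hhi : h i s = -N := by
        have := hWslit i s hs
        rw [hz] at this
        linarith
      have hVz :
          ∑ j ∈ Finset.univ.erase i, U j ((xmap (a i) (b i) s : ℂ) : OnePoint ℂ) = 2 * N := by
        have := heq i s hs
        rw [hhi] at this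
        linarith
      -- At a maximum on the `i`-th slit the other extensions sum to `2 * N`. This is their global
      -- maximum, since the sum is `W - U i ≤ N + N`. They are harmonic near that point because the
      -- slits are disjoint, so the maximum principle applies to them there.
      have hVle : ∀ y, ∑ j ∈ Finset.univ.erase i, U j y ≤
          ∑ j ∈ Finset.univ.erase i, U j ((xmap (a i) (b i) s : ℂ) : OnePoint ℂ) := by
        intro y
        rw [hVz]
        have h1 := hWsplit i y
        have h2 := hmax y
        have h3 := hUge i y
        linarith
      have hVev := eventually_eq_of_isMax (Finset.univ.erase i) hab hh hVD hVle
      -- At a nearby point off the slit `U i` must equal its lower bound `-N`. The strong minimum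
      -- principle then makes `h i` constant, hence `W = N` in a full neighbourhood.
      obtain ⟨y, hyD, hy⟩ := ((frequently_mem_slitDomain (a i) (b i) _).and_eventually hVev).exists
      have hUy : U i y = -N := by
        refine le_antisymm ?_ (hUge i y)
        have h1 := hWsplit i y
        have h2 := hmax y
        have hy' : ∑ j ∈ Finset.univ.erase i, U j y = 2 * N := hy.trans hVz
        linarith
      have hconst : ∀ s ∈ Set.Icc (-1 : ℝ) 1, h i s = -N := fun s hs =>
        eq_of_harmonicExt_eq (hab i) (hh i) (hge i) hyD hUy hs
      filter_upwards [hVev] with y hy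
      have hUi : U i y = -N := harmonicExt_eq_const (hab i) hconst y
      have hy' : ∑ j ∈ Finset.univ.erase i, U j y = 2 * N := hy.trans hVz
      have h1 := hWsplit i y
      change W y = N
      linarith
  have hall : {z | W z = N} = Set.univ :=
    IsClopen.eq_univ ⟨isClosed_eq hWc continuous_const, hopen⟩ ⟨z₀, rfl⟩
  have hWN : ∀ z, W z = N := fun z => Set.eq_univ_iff_forall.1 hall z
  have hconst : ∀ i, ∀ s ∈ Set.Icc (-1 : ℝ) 1, h i s = -N := fun i s hs => by
    have := hWslit i s hs
    rw [hWN] at this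
    linarith
  have hfin := heq i s hs
  rw [hconst i s hs, Finset.sum_congr rfl fun j _ => harmonicExt_eq_const (hab j) (hconst j) _,
    Finset.sum_const, nsmul_eq_mul] at hfin
  -- All data equal `-N`, so the equation becomes `(2 + card) * N = 0` with a positive coefficient.
  have hN0 : N = 0 := by
    have h1 : (2 + ((Finset.univ.erase i).card : ℝ)) * N = 0 := by linarith
    exact (mul_eq_zero.1 h1).resolve_left (by positivity)
  rw [hconst i s hs, hN0, neg_zero]

/-! ### The interaction operator and the Fredholm alternative -/

/-- The sum over `j ≠ i` of the harmonic extensions of `v j`, on the interval `Δᵢ`. -/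
def interaction {d : ℕ} (a b : Fin d → ℝ) (v : Fin d → ℝ → ℝ) (i : Fin d) (s : ℝ) : ℝ :=
  ∑ j ∈ Finset.univ.erase i, (herglotz (fun t => v j (Real.cos t))
    (phi (a j) (b j) ((xmap (a i) (b i) s : ℂ) : OnePoint ℂ))).re

/-- Continuous functions on `d` copies of `[-1, 1]`. -/
abbrev BoundarySpace (d : ℕ) : Type :=
  BoundedContinuousFunction (Fin d × Set.Icc (-1 : ℝ) 1) ℝ

/-- The extension of a component of an element of `BoundarySpace d` to the real line. -/
def comp {d : ℕ} (g : BoundarySpace d) (j : Fin d) (s : ℝ) : ℝ :=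
  g (j, Set.projIcc (-1) 1 (by norm_num) s)

lemma continuous_comp {d : ℕ} (g : BoundarySpace d) (j : Fin d) : Continuous (comp g j) :=
  g.continuous.comp (Continuous.prodMk continuous_const continuous_projIcc)

lemma abs_comp_le {d : ℕ} (g : BoundarySpace d) (j : Fin d) (s : ℝ) : |comp g j s| ≤ ‖g‖ :=
  g.norm_coe_le_norm _

lemma comp_of_mem {d : ℕ} (g : BoundarySpace d) (j : Fin d) (s : Set.Icc (-1 : ℝ) 1) :
    comp g j s = g (j, s) := by
  rw [comp, Set.projIcc_val]

lemma integrableAngle_comp {d : ℕ} (g : BoundarySpace d) (j : Fin d) :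
    IntegrableAngle fun t => comp g j (Real.cos t) :=
  integrableAngle_of_continuous ((continuous_comp g j).comp Real.continuous_cos)

lemma integral_abs_comp_le {d : ℕ} (g : BoundarySpace d) (j : Fin d) :
    ∫ t in Set.Ioc 0 (2 * Real.pi), |comp g j (Real.cos t)| ≤ 2 * Real.pi * ‖g‖ := by
  refine (integral_mono (integrableAngle_comp g j).abs (integrableAngle_const ‖g‖)
    fun t => abs_comp_le g j _).trans (le_of_eq ?_)
  simp [Real.pi_pos.le]

/-- Families of pairwise disjoint intervals. -/
structure DisjointIntervals {d : ℕ} (a b : Fin d → ℝ) : Prop where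
  lt : ∀ i, a i < b i
  disjoint : ∀ i j, i ≠ j → Disjoint (Set.Icc (a i) (b i)) (Set.Icc (a j) (b j))

variable {d : ℕ} {a b : Fin d → ℝ}

lemma DisjointIntervals.xmap_mem (hI : DisjointIntervals a b) {i j : Fin d}
    (hj : j ∈ Finset.univ.erase i) {s : ℝ} (hs : s ∈ Set.Icc (-1 : ℝ) 1) :
    ((xmap (a i) (b i) s : ℂ) : OnePoint ℂ) ∈ slitDomain (a j) (b j) :=
  ofReal_mem_slitDomain_iff.2 fun hx => Set.disjoint_left.1
    (hI.disjoint i j (Finset.ne_of_mem_erase hj).symm) (xmap_mem_Icc (hI.lt i) hs) hx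

lemma DisjointIntervals.norm_phi_lt (hI : DisjointIntervals a b) {i j : Fin d}
    (hj : j ∈ Finset.univ.erase i) {s : ℝ} (hs : s ∈ Set.Icc (-1 : ℝ) 1) :
    ‖phi (a j) (b j) ((xmap (a i) (b i) s : ℂ) : OnePoint ℂ)‖ < 1 :=
  norm_phi_lt_one (hI.lt j) (hI.xmap_mem hj hs)

lemma continuous_coe_xmap (a b : ℝ) :
    Continuous fun s : ℝ => ((xmap a b s : ℂ) : OnePoint ℂ) := by
  refine OnePoint.continuous_coe.comp (Complex.continuous_ofReal.comp ?_)
  unfold xmap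
  fun_prop

lemma DisjointIntervals.continuous_phi_xmap (hI : DisjointIntervals a b) {i j : Fin d}
    (hj : j ∈ Finset.univ.erase i) : Continuous fun s : Set.Icc (-1 : ℝ) 1 =>
      phi (a j) (b j) ((xmap (a i) (b i) s : ℂ) : OnePoint ℂ) := by
  rw [continuous_iff_continuousAt]
  intro s
  exact tendsto_phi (hI.lt j) tendsto_const_nhds tendsto_const_nhds
    (((continuous_coe_xmap (a i) (b i)).comp continuous_subtype_val).tendsto s)
    (hI.xmap_mem hj s.2)

/-- Integrable data suffice, since disjointness keeps all evaluation points strictly inside the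
disk. This is what allows a continuous correction to a datum that is only integrable. -/
lemma continuous_interaction (hI : DisjointIntervals a b) {v : Fin d → ℝ → ℝ}
    (hv : ∀ j, IntegrableAngle fun t => v j (Real.cos t)) :
    Continuous fun p : Fin d × Set.Icc (-1 : ℝ) 1 => interaction a b v p.1 p.2 := by
  rw [continuous_prod_of_discrete_left]
  intro i
  change Continuous fun s : Set.Icc (-1 : ℝ) 1 => ∑ j ∈ Finset.univ.erase i,
    (herglotz (fun t => v j (Real.cos t))
      (phi (a j) (b j) ((xmap (a i) (b i) s : ℂ) : OnePoint ℂ))).re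
  refine continuous_finsetSum _ fun j hj => ?_
  have hc : Continuous fun s : Set.Icc (-1 : ℝ) 1 => herglotz (fun t => v j (Real.cos t))
      (phi (a j) (b j) ((xmap (a i) (b i) s : ℂ) : OnePoint ℂ)) :=
    continuous_iff_continuousAt.2 fun s =>
      (continuousAt_herglotz (hv j) (hI.norm_phi_lt hj s.2)).tendsto.comp
        ((hI.continuous_phi_xmap hj).tendsto s)
  exact Complex.continuous_re.comp hc

/-- `interaction` as an element of `BoundarySpace d`. -/
def interactionFun (hI : DisjointIntervals a b) {v : Fin d → ℝ → ℝ}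
    (hv : ∀ j, IntegrableAngle fun t => v j (Real.cos t)) : BoundarySpace d :=
  BoundedContinuousFunction.mkOfCompact ⟨_, continuous_interaction hI hv⟩

lemma interactionFun_apply (hI : DisjointIntervals a b) {v : Fin d → ℝ → ℝ}
    (hv : ∀ j, IntegrableAngle fun t => v j (Real.cos t)) (p : Fin d × Set.Icc (-1 : ℝ) 1) :
    interactionFun hI hv p = interaction a b v p.1 p.2 := rfl

lemma interaction_add (hI : DisjointIntervals a b) {v w : Fin d → ℝ → ℝ}
    (hv : ∀ j, IntegrableAngle fun t => v j (Real.cos t))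
    (hw : ∀ j, IntegrableAngle fun t => w j (Real.cos t)) (i : Fin d) {s : ℝ}
    (hs : s ∈ Set.Icc (-1 : ℝ) 1) :
    interaction a b (fun j s => v j s + w j s) i s =
      interaction a b v i s + interaction a b w i s := by
  unfold interaction
  rw [← Finset.sum_add_distrib]
  refine Finset.sum_congr rfl fun j hj => ?_
  rw [herglotz_add (hv j) (hw j) (hI.norm_phi_lt hj hs), Complex.add_re]

lemma interaction_const_mul (c : ℝ) (v : Fin d → ℝ → ℝ) (i : Fin d) (s : ℝ) :
    interaction a b (fun j s => c * v j s) i s = c * interaction a b v i s := by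
  unfold interaction
  rw [Finset.mul_sum]
  refine Finset.sum_congr rfl fun j _ => ?_
  rw [herglotz_const_mul, Complex.re_ofReal_mul]

lemma abs_interaction_comp_le (hI : DisjointIntervals a b) (g : BoundarySpace d) (i : Fin d) {s : ℝ}
    (hs : s ∈ Set.Icc (-1 : ℝ) 1) : |interaction a b (comp g) i s| ≤ d * ‖g‖ := by
  unfold interaction
  refine (Finset.abs_sum_le_sum_abs _ _).trans ?_
  calc _ ≤ ∑ j ∈ Finset.univ.erase i, ‖g‖ := Finset.sum_le_sum fun j hj =>
        abs_re_herglotz_le (integrableAngle_comp g j) (hI.norm_phi_lt hj hs) fun t =>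
          abs_comp_le g j _
    _ ≤ ∑ j : Fin d, ‖g‖ := Finset.sum_le_sum_of_subset_of_nonneg (Finset.erase_subset _ _)
        fun _ _ _ => norm_nonneg _
    _ = d * ‖g‖ := by simp

/-- The interaction operator. -/
def interactionCLM (hI : DisjointIntervals a b) : BoundarySpace d →L[ℝ] BoundarySpace d :=
  LinearMap.mkContinuous
    { toFun := fun g => interactionFun hI (integrableAngle_comp g)
      map_add' := fun g g' => by
        ext p
        simp only [interactionFun_apply, BoundedContinuousFunction.coe_add, Pi.add_apply]
        exact interaction_add hI (integrableAngle_comp g) (integrableAngle_comp g') p.1 p.2.2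
      map_smul' := fun c g => by
        ext p
        simp only [interactionFun_apply, BoundedContinuousFunction.coe_smul, smul_eq_mul,
          RingHom.id_apply]
        exact interaction_const_mul c (comp g) p.1 p.2 } d fun g =>
    (BoundedContinuousFunction.norm_le (by positivity)).2 fun p =>
      abs_interaction_comp_le hI g p.1 p.2.2

lemma interactionCLM_apply (hI : DisjointIntervals a b) (g : BoundarySpace d)
    (p : Fin d × Set.Icc (-1 : ℝ) 1) :
    interactionCLM hI g p = interaction a b (comp g) p.1 p.2 := rfl

/-- A modulus of continuity for Herglotz integrals. -/
def diskModulus (w w' : ℂ) : ℝ := 2 * ‖w - w'‖ / ((1 - ‖w‖) * (1 - ‖w'‖))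

lemma diskModulus_nonneg {w w' : ℂ} (hw : ‖w‖ < 1) (hw' : ‖w'‖ < 1) : 0 ≤ diskModulus w w' := by
  have : 0 < 1 - ‖w‖ := by linarith
  have : 0 < 1 - ‖w'‖ := by linarith
  unfold diskModulus
  positivity

lemma tendsto_diskModulus {α : Type*} {l : Filter α} {w w' : α → ℂ} {w₀ : ℂ} (hw₀ : ‖w₀‖ < 1)
    (hw : Tendsto w l (𝓝 w₀)) (hw' : Tendsto w' l (𝓝 w₀)) :
    Tendsto (fun x => diskModulus (w x) (w' x)) l (𝓝 0) := by
  have h0 : (1 - ‖w₀‖) * (1 - ‖w₀‖) ≠ 0 := by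
    have : 0 < 1 - ‖w₀‖ := by linarith
    positivity
  have := Tendsto.div ((hw.sub hw').norm.const_mul 2)
    ((hw.norm.const_sub 1).mul (hw'.norm.const_sub 1)) h0
  simp only [sub_self, norm_zero, mul_zero, zero_div] at this
  exact this

lemma abs_re_herglotz_comp_sub_le (g : BoundarySpace d) (j : Fin d) {w w' : ℂ} (hw : ‖w‖ < 1)
    (hw' : ‖w'‖ < 1) :
    |(herglotz (fun t => comp g j (Real.cos t)) w).re -
      (herglotz (fun t => comp g j (Real.cos t)) w').re| ≤
      diskModulus w w' * (2 * Real.pi * ‖g‖) := by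
  rw [← Complex.sub_re]
  refine (Complex.abs_re_le_norm _).trans
    ((norm_herglotz_sub_le (integrableAngle_comp g j) hw hw').trans ?_)
  exact mul_le_mul_of_nonneg_left (integral_abs_comp_le g j) (diskModulus_nonneg hw hw')

/-- By Arzelà–Ascoli: the image of the unit ball is bounded by `d`, and `diskModulus` at interior
points is a common modulus of continuity depending only on the `L¹` norms of the data. -/
lemma isCompactOperator_interactionCLM (hI : DisjointIntervals a b) :
    IsCompactOperator (interactionCLM hI) := by
  change IsCompactOperator ((interactionCLM hI : BoundarySpace d →ₗ[ℝ] BoundarySpace d))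
  rw [isCompactOperator_iff_isCompact_closure_image_closedBall _ one_pos]
  refine BoundedContinuousFunction.arzela_ascoli (Metric.closedBall 0 d)
    (isCompact_closedBall _ _) _ ?_ ?_
  · rintro _ p ⟨g, hg, rfl⟩
    rw [mem_closedBall_zero_iff] at hg ⊢
    refine (abs_interaction_comp_le hI g p.1 p.2.2).trans ?_
    exact mul_le_of_le_one_right (by positivity) hg
  · rintro ⟨i, s⟩
    set m : Fin d × Set.Icc (-1 : ℝ) 1 → ℝ := fun p => ∑ j ∈ Finset.univ.erase i,
      diskModulus (phi (a j) (b j) ((xmap (a i) (b i) s : ℂ) : OnePoint ℂ))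
        (phi (a j) (b j) ((xmap (a i) (b i) p.2 : ℂ) : OnePoint ℂ)) * (2 * Real.pi) with hm
    refine Metric.equicontinuousAt_of_continuity_modulus m ?_ _ ?_
    · have : Tendsto m (𝓝 (i, s)) (𝓝 (∑ j ∈ Finset.univ.erase i, 0 * (2 * Real.pi))) := by
        refine tendsto_finsetSum _ fun j hj => Tendsto.mul_const _ ?_
        exact tendsto_diskModulus (hI.norm_phi_lt hj s.2) tendsto_const_nhds
          (((hI.continuous_phi_xmap hj).comp continuous_snd).tendsto (i, s))
      simpa using this
    · have : ∀ᶠ p : Fin d × Set.Icc (-1 : ℝ) 1 in 𝓝 (i, s), p.1 = i :=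
        (continuous_fst.tendsto (i, s)).eventually (mem_nhds_discrete.2 rfl : {i} ∈ 𝓝 i)
      filter_upwards [this] with p hp
      rintro ⟨_, g, hg, rfl⟩
      rw [mem_closedBall_zero_iff] at hg
      obtain ⟨i', s'⟩ := p
      obtain rfl : i' = i := hp
      change dist (interactionCLM hI g (i', s)) (interactionCLM hI g (i', s')) ≤ _
      rw [interactionCLM_apply, interactionCLM_apply, Real.dist_eq, interaction, interaction,
        ← Finset.sum_sub_distrib]
      refine (Finset.abs_sum_le_sum_abs _ _).trans (Finset.sum_le_sum fun j hj => ?_)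
      have h1 := hI.norm_phi_lt hj s.2
      have h2 := hI.norm_phi_lt hj s'.2
      refine (abs_re_herglotz_comp_sub_le g j h1 h2).trans ?_
      refine mul_le_mul_of_nonneg_left ?_ (diskModulus_nonneg h1 h2)
      exact mul_le_of_le_one_right Real.two_pi_pos.le hg

/-- An eigenvector for `-2` would be a nonzero solution of the homogeneous boundary value problem.
-/
lemma not_hasEigenvalue_interactionCLM (hI : DisjointIntervals a b) :
    ¬ Module.End.HasEigenvalue (interactionCLM hI : Module.End ℝ (BoundarySpace d)) (-2) := by
  intro h
  obtain ⟨g, hg⟩ := h.exists_hasEigenvector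
  have hg1 : interactionCLM hI g = (-2 : ℝ) • g := hg.apply_eq_smul
  refine hg.2 ?_
  ext ⟨i, s⟩
  have := eq_zero_of_homogeneous hI.lt hI.disjoint (continuous_comp g) (fun i s hs => ?_) i s.2
  · rwa [comp_of_mem] at this
  · have h1 := congrArg (fun f : BoundarySpace d => f (i, ⟨s, hs⟩)) hg1
    simp only [interactionCLM_apply, BoundedContinuousFunction.coe_smul, smul_eq_mul] at h1
    rw [← comp_of_mem g i ⟨s, hs⟩, interaction] at h1
    rw [Finset.sum_congr rfl fun j hj => harmonicExt_of_mem (comp g j) (hI.xmap_mem hj hs), h1]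
    ring

/-- Fredholm alternative: since `-2` is not an eigenvalue of the compact operator, it lies in the
resolvent set. The resolvent operator is `-2 - T`, hence the sign change of `r`. -/
lemma exists_interaction_solution (hI : DisjointIntervals a b) (r : BoundarySpace d) :
    ∃ g : BoundarySpace d, (2 : ℝ) • g + interactionCLM hI g = r := by
  have h := ((isCompactOperator_interactionCLM hI).hasEigenvalue_or_mem_resolventSet
    (μ := (-2 : ℝ)) (by norm_num)).resolve_left (not_hasEigenvalue_interactionCLM hI)
  rw [spectrum.mem_resolventSet_iff, ContinuousLinearMap.isUnit_iff_bijective] at h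
  obtain ⟨g, hg⟩ := h.2 (-r)
  refine ⟨g, ?_⟩
  have : algebraMap ℝ (BoundarySpace d →L[ℝ] BoundarySpace d) (-2) g - interactionCLM hI g =
    -r := hg
  rw [Algebra.algebraMap_eq_smul_one, smul_apply,
    one_apply_eq_self] at this
  rw [← neg_neg r, ← this]
  module

/-- The quantitative form of injectivity. Used for the limiting intervals only, it controls the
corrections for all nearby intervals. -/
lemma exists_norm_le_interaction (hI : DisjointIntervals a b) :
    ∃ K : ℝ, 0 ≤ K ∧ ∀ g : BoundarySpace d, ‖g‖ ≤ K * ‖(2 : ℝ) • g + interactionCLM hI g‖ := by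
  obtain ⟨K, hK⟩ := (isCompactOperator_interactionCLM hI).antilipschitz_of_not_hasEigenvalue
    (μ := (-2 : ℝ)) (by norm_num) (not_hasEigenvalue_interactionCLM hI)
  refine ⟨K, K.2, fun g => ?_⟩
  have := hK.le_mul_dist g 0
  rw [dist_zero_right, map_zero, dist_zero_right] at this
  have e : (interactionCLM hI - (-2 : ℝ) • 1) g = (2 : ℝ) • g + interactionCLM hI g := by
    rw [sub_apply, smul_apply, one_apply_eq_self]
    module
  rwa [e] at this

/-! ### Outer functions with prescribed boundary modulus -/

/-- The outer function on `D_Δ` whose modulus on `Δ` is `exp v`, in the coordinate of `[-1, 1]`. -/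
def outerExp (a b : ℝ) (v : ℝ → ℝ) (z : OnePoint ℂ) : ℂ :=
  Complex.exp (herglotz (fun t => v (Real.cos t)) (phi a b z))

lemma ae_tendsto_re_herglotz_phi {a b : ℝ} (hab : a < b) {k : ℝ → ℝ} (hk : IntegrableAngle k) :
    ∀ᵐ t ∂angleMeasure, ∀ σ κ : ℝ, |σ| = 1 → σ * Real.sin t < 0 → 0 < κ →
      Tendsto (fun z : ℂ => ‖Complex.exp (herglotz k (phi a b z))‖)
        (𝓝[{z : ℂ | |z.re - xmap a b (Real.cos t)| < κ * (σ * z.im)}]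
          (xmap a b (Real.cos t) : ℂ)) (𝓝 (Real.exp (k t))) := by
  filter_upwards [ae_tendsto_re_herglotz hk] with t ht σ κ hσ hst hκ
  obtain ⟨C, hC⟩ := tendsto_phi_stolz hab hσ hst hκ
  simp only [Complex.norm_exp]
  exact (Real.continuous_exp.tendsto _).comp ((ht C).comp hC)

/-- Non-triviality of the approach filter makes non-tangential limits unique. -/
lemma neBot_cone (x : ℝ) {κ σ : ℝ} (hκ : 0 < κ) (hσ : |σ| = 1) :
    (𝓝[{z : ℂ | |z.re - x| < κ * (σ * z.im)}] (x : ℂ)).NeBot := by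
  have hσ2 : σ * σ = 1 := by rw [← abs_mul_abs_self, hσ, one_mul]
  have h : Tendsto (fun ε : ℝ => ((x : ℂ) + (σ * ε : ℝ) * Complex.I)) (𝓝[>] 0)
      (𝓝[{z : ℂ | |z.re - x| < κ * (σ * z.im)}] (x : ℂ)) := by
    refine tendsto_nhdsWithin_iff.2 ⟨?_, ?_⟩
    · have : Continuous fun ε : ℝ => ((x : ℂ) + (σ * ε : ℝ) * Complex.I) := by fun_prop
      have := this.tendsto 0
      simp only [mul_zero, Complex.ofReal_zero, zero_mul, add_zero] at this
      exact this.mono_left nhdsWithin_le_nhds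
    · filter_upwards [self_mem_nhdsWithin] with ε hε
      have : 0 < κ * ε := mul_pos hκ hε
      simp only [Complex.add_re, Complex.ofReal_re, Complex.re_ofReal_mul,
        Complex.I_re, Complex.add_im, Complex.ofReal_im, Complex.im_ofReal_mul, Complex.I_im]
      rw [mul_zero, add_zero, sub_self, abs_zero, zero_add, mul_one, ← mul_assoc σ, hσ2, one_mul]
      exact this
  exact h.neBot

/-- The boundary datum is even in the angle, so the Herglotz integral is real at real points. The
products in the boundary condition are therefore positive. -/
lemma outerExp_ofReal {a b x : ℝ} (hab : a < b) (v : ℝ → ℝ) (hx : x ∉ Set.Icc a b) :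
    outerExp a b v ((x : ℂ) : OnePoint ℂ) =
      (Real.exp (herglotz (fun t => v (Real.cos t)) (phi a b ((x : ℂ) : OnePoint ℂ))).re : ℂ) := by
  have h1 : starRingEnd ℂ (phi a b ((x : ℂ) : OnePoint ℂ)) = phi a b ((x : ℂ) : OnePoint ℂ) :=
    Complex.conj_eq_iff_im.2 (phi_ofReal_im hab hx)
  have h2 := herglotz_conj (k := fun t => v (Real.cos t))
    (fun t => by rw [Real.cos_two_pi_sub]) (phi a b ((x : ℂ) : OnePoint ℂ))
  rw [h1] at h2
  rw [outerExp, Complex.ofReal_exp, Complex.conj_eq_iff_re.1 h2.symm]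

lemma prod_outerExp (hI : DisjointIntervals a b) (v : Fin d → ℝ → ℝ) (i : Fin d) {s : ℝ}
    (hs : s ∈ Set.Icc (-1 : ℝ) 1) :
    ∏ j ∈ Finset.univ.erase i, outerExp (a j) (b j) (v j)
      ((xmap (a i) (b i) s : ℂ) : OnePoint ℂ) = (Real.exp (interaction a b v i s) : ℂ) := by
  rw [interaction, Real.exp_sum, Complex.ofReal_prod]
  exact Finset.prod_congr rfl fun j hj => outerExp_ofReal (hI.lt j) _
    (ofReal_mem_slitDomain_iff.1 (hI.xmap_mem hj hs))

/-! ### Vector Szegő functions and the integral equation -/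

/-- The logarithm of the boundary modulus of the Szegő function determined by the correction
`g`. -/
def logSzego (μ : Fin d → Measure ℝ) (a b : Fin d → ℝ) (g : BoundarySpace d) (i : Fin d) (s : ℝ) :
    ℝ :=
  halfLogDensity (μ i) (a i) (b i) s + comp g i s

/-- The integral equation for the correction `g`. -/
def IsCorrection (μ : Fin d → Measure ℝ) (a b : Fin d → ℝ) (g : BoundarySpace d) : Prop :=
  ∀ (i : Fin d) (s : Set.Icc (-1 : ℝ) 1),
    2 * g (i, s) + interaction a b (logSzego μ a b g) i s = 0

lemma cos_mem_Icc (t : ℝ) : Real.cos t ∈ Set.Icc (-1 : ℝ) 1 :=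
  ⟨Real.neg_one_le_cos t, Real.cos_le_one t⟩

lemma IsCorrection.logSzego_cos {μ : Fin d → Measure ℝ} {g : BoundarySpace d}
    (hg : IsCorrection μ a b g) (i : Fin d) (t : ℝ) :
    2 * logSzego μ a b g i (Real.cos t) + interaction a b (logSzego μ a b g) i (Real.cos t) =
      2 * halfLogDensity (μ i) (a i) (b i) (Real.cos t) := by
  have h := hg i ⟨_, cos_mem_Icc t⟩
  rw [← comp_of_mem] at h
  simp only at h
  have e : logSzego μ a b g i (Real.cos t) =
    halfLogDensity (μ i) (a i) (b i) (Real.cos t) + comp g i (Real.cos t) := rfl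
  linarith

section Measures

variable {μ : Fin d → Measure ℝ} [∀ i, IsFiniteMeasure (μ i)]

lemma integrableAngle_logSzego (hI : DisjointIntervals a b)
    (hS : ∀ i, IsSzego (μ i) (a i) (b i)) (g : BoundarySpace d) (i : Fin d) :
    IntegrableAngle fun t => logSzego μ a b g i (Real.cos t) :=
  (integrableAngle_halfLogDensity (hI.lt i) (hS i)).add (integrableAngle_comp g i)

lemma exists_isCorrection (hI : DisjointIntervals a b) (hS : ∀ i, IsSzego (μ i) (a i) (b i)) :
    ∃ g : BoundarySpace d, IsCorrection μ a b g := by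
  have hF := fun i => integrableAngle_halfLogDensity (hI.lt i) (hS i)
  obtain ⟨g, hg⟩ := exists_interaction_solution hI
    (-interactionFun hI (v := fun i => halfLogDensity (μ i) (a i) (b i)) hF)
  refine ⟨g, fun i s => ?_⟩
  have h := congrArg (fun f : BoundarySpace d => f (i, s)) hg
  simp only [BoundedContinuousFunction.coe_add, BoundedContinuousFunction.coe_smul,
    BoundedContinuousFunction.coe_neg, Pi.add_apply, Pi.neg_apply, smul_eq_mul,
    interactionCLM_apply, interactionFun_apply] at h
  have e := interaction_add hI hF (integrableAngle_comp g) i s.2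
  have e' : interaction a b (logSzego μ a b g) i s =
    interaction a b (fun j s => halfLogDensity (μ j) (a j) (b j) s + comp g j s) i s := rfl
  rw [e', e]
  linarith

lemma exp_two_mul_halfLogDensity {μ : Measure ℝ} {a b s : ℝ}
    (h : 0 < arcsineDensity μ a b (xmap a b s)) :
    Real.exp (2 * halfLogDensity μ a b s) = arcsineDensity μ a b (xmap a b s) := by
  rw [halfLogDensity, ← mul_assoc, mul_one_div_cancel two_ne_zero, one_mul, Real.exp_log h]

lemma isConjSymm_outerExp {a b : ℝ} (hab : a < b) (v : ℝ → ℝ) :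
    IsConjSymm a b (outerExp a b v) := by
  have hc := herglotz_conj (k := fun t => v (Real.cos t)) fun t => by rw [Real.cos_two_pi_sub]
  refine ⟨fun z hz => ?_, ?_⟩
  · rw [outerExp, phi_conj hab hz, hc, Complex.exp_conj, outerExp]
  · rw [outerExp, phi_infty, ← Complex.exp_conj, ← hc, map_zero]

/-- Fatou's theorem gives the boundary modulus `exp v`. The exponential of the integral equation is
the required boundary identity. -/
lemma isVectorSzego_outerExp (hI : DisjointIntervals a b) (hS : ∀ i, IsSzego (μ i) (a i) (b i))
    {g : BoundarySpace d} (hg : IsCorrection μ a b g) :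
    IsVectorSzego μ a b fun i => outerExp (a i) (b i) (logSzego μ a b g i) := by
  intro i
  have hk := integrableAngle_logSzego hI hS g i
  refine ⟨⟨1, fun t => Real.exp (logSzego μ a b g i (Real.cos t)), norm_one,
    Eventually.of_forall fun t => Real.exp_pos _, ?_, ?_, fun z hz => ?_⟩,
    isConjSymm_outerExp (hI.lt i) _, ?_, ?_⟩
  · simpa only [Real.log_exp] using hk
  · exact memLp_exp_halfLogDensity_add (hI.lt i) (hS i) (continuous_comp g i).measurable
      (abs_comp_le g i)
  · simp only [Real.log_exp, outerExp, phi_phiInv (hI.lt i) hz, one_mul]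
    rfl
  · have h := (isConjSymm_outerExp (hI.lt i) (logSzego μ a b g i)).2
    have h2 := herglotz_conj (k := fun t => logSzego μ a b g i (Real.cos t))
      (fun t => by rw [Real.cos_two_pi_sub]) 0
    rw [map_zero] at h2
    refine ⟨?_, Complex.conj_eq_iff_im.1 h⟩
    simp only [outerExp, phi_infty]
    rw [← Complex.conj_eq_iff_re.1 h2.symm, ← Complex.ofReal_exp,
      Complex.ofReal_re]
    exact Real.exp_pos _
  -- Since `phi` interchanges half-planes, the limit from above is read at `2π - t` and the limit
  -- from below at `t`, for `t` in `(0, π)`.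
  · filter_upwards [ae_Icc_of_ae_angle (hI.lt i) ((ae_tendsto_re_herglotz_phi (hI.lt i) hk).and
      (arcsineDensity_pos_of_isSzego (hI.lt i) (hS i)))] with x ⟨t, ht, hx, h1, h2⟩
    have hsin := Real.sin_pos_of_mem_Ioo ht
    subst hx
    simp only [Real.cos_two_pi_sub, Real.sin_two_pi_sub] at h2
    set v := logSzego μ a b g i (Real.cos t) with hv
    have key : ((Real.exp v : ℝ) : ℂ) ^ 2 * ∏ j ∈ Finset.univ.erase i,
        outerExp (a j) (b j) (logSzego μ a b g j)
          ((xmap (a i) (b i) (Real.cos t) : ℂ) : OnePoint ℂ) =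
        (arcsineDensity (μ i) (a i) (b i) (xmap (a i) (b i) (Real.cos t)) : ℂ) := by
      rw [prod_outerExp hI _ i (cos_mem_Icc t), ← exp_two_mul_halfLogDensity h1.2.1,
        ← hg.logSzego_cos i t, Real.exp_add, two_mul, Real.exp_add, ← hv]
      push_cast
      ring
    refine ⟨Real.exp v, Real.exp v, fun κ hκ => ?_, fun κ hκ => ?_, key, key⟩
    · simpa only [one_mul, outerExp] using h2.1 1 κ (by simp) (by linarith) hκ
    · simpa only [neg_mul, one_mul, outerExp] using h1.1 (-1) κ (by simp) (by linarith) hκ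

lemma herglotz_zero (k : ℝ → ℝ) :
    herglotz k 0 = ((1 / (2 * Real.pi) * ∫ t in Set.Ioc 0 (2 * Real.pi), k t : ℝ) : ℂ) := by
  simp only [herglotz, add_zero, sub_zero, div_self (Complex.exp_ne_zero _), one_mul]
  rw [integral_complex_ofReal]
  push_cast
  rfl

/-- The Herglotz integral of a real function is real at the origin, so positivity at infinity makes
the unimodular constant a positive real, hence one. -/
lemma IsOuter.exists_eq_exp {a b : ℝ} (hab : a < b) {S : OnePoint ℂ → ℂ} (h : IsOuter a b S)
    (hre : 0 < (S OnePoint.infty).re) (him : (S OnePoint.infty).im = 0) :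
    ∃ k : ℝ → ℝ, IntegrableAngle k ∧
      ∀ z ∈ slitDomain a b, S z = Complex.exp (herglotz k (phi a b z)) := by
  obtain ⟨c, ψ, hc, -, hψ, -, hF⟩ := h
  have hz : ∀ z ∈ slitDomain a b,
      S z = c * Complex.exp (herglotz (fun t => Real.log (ψ t)) (phi a b z)) := fun z hz => by
    have := hF _ (norm_phi_lt_one hab hz)
    simp only [phiInv_phi hab hz] at this
    exact this
  refine ⟨_, hψ, fun z hz' => ?_⟩
  have h0 := hz _ (infty_mem_slitDomain a b)
  rw [phi_infty, herglotz_zero, ← Complex.ofReal_exp] at h0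
  set r := Real.exp (1 / (2 * Real.pi) * ∫ t in Set.Ioc 0 (2 * Real.pi), Real.log (ψ t)) with hr
  have hr0 : 0 < r := Real.exp_pos _
  rw [h0, Complex.re_mul_ofReal] at hre
  rw [h0, Complex.im_mul_ofReal] at him
  have him' : c.im = 0 := (mul_eq_zero.1 him).resolve_right hr0.ne'
  have hre' : 0 < c.re := pos_of_mul_pos_left hre hr0.le
  have hc1 : c = 1 := by
    have e : c = (c.re : ℂ) := (Complex.conj_eq_iff_re.1 (Complex.conj_eq_iff_im.2 him')).symm
    rw [e, Complex.norm_real, Real.norm_eq_abs, abs_of_pos hre'] at hc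
    rw [e, hc, Complex.ofReal_one]
  rw [hz z hz', hc1, one_mul]

/-- Fatou's theorem determines the representing function `k i` almost everywhere: it is `F i` minus
half the contribution of the other components. That contribution is continuous on the slit, and
minus one half of it is the correction. -/
lemma IsVectorSzego.exists_isCorrection (hI : DisjointIntervals a b)
    (hS : ∀ i, IsSzego (μ i) (a i) (b i)) {S : Fin d → OnePoint ℂ → ℂ}
    (h : IsVectorSzego μ a b S) : ∃ g : BoundarySpace d, IsCorrection μ a b g ∧
      ∀ i, ∀ z ∈ slitDomain (a i) (b i), S i z = outerExp (a i) (b i) (logSzego μ a b g i) z := by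
  choose k hk hkS using fun i => (h i).1.exists_eq_exp (hI.lt i) (h i).2.2.1.1 (h i).2.2.1.2
  set I : Fin d → ℝ → ℝ := fun i s => ∑ j ∈ Finset.univ.erase i, (herglotz (k j)
    (phi (a j) (b j) ((xmap (a i) (b i) s : ℂ) : OnePoint ℂ))).re with hIdef
  set v : Fin d → ℝ → ℝ := fun i s => halfLogDensity (μ i) (a i) (b i) s - 1 / 2 * I i s with hv
  have hkv : ∀ i, ∀ᵐ t ∂angleMeasure, k i t = v i (Real.cos t) := by
    intro i
    filter_upwards [ae_angle_of_ae_Icc (hI.lt i) (h i).2.2.2, ae_sin_ne_zero,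
      ae_tendsto_re_herglotz_phi (hI.lt i) (hk i),
      arcsineDensity_pos_of_isSzego (hI.lt i) (hS i)] with t ht hsin hF hpos
    obtain ⟨p, m, hp, hm, hpe, hme⟩ := ht
    set x := xmap (a i) (b i) (Real.cos t) with hx
    have hprod : ‖∏ j ∈ Finset.univ.erase i, S j ((x : ℂ) : OnePoint ℂ)‖ =
        Real.exp (I i (Real.cos t)) := by
      rw [norm_prod, hIdef, Real.exp_sum]
      refine Finset.prod_congr rfl fun j hj => ?_
      rw [hkS j _ (hI.xmap_mem hj (cos_mem_Icc t)), Complex.norm_exp]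
    -- Taking norms in the boundary identity loses nothing that is needed here: the logarithm of the
    -- moduli is the linear equation for `k i t`.
    have key : ∀ q : ℝ, q = Real.exp (k i t) →
        (q : ℂ) ^ 2 * ∏ j ∈ Finset.univ.erase i, S j ((x : ℂ) : OnePoint ℂ) =
          (arcsineDensity (μ i) (a i) (b i) x : ℂ) → k i t = v i (Real.cos t) := by
      rintro q rfl hq
      have h1 := congrArg norm hq
      rw [norm_mul, hprod, norm_pow, Complex.norm_real, Complex.norm_real, Real.norm_eq_abs,
        Real.norm_eq_abs, abs_of_pos (Real.exp_pos _), abs_of_pos hpos.1,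
        ← exp_two_mul_halfLogDensity hpos.1, ← Real.exp_nat_mul, ← Real.exp_add,
        Real.exp_eq_exp] at h1
      simp only [hv]
      push_cast at h1
      linarith
    have hlim : ∀ σ q : ℝ, |σ| = 1 → σ * Real.sin t < 0 →
        Tendsto (fun z : ℂ => ‖S i (z : OnePoint ℂ)‖)
          (𝓝[{z : ℂ | |z.re - x| < 1 * (σ * z.im)}] (x : ℂ)) (𝓝 q) → q = Real.exp (k i t) := by
      intro σ q hσ hst hq
      have := neBot_cone x one_pos hσ
      refine tendsto_nhds_unique (hq.congr' ?_) (hF σ 1 hσ hst one_pos)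
      filter_upwards [self_mem_nhdsWithin] with z (hz : |z.re - x| < 1 * (σ * z.im))
      rw [hkS i]
      refine coe_mem_slitDomain_of_im_ne_zero fun h0 => ?_
      rw [h0, mul_zero, mul_zero] at hz
      exact absurd hz (abs_nonneg _).not_gt
    -- Angles with negative sine are reached from above the slit, the others from below.
    rcases lt_or_gt_of_ne hsin with hs | hs
    · refine key p (hlim 1 p (by simp) (by linarith) ?_) hpe
      simpa only [one_mul] using hp 1 one_pos
    · refine key m (hlim (-1) m (by simp) (by linarith) ?_) hme
      simpa only [neg_mul, one_mul] using hm 1 one_pos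
  have hvi : ∀ i, IntegrableAngle fun t => v i (Real.cos t) := fun i => (hk i).congr (hkv i)
  have hvI : ∀ i s, interaction a b v i s = I i s := fun i s =>
    Finset.sum_congr rfl fun j _ => by rw [herglotz_congr (hkv j)]
  refine ⟨-(1 / 2 : ℝ) • interactionFun hI hvi, ?_, ?_⟩
  all_goals
    set g : BoundarySpace d := -(1 / 2 : ℝ) • interactionFun hI hvi with hg
    have hgI : ∀ i (s : Set.Icc (-1 : ℝ) 1), g (i, s) = -(1 / 2) * I i s := fun i s => by
      rw [hg, BoundedContinuousFunction.smul_apply, smul_eq_mul, interactionFun_apply, hvI]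
    have hgv : ∀ i t, logSzego μ a b g i (Real.cos t) = v i (Real.cos t) := fun i t => by
      have e := comp_of_mem g i ⟨_, cos_mem_Icc t⟩
      rw [hgI] at e
      simp only at e
      rw [logSzego, e, hv]
      ring
  · intro i s
    have e : interaction a b (logSzego μ a b g) i s = interaction a b v i s := by
      simp only [interaction, hgv]
    rw [e, hvI, hgI]
    ring
  · intro i z hz
    simp only [outerExp, hgv]
    rw [hkS i z hz, herglotz_congr (hkv i)]

end Measures

/-! ### Stability under perturbation of the intervals -/

/-- On a compact space, joint convergence at every point is uniform convergence. This reduces the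
uniform estimates on the corrections to the joint continuity lemmas. -/
lemma eventually_forall_abs_le {X ι : Type*} [TopologicalSpace X] [CompactSpace X] {l : Filter ι}
    {Φ : ι → X → ℝ} (h : ∀ x, Tendsto (fun y : ι × X => Φ y.1 y.2) (l ×ˢ 𝓝 x) (𝓝 0)) {δ : ℝ}
    (hδ : 0 < δ) : ∀ᶠ n in l, ∀ x, |Φ n x| ≤ δ := by
  have hu : TendstoUniformly Φ (fun _ => 0) l := by
    rw [← tendstoLocallyUniformly_iff_tendstoUniformly_of_compactSpace,
      tendstoLocallyUniformly_iff_forall_tendsto]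
    intro x
    exact (tendsto_const_nhds.prodMk_nhds (h x)).mono_right (nhds_le_uniformity 0)
  filter_upwards [Metric.tendstoUniformly_iff.1 hu δ hδ] with n hn x
  have := hn x
  rw [Real.dist_eq, zero_sub, abs_neg] at this
  exact this.le

section Joint

variable {α : Type*} {l : Filter α} {a' b' : α → Fin d → ℝ} {s : α → ℝ} {s₀ : ℝ}

lemma tendsto_phi_xmap (hI : DisjointIntervals a b)
    (ha : ∀ i, Tendsto (fun x => a' x i) l (𝓝 (a i)))
    (hb : ∀ i, Tendsto (fun x => b' x i) l (𝓝 (b i))) (hs : Tendsto s l (𝓝 s₀))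
    (hs₀ : s₀ ∈ Set.Icc (-1 : ℝ) 1) {i j : Fin d} (hj : j ∈ Finset.univ.erase i) :
    Tendsto (fun x => phi (a' x j) (b' x j) ((xmap (a' x i) (b' x i) (s x) : ℂ) : OnePoint ℂ)) l
      (𝓝 (phi (a j) (b j) ((xmap (a i) (b i) s₀ : ℂ) : OnePoint ℂ))) := by
  refine tendsto_phi (hI.lt j) (ha j) (hb j) ?_ (hI.xmap_mem hj hs₀)
  refine (OnePoint.continuous_coe.tendsto _).comp ((Complex.continuous_ofReal.tendsto _).comp ?_)
  unfold xmap
  exact (((ha i).add (hb i)).div_const 2).add ((((hb i).sub (ha i)).div_const 2).mul hs)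

lemma tendsto_interaction (hI : DisjointIntervals a b)
    (ha : ∀ i, Tendsto (fun x => a' x i) l (𝓝 (a i)))
    (hb : ∀ i, Tendsto (fun x => b' x i) l (𝓝 (b i))) (hs : Tendsto s l (𝓝 s₀))
    (hs₀ : s₀ ∈ Set.Icc (-1 : ℝ) 1) {v : α → Fin d → ℝ → ℝ} {v₀ : Fin d → ℝ → ℝ}
    (hv₀ : ∀ j, IntegrableAngle fun t => v₀ j (Real.cos t))
    (hv : ∀ᶠ x in l, ∀ j, IntegrableAngle fun t => v x j (Real.cos t))
    (hvl : ∀ j, Tendsto (fun x => ∫ t, |v x j (Real.cos t) - v₀ j (Real.cos t)| ∂angleMeasure) l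
      (𝓝 0)) (i : Fin d) :
    Tendsto (fun x => interaction (a' x) (b' x) (v x) i (s x)) l
      (𝓝 (interaction a b v₀ i s₀)) :=
  tendsto_finsetSum _ fun j hj => (Complex.continuous_re.tendsto _).comp
    (tendsto_herglotz (hv₀ j) (hI.norm_phi_lt hj hs₀) (hv.mono fun _ h => h j) (hvl j)
      (tendsto_phi_xmap hI ha hb hs hs₀ hj))

end Joint

variable {μ : Fin d → Measure ℝ} [∀ i, IsFiniteMeasure (μ i)] {an bn : ℕ → Fin d → ℝ}

lemma tendsto_integral_logSzego {g : BoundarySpace d} {gn : ℕ → BoundarySpace d}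
    (hI : DisjointIntervals a b) (hIn : ∀ n, DisjointIntervals (an n) (bn n))
    (hS : ∀ i, IsSzego (μ i) (a i) (b i))
    (hSn : ∀ᶠ n in atTop, ∀ i, IsSzego (μ i) (an n i) (bn n i)) (i : Fin d)
    (hF : Tendsto (fun n => ∫ t, |halfLogDensity (μ i) (an n i) (bn n i) (Real.cos t) -
      halfLogDensity (μ i) (a i) (b i) (Real.cos t)| ∂angleMeasure) atTop (𝓝 0))
    (hg : Tendsto (fun n => ‖gn n - g‖) atTop (𝓝 0)) :
    Tendsto (fun n => ∫ t, |logSzego μ (an n) (bn n) (gn n) i (Real.cos t) -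
      logSzego μ a b g i (Real.cos t)| ∂angleMeasure) atTop (𝓝 0) := by
  have h := hF.add (hg.const_mul (2 * Real.pi))
  rw [mul_zero, add_zero] at h
  refine squeeze_zero' (Eventually.of_forall fun n => integral_nonneg fun t => abs_nonneg _) ?_ h
  filter_upwards [hSn] with n hn
  have h1 := integrableAngle_logSzego (hIn n) hn (gn n) i
  have h2 := integrableAngle_logSzego hI hS g i
  have h3 : IntegrableAngle fun t => halfLogDensity (μ i) (an n i) (bn n i) (Real.cos t) -
      halfLogDensity (μ i) (a i) (b i) (Real.cos t) :=
    (integrableAngle_halfLogDensity ((hIn n).lt i) (hn i)).sub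
      (integrableAngle_halfLogDensity (hI.lt i) (hS i))
  refine le_trans ?_ (add_le_add_right (integral_abs_comp_le (gn n - g) i) _)
  rw [← integral_add h3.abs (integrableAngle_comp (gn n - g) i).abs]
  refine integral_mono (h1.sub h2).abs (h3.abs.add (integrableAngle_comp (gn n - g) i).abs)
    fun t => ?_
  refine le_trans (le_of_eq ?_) (abs_add_le _ _)
  have e : comp (gn n - g) i (Real.cos t) = comp (gn n) i (Real.cos t) - comp g i (Real.cos t) :=
    rfl
  simp only [logSzego, e]
  congr 1
  ring

/-- The corrections depend continuously on the intervals. -/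
lemma tendsto_correction {g : BoundarySpace d} {gn : ℕ → BoundarySpace d}
    (hI : DisjointIntervals a b) (hIn : ∀ n, DisjointIntervals (an n) (bn n))
    (hS : ∀ i, IsSzego (μ i) (a i) (b i))
    (hSn : ∀ᶠ n in atTop, ∀ i, IsSzego (μ i) (an n i) (bn n i))
    (ha : ∀ i, Tendsto (fun n => an n i) atTop (𝓝 (a i)))
    (hb : ∀ i, Tendsto (fun n => bn n i) atTop (𝓝 (b i)))
    (hF : ∀ i, Tendsto (fun n => ∫ t, |halfLogDensity (μ i) (an n i) (bn n i) (Real.cos t) -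
      halfLogDensity (μ i) (a i) (b i) (Real.cos t)| ∂angleMeasure) atTop (𝓝 0))
    (hg : IsCorrection μ a b g) (hgn : ∀ᶠ n in atTop, IsCorrection μ (an n) (bn n) (gn n)) :
    Tendsto (fun n => ‖gn n - g‖) atTop (𝓝 0) := by
  have hfst : ∀ s : Set.Icc (-1 : ℝ) 1, Tendsto Prod.fst ((atTop : Filter ℕ) ×ˢ 𝓝 s) atTop :=
    fun s => tendsto_fst
  have hsnd : ∀ s : Set.Icc (-1 : ℝ) 1, Tendsto (fun y : ℕ × Set.Icc (-1 : ℝ) 1 => (y.2 : ℝ))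
      ((atTop : Filter ℕ) ×ˢ 𝓝 s) (𝓝 (s : ℝ)) :=
    fun s => (continuous_subtype_val.tendsto s).comp tendsto_snd
  -- `D` bounds the operator norm of the difference of the two interaction operators. `R` is the
  -- residual left when the limiting correction `g` is put into the perturbed equation.
  set D : ℕ → Fin d → Set.Icc (-1 : ℝ) 1 → ℝ := fun n i s => ∑ j ∈ Finset.univ.erase i,
    diskModulus (phi (an n j) (bn n j) ((xmap (an n i) (bn n i) s : ℂ) : OnePoint ℂ))
      (phi (a j) (b j) ((xmap (a i) (b i) s : ℂ) : OnePoint ℂ)) * (2 * Real.pi) with hD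
  set R : ℕ → Fin d → Set.Icc (-1 : ℝ) 1 → ℝ := fun n i s =>
    interaction (an n) (bn n) (logSzego μ (an n) (bn n) g) i s -
      interaction a b (logSzego μ a b g) i s with hR
  have hDlim : ∀ i s, Tendsto (fun y : ℕ × Set.Icc (-1 : ℝ) 1 => D y.1 i y.2)
      (atTop ×ˢ 𝓝 s) (𝓝 0) := by
    intro i s
    have : Tendsto (fun y : ℕ × Set.Icc (-1 : ℝ) 1 => D y.1 i y.2)
      (atTop ×ˢ 𝓝 s) (𝓝 (∑ j ∈ Finset.univ.erase i, 0 * (2 * Real.pi))) :=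
      tendsto_finsetSum _ fun j hj => Tendsto.mul_const _ (tendsto_diskModulus
        (hI.norm_phi_lt hj s.2)
        (tendsto_phi_xmap hI (a' := fun y : ℕ × Set.Icc (-1 : ℝ) 1 => an y.1)
          (b' := fun y => bn y.1) (fun i => (ha i).comp (hfst s)) (fun i => (hb i).comp (hfst s))
          (hsnd s) s.2 hj)
        (((hI.continuous_phi_xmap hj).tendsto s).comp tendsto_snd))
    simpa using this
  have hRlim : ∀ i s, Tendsto (fun y : ℕ × Set.Icc (-1 : ℝ) 1 => R y.1 i y.2)
      (atTop ×ˢ 𝓝 s) (𝓝 0) := by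
    intro i s
    have h1 := tendsto_interaction hI (a' := fun y : ℕ × Set.Icc (-1 : ℝ) 1 => an y.1)
      (b' := fun y => bn y.1) (fun i => (ha i).comp (hfst s)) (fun i => (hb i).comp (hfst s))
      (hsnd s) s.2 (v := fun y => logSzego μ (an y.1) (bn y.1) g) (v₀ := logSzego μ a b g)
      (integrableAngle_logSzego hI hS g)
      ((hfst s).eventually (hSn.mono fun n hn => integrableAngle_logSzego (hIn n) hn g))
      (fun j => (tendsto_integral_logSzego (gn := fun _ => g) hI hIn hS hSn j (hF j)
        (by simp)).comp (hfst s)) i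
    have h2 := tendsto_interaction hI (a' := fun _ : ℕ × Set.Icc (-1 : ℝ) 1 => a)
      (b' := fun _ => b) (fun i => tendsto_const_nhds) (fun i => tendsto_const_nhds)
      (hsnd s) s.2 (v := fun _ => logSzego μ a b g) (v₀ := logSzego μ a b g)
      (integrableAngle_logSzego hI hS g)
      (Eventually.of_forall fun _ => integrableAngle_logSzego hI hS g)
      (fun j => by simp) i
    have := h1.sub h2
    rwa [sub_self] at this
  obtain ⟨K, hK, hKb⟩ := exists_norm_le_interaction hI
  rw [Metric.tendsto_nhds]
  intro ε hε
  -- Chosen so that `K * δ ≤ min 1 ε / 4`. The estimate `‖e‖ ≤ K * δ * (‖e‖ + 1)` then lets the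
  -- `‖e‖` on the right be absorbed, thanks to the `1` in the minimum, and gives `‖e‖ ≤ min 1 ε / 3
  -- < ε`.
  set δ := min 1 ε / (4 * (K + 1)) with hδ
  have hm : 0 < min 1 ε := lt_min one_pos hε
  have hδ0 : 0 < δ := by positivity
  have hKδ : K * δ ≤ min 1 ε / 4 := by
    have : (K + 1) * δ = min 1 ε / 4 := by rw [hδ]; field_simp
    nlinarith
  filter_upwards [
    eventually_all.2 fun i => eventually_forall_abs_le (Φ := fun n => D n i) (hDlim i) hδ0,
    eventually_all.2 fun i => eventually_forall_abs_le (Φ := fun n => R n i) (hRlim i) hδ0,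
    hgn, hSn]
    with n hn1 hn2 hn3 hn4
  set e := gn n - g with he
  have hbound : ‖(2 : ℝ) • e + interactionCLM hI e‖ ≤ δ * ‖e‖ + δ := by
    refine (BoundedContinuousFunction.norm_le (by positivity)).2 fun ⟨i, s⟩ => ?_
    rw [BoundedContinuousFunction.add_apply, BoundedContinuousFunction.smul_apply,
      interactionCLM_apply, smul_eq_mul, Real.norm_eq_abs]
    have h1 : interaction (an n) (bn n) (logSzego μ (an n) (bn n) (gn n)) i s =
        interaction (an n) (bn n) (logSzego μ (an n) (bn n) g) i s +
          interaction (an n) (bn n) (comp e) i s := by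
      rw [← interaction_add (hIn n) (integrableAngle_logSzego (hIn n) hn4 g)
        (integrableAngle_comp e) i s.2]
      congr 1
      funext j s
      change _ + comp (gn n) j s = _ + comp g j s + (comp (gn n) j s - comp g j s)
      ring
    have h2 := hn3 i s
    have h3 := hg i s
    have h4 : e (i, s) = gn n (i, s) - g (i, s) := rfl
    have h5 : |interaction (an n) (bn n) (comp e) i s - interaction a b (comp e) i s| ≤
        δ * ‖e‖ := by
      refine le_trans ?_ (mul_le_mul_of_nonneg_right ((le_abs_self _).trans (hn1 i s))
        (norm_nonneg e))
      simp only [hD, interaction]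
      rw [← Finset.sum_sub_distrib, Finset.sum_mul]
      refine (Finset.abs_sum_le_sum_abs _ _).trans (Finset.sum_le_sum fun j hj => ?_)
      rw [mul_assoc]
      exact abs_re_herglotz_comp_sub_le e j ((hIn n).norm_phi_lt hj s.2) (hI.norm_phi_lt hj s.2)
    have h6 := hn2 i s
    -- Subtracting the two correction equations leaves the limiting operator applied to `e`, with
    -- the residual and the change of operator on the right.
    have h7 : 2 * e (i, s) + interaction a b (comp e) i s = -(R n i s) -
        (interaction (an n) (bn n) (comp e) i s - interaction a b (comp e) i s) := by
      simp only [hR]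
      rw [h1] at h2
      rw [h4]
      linarith
    rw [h7]
    refine (abs_sub _ _).trans ?_
    rw [abs_neg]
    linarith
  have h1 := (hKb e).trans (mul_le_mul_of_nonneg_left hbound hK)
  rw [dist_zero_right, norm_norm]
  have h2 : min 1 ε ≤ 1 := min_le_left _ _
  have h3 : min 1 ε ≤ ε := min_le_right _ _
  have h4 : K * (δ * ‖e‖ + δ) = K * δ * (‖e‖ + 1) := by ring
  have h5 := mul_le_mul_of_nonneg_right hKδ (add_nonneg (norm_nonneg e) zero_le_one)
  nlinarith [norm_nonneg e]

lemma tendsto_outerExp {α : Type*} {l : Filter α} {a' b' : α → ℝ} {a b : ℝ} {v : α → ℝ → ℝ}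
    {v₀ : ℝ → ℝ} {z : α → OnePoint ℂ} {z₀ : OnePoint ℂ} (hab : a < b)
    (ha : Tendsto a' l (𝓝 a)) (hb : Tendsto b' l (𝓝 b))
    (hv₀ : IntegrableAngle fun t => v₀ (Real.cos t))
    (hv : ∀ᶠ x in l, IntegrableAngle fun t => v x (Real.cos t))
    (hvl : Tendsto (fun x => ∫ t, |v x (Real.cos t) - v₀ (Real.cos t)| ∂angleMeasure) l (𝓝 0))
    (hz : Tendsto z l (𝓝 z₀)) (hz₀ : z₀ ∈ slitDomain a b) :
    Tendsto (fun x => outerExp (a' x) (b' x) (v x) (z x)) l (𝓝 (outerExp a b v₀ z₀)) :=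
  (Complex.continuous_exp.tendsto _).comp (tendsto_herglotz hv₀ (norm_phi_lt_one hab hz₀) hv hvl
    (tendsto_phi hab ha hb hz hz₀))

end VectorSzego

end

/-! ### Existence and convergence of vector Szegő functions -/

theorem proposition3p2 {d : ℕ} (μ : Fin d → Measure ℝ) [∀ i, IsFiniteMeasure (μ i)]
    (hcomp : ∀ i, IsCompact (μ i).support)
    (a b : Fin d → ℝ) (hab : ∀ i, a i < b i)
    (hdisj : ∀ i j, i ≠ j → Disjoint (Set.Icc (a i) (b i)) (Set.Icc (a j) (b j)))
    (hμ : ∀ i, VectorSzego.IsUniformlySzego (μ i) (a i) (b i))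
    (an bn : ℕ → Fin d → ℝ) (habn : ∀ n i, an n i < bn n i)
    (hdisjn : ∀ n i j, i ≠ j →
      Disjoint (Set.Icc (an n i) (bn n i)) (Set.Icc (an n j) (bn n j)))
    (hsub : ∀ n i, Set.Icc (an n i) (bn n i) ⊆ VectorSzego.hullSupport (μ i))
    (han : ∀ i, Tendsto (fun n => an n i) atTop (𝓝 (a i)))
    (hbn : ∀ i, Tendsto (fun n => bn n i) atTop (𝓝 (b i))) :
    (∃ S : Fin d → OnePoint ℂ → ℂ, VectorSzego.IsVectorSzego μ a b S) ∧
    (∀ᶠ n in atTop, ∃ S : Fin d → OnePoint ℂ → ℂ,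
      VectorSzego.IsVectorSzego μ (an n) (bn n) S) ∧
    ∀ (S : Fin d → OnePoint ℂ → ℂ) (Sn : ℕ → Fin d → OnePoint ℂ → ℂ),
      VectorSzego.IsVectorSzego μ a b S →
      (∀ᶠ n in atTop, VectorSzego.IsVectorSzego μ (an n) (bn n) (Sn n)) →
      ∀ i, TendstoLocallyUniformlyOn (fun n => Sn n i) (S i) atTop
        (VectorSzego.slitDomain (a i) (b i)) := by
  open VectorSzego in
  have hI : DisjointIntervals a b := ⟨hab, hdisj⟩
  have hIn : ∀ n, DisjointIntervals (an n) (bn n) := fun n => ⟨habn n, hdisjn n⟩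
  have hS : ∀ i, IsSzego (μ i) (a i) (b i) := fun i => (hμ i).1
  have hUSz := fun i => (hμ i).2 (fun n => an n i) (fun n => bn n i) (fun n => habn n i)
    (fun n => hsub n i) (han i) (hbn i)
  have hSn : ∀ᶠ n in atTop, ∀ i, IsSzego (μ i) (an n i) (bn n i) :=
    eventually_all.2 fun i => eventually_atTop.2 (hUSz i).1
  refine ⟨?_, ?_, fun S Sn hVS hVSn i => ?_⟩
  · obtain ⟨g, hg⟩ := exists_isCorrection hI hS
    exact ⟨_, isVectorSzego_outerExp hI hS hg⟩
  · filter_upwards [hSn] with n hn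
    obtain ⟨g, hg⟩ := exists_isCorrection (hIn n) hn
    exact ⟨_, isVectorSzego_outerExp (hIn n) hn hg⟩
  · obtain ⟨g, hg, hSg⟩ := hVS.exists_isCorrection hI hS
    have hex : ∀ᶠ n in atTop, ∃ g : BoundarySpace d, IsCorrection μ (an n) (bn n) g ∧
        ∀ i, ∀ z ∈ slitDomain (an n i) (bn n i),
          Sn n i z = outerExp (an n i) (bn n i) (logSzego μ (an n) (bn n) g i) z := by
      filter_upwards [hSn, hVSn] with n hn hn'
      exact hn'.exists_isCorrection (hIn n) hn
    obtain ⟨gn, hgn⟩ := hex.choice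
    have hF := fun i => tendsto_integral_halfLogDensity (hab i) (hS i) (fun n => habn n i)
      (eventually_all.1 hSn i) (han i) (hbn i) (hUSz i).2
    have hlim := tendsto_correction hI hIn hS hSn han hbn hF hg (hgn.mono fun _ h => h.1)
    have hL := tendsto_integral_logSzego hI hIn hS hSn i (hF i) hlim
    have hk := integrableAngle_logSzego hI hS g i
    -- On an open set locally uniform convergence can be tested by letting index and point vary
    -- together. Both `S i` and `Sn n i` are shown to tend to the same value, so the pair tends to
    -- the diagonal.
    rw [(isOpen_slitDomain (a i) (b i)).tendstoLocallyUniformlyOn_iff_forall_tendsto]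
    intro z hz
    have hfst : Tendsto (Prod.fst : ℕ × OnePoint ℂ → ℕ) (atTop ×ˢ 𝓝 z) atTop := tendsto_fst
    have hsnd : Tendsto (Prod.snd : ℕ × OnePoint ℂ → OnePoint ℂ) (atTop ×ˢ 𝓝 z) (𝓝 z) :=
      tendsto_snd
    have h1 : Tendsto (fun y : ℕ × OnePoint ℂ => S i y.2) (atTop ×ˢ 𝓝 z)
        (𝓝 (outerExp (a i) (b i) (logSzego μ a b g i) z)) := by
      refine (tendsto_outerExp (v := fun _ => logSzego μ a b g i) (hab i) tendsto_const_nhds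
        tendsto_const_nhds hk (Eventually.of_forall fun _ => hk) (by simp) hsnd hz).congr' ?_
      filter_upwards [hsnd.eventually ((isOpen_slitDomain (a i) (b i)).mem_nhds hz)] with y hy
      exact (hSg i _ hy).symm
    have h2 : Tendsto (fun y : ℕ × OnePoint ℂ => Sn y.1 i y.2) (atTop ×ˢ 𝓝 z)
        (𝓝 (outerExp (a i) (b i) (logSzego μ a b g i) z)) := by
      refine (tendsto_outerExp (v := fun y : ℕ × OnePoint ℂ =>
        logSzego μ (an y.1) (bn y.1) (gn y.1) i) (hab i) ((han i).comp hfst) ((hbn i).comp hfst) hk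
        (hfst.eventually (hSn.mono fun n hn => integrableAngle_logSzego (hIn n) hn (gn n) i))
        (hL.comp hfst) hsnd hz).congr' ?_
      filter_upwards [hfst.eventually hgn, eventually_mem_slitDomain (hab i) ((han i).comp hfst)
        ((hbn i).comp hfst) hsnd hz] with y hy hy'
      exact (hy.2 i _ hy').symm
    exact (h1.prodMk_nhds h2).mono_right (nhds_le_uniformity _)
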